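/- Let $d\ge 1$. Let $\xi_1,\dots,\xi_d$ be an enumeration of the roots of $P_d(t)=\prod_{j=1}^d(t-2j+1)-1$ (they are real and pairwise distinct), let $V=(\xi_i^{\,j-1})_{i,j=1}^d$, $T_n=(n\,|\det V|)^{-1/d}\,V$, and let Frolov's cubature rule be $$Q_n(f)=\frac1n\sum_{x\in T_n(\mathbb Z^d)\cap[0,1)^d}f(x).$$ Let $1\le p<\infty$, $1\le\theta\le\infty$ and $s>1/p$. Let $L\in\mathbb N_0$ with $L+1>s$, and let $\Psi_0,\Psi_1\in C_0^\infty(\mathbb R)$ be such that, for some $\varepsilon>0$, $\mathcal F\Psi_0(t)\ne0$ for $|t|<\varepsilon$, $\mathcal F\Psi_1(t)\neq 0$ for $\varepsilon/2<|t|<2\varepsilon$, and $D^\alpha\mathcal F\Psi_1(0)=0$ for $0\le\alpha\le L$. Put $\Psi_j(t)=2^{j-1}\Psi_1(2^{j-1}t)$ for $j\ge1$ and $\Psi_m(x)=\prod_{i=1}^d\Psi_{m_i}(x_i)$ for $m\in\mathbb N_0^d$, and for $f\in\mathcal S'(\mathbb R^d)$ let $$\|f\|_{\mathbf F^s_{p,\theta}}=\Big\|\Big(\sum_{m\in\mathbb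 N_0^d}2^{s|m|_1\theta}\,|\Psi_m*f|^\theta\Big)^{1/\theta}\Big\|_{L_p(\mathbb R^d)}$$ (with a supremum over $m$ if $\theta=\infty$). Let $\mathring{\mathbf F}^s_{p,\theta}$ be the space of all $f\in\mathcal S'(\mathbb R^d)$ with $\|f\|_{\mathbf F^s_{p,\theta}}<\infty$ and $\operatorname{supp} f\subset[0,1]^d$. Since $s>1/p$, each such $f$ is (represented by) a continuous function, and we let $$e(Q_n,\mathring{\mathbf F}^s_{p,\theta})=\sup\Big\{\Big|\int_{[0,1]^d}f(x)\,dx-Q_n(f)\Big| : f\in\mathring{\mathbf F}^s_{p,\theta},\ \|f\|_{\mathbf F^s_{p,\theta}}\le1\Big\}.$$ Then the following holds, with positive constants that do not depend on $n$ (with the convention $1/\infty=0$). (i) If $s>1/\theta$, then there are $c,C>0$ such that for all $n\ge2$ $$c\,n^{-s}(\log n)^{(d-1)(1-1/\theta)}\le e(Q_n,\mathring{\mathbf F}^s_{p,\theta})\le C\,n^{-s}(\log n)^{(d-1)(1-1/\theta)}.$$ (ii) If $s<1/\theta$, then there is $C>0$ such that for all $n\ge2$ $$e(Q_n,\mathring{\mathbf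 F}^s_{p,\theta})\le C\,n^{-s}(\log n)^{(d-1)(1-s)}.$$ (iii) If $s=1/\theta$, then there is $C>0$ such that for all $n\ge3$ $$e(Q_n,\mathring{\mathbf F}^s_{p,\theta})\le C\,n^{-s}(\log n)^{(d-1)(1-s)}(\log\log n)^{1-s}.$$ -/

import Mathlib

open MeasureTheory
open scoped ENNReal SchwartzMap FourierTransform ContDiff

namespace Frolov

noncomputable section

/-! ### The cubature rule -/

/-- `ξ` enumerates the roots of the polynomial `P_d(t) = (t - 1)(t - 3) ⋯ (t - (2d - 1)) - 1`,
which are real and pairwise different. -/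
def IsFrolovRoots {d : ℕ} (ξ : Fin d → ℝ) : Prop :=
  Function.Injective ξ ∧
    ∀ t : ℝ, ∏ j : Fin d, (t - (2 * ((j : ℕ) : ℝ) + 1)) - 1 = ∏ j : Fin d, (t - ξ j)

/-- The generator `T_n = (n |det V|)^{-1/d} V` of the lattice, where `V = (ξ_i^{j-1})_{i,j}` is the
Vandermonde matrix; thus `|det T_n| = 1/n`. (The sign of `det V` depends on the order in which the
roots are enumerated.) -/
def latticeMatrix {d : ℕ} (ξ : Fin d → ℝ) (n : ℕ) : Matrix (Fin d) (Fin d) ℝ :=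
  ((n : ℝ) * |(Matrix.vandermonde ξ).det|) ^ (-(1 / (d : ℝ))) • Matrix.vandermonde ξ

/-- The nodes: the points of the lattice `T_n(ℤ^d)` in the half-open cube `[0,1)^d`. -/
def nodes {d : ℕ} (ξ : Fin d → ℝ) (n : ℕ) : Set (EuclideanSpace ℝ (Fin d)) :=
  {x | (∃ k : Fin d → ℤ, ∀ i, x i = (latticeMatrix ξ n).mulVec (fun j => (k j : ℝ)) i) ∧
    ∀ i, 0 ≤ x i ∧ x i < 1}

/-- The cubature rule `Q_n(g) = n⁻¹ ∑_{x ∈ T_n(ℤ^d) ∩ [0,1)^d} g(x)`; the sum is finite, see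
`finite_nodes`. -/
def rule {d : ℕ} (ξ : Fin d → ℝ) (n : ℕ) (g : EuclideanSpace ℝ (Fin d) → ℂ) : ℂ :=
  (1 / (n : ℂ)) * ∑ᶠ x ∈ nodes ξ n, g x

/-! The roots of `P_d` exist, and the set of nodes is finite. -/

theorem prod_pos_of_even (k r : ℕ) :
    0 < ∏ j ∈ Finset.range (k + 2 * r), (2 * (k : ℤ) - (2 * (j : ℤ) + 1)) := by
  rw [Finset.prod_range_add]
  apply mul_pos
  · apply Finset.prod_pos
    intro j hj
    have := Finset.mem_range.1 hj
    omega
  · have h : ∀ j ∈ Finset.range (2 * r),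
        (2 * (k : ℤ) - (2 * ((k + j : ℕ) : ℤ) + 1)) = (-1) * (2 * (j : ℤ) + 1) := by
      intro j _; push_cast; ring
    rw [Finset.prod_congr rfl h, Finset.prod_mul_distrib, Finset.prod_const, Finset.card_range,
      pow_mul]
    simp only [even_two, Even.neg_pow, one_pow, one_mul]
    exact Finset.prod_pos fun j _ => by positivity

theorem exists_root_near {d i : ℕ} (hi : i < d) :
    ∃ t : ℝ, ∏ j ∈ Finset.range d, (t - (2 * (j : ℝ) + 1)) = 1 ∧
      2 * (i : ℝ) ≤ t ∧ t ≤ 2 * i + 2 ∧ (i + 1 < d → t < 2 * i + 2) := by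
  have hcont : Continuous fun t : ℝ => ∏ j ∈ Finset.range d, (t - (2 * (j : ℝ) + 1)) := by
    fun_prop
  have hzero : ∏ j ∈ Finset.range d, ((2 * (i : ℝ) + 1) - (2 * (j : ℝ) + 1)) = 0 :=
    Finset.prod_eq_zero (Finset.mem_range.2 hi) (by ring)
  rcases Nat.even_or_odd (d - i) with he | ho
  · obtain ⟨r, hr⟩ := he
    have hd : d = i + 2 * r := by omega
    have h1 : (1 : ℝ) ≤ ∏ j ∈ Finset.range d, ((2 * (i : ℝ)) - (2 * (j : ℝ) + 1)) := by
      have := prod_pos_of_even i r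
      rw [← hd] at this
      exact_mod_cast this
    obtain ⟨t, ht, hq⟩ := intermediate_value_Icc' (by linarith : 2 * (i : ℝ) ≤ 2 * i + 1)
      hcont.continuousOn (show (1 : ℝ) ∈ Set.Icc _ _ from ⟨by rw [hzero]; norm_num, h1⟩)
    exact ⟨t, hq, ht.1, by linarith [ht.2], fun _ => by linarith [ht.2]⟩
  · obtain ⟨r, hr⟩ := ho
    have hd : d = (i + 1) + 2 * r := by omega
    have hpos := prod_pos_of_even (i + 1) r
    rw [← hd] at hpos
    have h1 : (1 : ℝ) ≤ ∏ j ∈ Finset.range d, ((2 * (i : ℝ) + 2) - (2 * (j : ℝ) + 1)) := by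
      have h2 : (1 : ℝ) ≤ ∏ j ∈ Finset.range d, (2 * ((i : ℝ) + 1) - (2 * (j : ℝ) + 1)) := by
        exact_mod_cast hpos
      refine h2.trans (le_of_eq (Finset.prod_congr rfl fun j _ => by ring))
    obtain ⟨t, ht, hq⟩ := intermediate_value_Icc (by linarith : 2 * (i : ℝ) + 1 ≤ 2 * i + 2)
      hcont.continuousOn (show (1 : ℝ) ∈ Set.Icc _ _ from ⟨by rw [hzero]; norm_num, h1⟩)
    refine ⟨t, hq, by linarith [ht.1], ht.2, fun hid => lt_of_le_of_ne ht.2 fun hte => ?_⟩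
    have hdvd : (-3 : ℤ) ∣ ∏ j ∈ Finset.range d, (2 * ((i + 1 : ℕ) : ℤ) - (2 * (j : ℤ) + 1)) := by
      have hm : i + 2 ∈ Finset.range d := Finset.mem_range.2 (by omega)
      refine dvd_trans (dvd_of_eq ?_) (Finset.dvd_prod_of_mem _ hm)
      push_cast; ring
    have hone : ∏ j ∈ Finset.range d, (2 * ((i + 1 : ℕ) : ℤ) - (2 * (j : ℤ) + 1)) = 1 := by
      have h2 : ∏ j ∈ Finset.range d, (2 * ((i : ℝ) + 1) - (2 * (j : ℝ) + 1)) = 1 := by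
        refine (Finset.prod_congr rfl fun j _ => ?_).trans hq
        linarith
      exact_mod_cast h2
    rw [hone] at hdvd
    norm_num at hdvd

theorem exists_isFrolovRoots (d : ℕ) (hd : 1 ≤ d) : ∃ ξ : Fin d → ℝ, IsFrolovRoots ξ := by
  choose ξ h1 h2 h3 h4 using fun i : Fin d => exists_root_near i.2
  have hinj : Function.Injective ξ := by
    refine StrictMono.injective fun a b hab => ?_
    have hab' : (a : ℕ) + 1 ≤ b := hab
    have h5 : ((a : ℕ) : ℝ) + 1 ≤ ((b : ℕ) : ℝ) := by exact_mod_cast hab'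
    have := h4 a (by omega)
    linarith [h2 b]
  refine ⟨ξ, hinj, fun t => ?_⟩
  have hdeg : ∀ η : Fin d → ℝ, (∏ j : Fin d, (Polynomial.X - Polynomial.C (η j))).natDegree = d := by
    intro η
    rw [Polynomial.natDegree_prod_of_monic _ _ fun j _ => Polynomial.monic_X_sub_C _]
    simp
  have hmon : ∀ η : Fin d → ℝ, (∏ j : Fin d, (Polynomial.X - Polynomial.C (η j))).Monic :=
    fun η => Polynomial.monic_prod_of_monic _ _ fun j _ => Polynomial.monic_X_sub_C _
  set A : Polynomial ℝ :=
    ∏ j : Fin d, (Polynomial.X - Polynomial.C (2 * ((j : ℕ) : ℝ) + 1)) with hA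
  set B : Polynomial ℝ := ∏ j : Fin d, (Polynomial.X - Polynomial.C (ξ j)) with hB
  have hA0 : A.natDegree = d := hdeg _
  have hB0 : B.natDegree = d := hdeg _
  have hlt : (A - B - 1).natDegree < d := by
    have h5 : (A - B).natDegree < d := by
      by_cases h0 : A - B = 0
      · rw [h0, Polynomial.natDegree_zero]; omega
      · rw [← hA0]
        refine Polynomial.natDegree_lt_natDegree h0 (Polynomial.degree_sub_lt_left ?_ (hmon _).ne_zero ?_)
        · rw [Polynomial.degree_eq_natDegree (hmon _).ne_zero,
            Polynomial.degree_eq_natDegree (hmon _).ne_zero, ← hA, ← hB, hA0, hB0]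
        · rw [(hmon _).leadingCoeff, (hmon _).leadingCoeff]
    refine lt_of_le_of_lt (Polynomial.natDegree_sub_le _ _) ?_
    rw [Polynomial.natDegree_one]
    omega
  have hz : A - B - 1 = 0 := by
    refine Polynomial.eq_zero_of_natDegree_lt_card_of_eval_eq_zero _ hinj (fun i => ?_)
      (by simpa using hlt)
    have h6 := h1 i
    rw [Finset.prod_range fun j : ℕ => (ξ i - (2 * (j : ℝ) + 1))] at h6
    have h7 : ∏ j : Fin d, (ξ i - ξ j) = 0 := Finset.prod_eq_zero (Finset.mem_univ i) (sub_self _)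
    simp only [hA, hB, Polynomial.eval_sub, Polynomial.eval_prod, Polynomial.eval_X,
      Polynomial.eval_C, Polynomial.eval_one, h6, h7]
    norm_num
  have h8 := congrArg (Polynomial.eval t) hz
  simp only [hA, hB, Polynomial.eval_sub, Polynomial.eval_prod, Polynomial.eval_X,
      Polynomial.eval_C, Polynomial.eval_one, Polynomial.eval_zero] at h8
  linarith

theorem finite_nodes {d : ℕ} {ξ : Fin d → ℝ} (hξ : IsFrolovRoots ξ) {n : ℕ} (hn : 1 ≤ n) :
    (nodes ξ n).Finite := by
  set M := latticeMatrix ξ n with hM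
  have hV : (Matrix.vandermonde ξ).det ≠ 0 := Matrix.det_vandermonde_ne_zero_iff.2 hξ.1
  have hn' : (0 : ℝ) < n := by exact_mod_cast hn
  have hdet : IsUnit M.det := by
    rw [isUnit_iff_ne_zero, hM, latticeMatrix, Matrix.det_smul]
    exact mul_ne_zero (pow_ne_zero _ (Real.rpow_pos_of_pos
      (mul_pos hn' (abs_pos.2 hV)) _).ne') hV
  set K : ℝ := ∑ j, ∑ i, |M⁻¹ j i| with hK
  have hfin : (Set.pi Set.univ fun _ : Fin d => Set.Icc (-⌈K⌉) ⌈K⌉).Finite :=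
    Set.Finite.pi fun _ => Set.finite_Icc _ _
  refine (hfin.image fun k : Fin d → ℤ =>
    WithLp.toLp 2 (M.mulVec fun j => (k j : ℝ))).subset ?_
  rintro x ⟨⟨k, hk⟩, hx⟩
  refine ⟨k, fun j _ => ?_, by ext i; exact (hk i).symm⟩
  have hkx : (fun j => (k j : ℝ)) = M⁻¹.mulVec (fun i => x i) := by
    have : (fun i => x i) = M.mulVec (fun j => (k j : ℝ)) := funext hk
    rw [this, Matrix.mulVec_mulVec, Matrix.nonsing_inv_mul _ hdet, Matrix.one_mulVec]
  have hb : |(k j : ℝ)| ≤ K := by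
    have h1 : (k j : ℝ) = ∑ i, M⁻¹ j i * x i := congrFun hkx j
    rw [h1]
    calc |∑ i, M⁻¹ j i * x i| ≤ ∑ i, |M⁻¹ j i * x i| := Finset.abs_sum_le_sum_abs _ _
      _ ≤ ∑ i, |M⁻¹ j i| := Finset.sum_le_sum fun i _ => by
          rw [abs_mul, abs_of_nonneg (hx i).1]
          exact mul_le_of_le_one_right (abs_nonneg _) (hx i).2.le
      _ ≤ K := Finset.single_le_sum (f := fun j => ∑ i, |M⁻¹ j i|)
          (fun j _ => Finset.sum_nonneg fun i _ => abs_nonneg _) (Finset.mem_univ j)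
  have hc : |(k j : ℝ)| ≤ ((⌈K⌉ : ℤ) : ℝ) := hb.trans (Int.le_ceil K)
  exact abs_le.1 (by exact_mod_cast hc)

/-! ### Triebel-Lizorkin spaces of dominating mixed smoothness -/

/-- Local means kernels `Ψ₀, Ψ₁ ∈ C_0^∞(ℝ)`: for some `ε > 0` one has `𝓕 Ψ₀ ≠ 0` on `|t| < ε`,
`𝓕 Ψ₁ ≠ 0` on `ε/2 < |t| < 2ε`, and `D^α (𝓕 Ψ₁)(0) = 0` for `0 ≤ α ≤ L`. Here
`𝓕 f t = ∫ f(y) e^{-2πi t y} dy`. -/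
structure Kernels (L : ℕ) where
  psi0 : ℝ → ℂ
  psi1 : ℝ → ℂ
  contDiff_psi0 : ContDiff ℝ ∞ psi0
  contDiff_psi1 : ContDiff ℝ ∞ psi1
  hasCompactSupport_psi0 : HasCompactSupport psi0
  hasCompactSupport_psi1 : HasCompactSupport psi1
  tauberian : ∃ ε : ℝ, 0 < ε ∧ (∀ t : ℝ, |t| < ε → 𝓕 psi0 t ≠ 0) ∧
    ∀ t : ℝ, ε / 2 < |t| → |t| < 2 * ε → 𝓕 psi1 t ≠ 0
  moments : ∀ α ≤ L, iteratedDeriv α (𝓕 psi1) 0 = 0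

variable {L d : ℕ}

/-- `Ψ_0` is given and `Ψ_j(t) = 2^{j-1} Ψ₁(2^{j-1} t)` for `j ≥ 1`. -/
def Kernels.psi (Ψ : Kernels L) : ℕ → ℝ → ℂ
  | 0 => Ψ.psi0
  | j + 1 => fun t => 2 ^ j * Ψ.psi1 (2 ^ j * t)

/-- The tensor product `Ψ_m(x) = ∏ i, Ψ_{m_i}(x_i)`. -/
def Kernels.tensor (Ψ : Kernels L) (m : Fin d → ℕ) (x : EuclideanSpace ℝ (Fin d)) : ℂ :=
  ∏ i, Ψ.psi (m i) (x i)

theorem Kernels.contDiff_psi (Ψ : Kernels L) (j : ℕ) : ContDiff ℝ ∞ (Ψ.psi j) := by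
  cases j with
  | zero => exact Ψ.contDiff_psi0
  | succ j => exact contDiff_const.mul (Ψ.contDiff_psi1.comp (contDiff_const.mul contDiff_id))

theorem Kernels.hasCompactSupport_psi (Ψ : Kernels L) (j : ℕ) :
    HasCompactSupport (Ψ.psi j) := by
  cases j with
  | zero => exact Ψ.hasCompactSupport_psi0
  | succ j =>
    exact (Ψ.hasCompactSupport_psi1.comp_homeomorph
      (Homeomorph.mulLeft₀ ((2 : ℝ) ^ j) (by positivity))).mul_left

theorem Kernels.contDiff_tensor_sub (Ψ : Kernels L) (m : Fin d → ℕ)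
    (x : EuclideanSpace ℝ (Fin d)) : ContDiff ℝ ∞ fun y => Ψ.tensor m (x - y) := by
  refine contDiff_prod fun i _ => (Ψ.contDiff_psi (m i)).comp ?_
  exact (by fun_prop : ContDiff ℝ ∞ fun y : EuclideanSpace ℝ (Fin d) => x i - y i)

theorem Kernels.hasCompactSupport_tensor_sub (Ψ : Kernels L) (m : Fin d → ℕ)
    (x : EuclideanSpace ℝ (Fin d)) : HasCompactSupport fun y => Ψ.tensor m (x - y) := by
  have h : HasCompactSupport (Ψ.tensor m : EuclideanSpace ℝ (Fin d) → ℂ) := by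
    refine HasCompactSupport.intro
      (K := WithLp.toLp 2 '' (Set.pi Set.univ fun i => tsupport (Ψ.psi (m i))))
      ((isCompact_univ_pi fun i => Ψ.hasCompactSupport_psi (m i)).image
        (PiLp.continuous_toLp 2 _)) fun y hy => ?_
    by_contra hne
    refine hy ⟨fun i => y i, fun i _ => subset_tsupport _ ?_, rfl⟩
    exact (Finset.prod_ne_zero_iff.1 hne) i (Finset.mem_univ i)
  exact h.comp_homeomorph (Homeomorph.subLeft x)

/-- The test function `y ↦ Ψ_m(x - y)`. -/
def Kernels.test (Ψ : Kernels L) (m : Fin d → ℕ) (x : EuclideanSpace ℝ (Fin d)) :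
    𝓢(EuclideanSpace ℝ (Fin d), ℂ) :=
  (Ψ.hasCompactSupport_tensor_sub m x).toSchwartzMap (Ψ.contDiff_tensor_sub m x)

/-- The convolution `(Ψ_m * f)(x) = f(Ψ_m(x - ·))` with a tempered distribution `f`. -/
def Kernels.conv (Ψ : Kernels L) (m : Fin d → ℕ) (f : 𝓢'(EuclideanSpace ℝ (Fin d), ℂ))
    (x : EuclideanSpace ℝ (Fin d)) : ℂ :=
  f (Ψ.test m x)

/-- The `ℓ_θ` norm of a family of numbers in `[0,∞]`, for `0 < θ ≤ ∞`. -/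
def seqNorm {ι : Type*} (θ : ℝ≥0∞) (a : ι → ℝ≥0∞) : ℝ≥0∞ :=
  if θ = ⊤ then ⨆ m, a m else (∑' m, a m ^ θ.toReal) ^ (1 / θ.toReal)

/-- The norm of `𝐅^s_{p,θ}(ℝ^d)` (with values in `[0,∞]`),
`‖ ( ∑_{m ∈ ℕ₀^d} 2^{s |m|_1 θ} |Ψ_m * f|^θ )^{1/θ} ‖_{L_p}`, with a supremum if `θ = ∞`. -/
def Kernels.fNorm (Ψ : Kernels L) (s p : ℝ) (θ : ℝ≥0∞)
    (f : 𝓢'(EuclideanSpace ℝ (Fin d), ℂ)) : ℝ≥0∞ :=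
  (∫⁻ x, seqNorm θ (fun m : Fin d → ℕ =>
    ENNReal.ofReal ((2 : ℝ) ^ (s * ∑ i, (m i : ℝ))) * ‖Ψ.conv m f x‖ₑ) ^ p) ^ (1 / p)

/-- The unit cube `[0,1]^d`. -/
def unitCube (d : ℕ) : Set (EuclideanSpace ℝ (Fin d)) :=
  {x | ∀ i, 0 ≤ x i ∧ x i ≤ 1}

/-- The space of all `f ∈ 𝐅^s_{p,θ}(ℝ^d)` with `supp f ⊆ [0,1]^d`. -/
def Kernels.fSpace (Ψ : Kernels L) (d : ℕ) (s p : ℝ) (θ : ℝ≥0∞) :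
    Set 𝓢'(EuclideanSpace ℝ (Fin d), ℂ) :=
  {f | Ψ.fNorm s p θ f < ⊤ ∧ Distribution.dsupport f ⊆ unitCube d}

/-! ### The worst-case error -/

/-- The distribution `f` is the continuous function `g`, which vanishes outside the unit cube. -/
def IsRepresentedBy (f : 𝓢'(EuclideanSpace ℝ (Fin d), ℂ))
    (g : EuclideanSpace ℝ (Fin d) → ℂ) : Prop :=
  Continuous g ∧ (∀ x ∉ unitCube d, g x = 0) ∧ ∀ φ : 𝓢(EuclideanSpace ℝ (Fin d), ℂ),
    f φ = ∫ x, φ x * g x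

/-- The error `|∫_{[0,1]^d} g - Q_n(g)|`, where `g` is the continuous representative of `f`. The
representative is unique if it exists; if it does not, then the infimum is over the empty set and
the error is `∞`. -/
def ruleError (ξ : Fin d → ℝ) (n : ℕ) (f : 𝓢'(EuclideanSpace ℝ (Fin d), ℂ)) : ℝ≥0∞ :=
  ⨅ (g : EuclideanSpace ℝ (Fin d) → ℂ) (_ : IsRepresentedBy f g),
    ‖(∫ x in unitCube d, g x) - rule ξ n g‖ₑ

/-- The worst-case error `e(Q_n, 𝐅)`: the supremum of the error over the unit ball of the space of
all `f ∈ 𝐅^s_{p,θ}(ℝ^d)` with `supp f ⊆ [0,1]^d`. -/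
def worstCaseError (ξ : Fin d → ℝ) (n : ℕ) (Ψ : Kernels L) (s p : ℝ) (θ : ℝ≥0∞) : ℝ≥0∞ :=
  ⨆ f ∈ {f ∈ Ψ.fSpace d s p θ | Ψ.fNorm s p θ f ≤ 1}, ruleError ξ n f

end

end Frolov

/-! Upper bounds. The dual kernels `DualKernels` turn the local means into a reproducing formula `f
= ∑ Λ_m * Ψ_m * f`, where the Fourier transform of `Λ_m` is supported in the box `|w_i| ≤ ε
2^{m_i}`. The lattice and its dual are admissible: the generating polynomial is irreducible, so the
coordinate products of nonzero lattice points are, up to scaling, nonzero integers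
(`one_le_abs_prod`, `one_le_abs_prod_dual`). After scaling, every nonzero dual point has coordinate
product at least `c n`. By Poisson summation the sum over the whole lattice is therefore exact on
each component with `2^{|m|} ≤ c n` (`pieceError_eq_zero`). Since the representative of `f` vanishes
outside `[0,1)^d`, the rule coincides with the sum over the whole lattice, and only components of
high frequency contribute (`ruleError_le_tsum`). For them, admissibility of the lattice itself
bounds the lattice sums of a majorant of `Λ_m`, pointwise and in the mean, and Hölder's inequality
bounds the error by a multiple of `‖Ψ_m * f‖_q (2^{|m|}/n)^{1/q}` (`enorm_pieceError_le`).

It remains to sum over `m`. For `q ≤ min(p, θ)` and a finite set `S` of indices, `∑_{m ∈ S} 2^{s|m|}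
‖Ψ_m * f‖_q` is at most a constant times `(#S)^{1-1/θ} ‖f‖` (`exists_sum_weight_mul_levelNorm_le`),
and the level `|m| = ℓ` has about `ℓ^{d-1}` indices. If `s > 1/θ`, the choice `q = min(p, θ)` gives
a series over levels that starts near `log n` and decays geometrically. If `s ≤ 1/θ`, then `θ < p`,
and `q = θ` gives no decay. In that case `q = θ` is used only on the first `(d-1) log log n` levels
or so. Beyond them `q = p` is used, by way of `𝐅_{p,θ} ⊆ 𝐅_{p,p}`; the decay accumulated by then
pays for the larger power of the cardinality (`exists_ruleError_le_split`). Both blocks are of the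
order `(log n)^{(d-1)(1-s)}`; for `s = 1/θ` the first block costs the additional factor `(log log
n)^{1-s}`.

Lower bound. Let `2^ℓ` be comparable to `n` and at least twice the number of nodes. For each `m`
with `|m| = ℓ`, at least half of the dyadic boxes of level `m` carry a bump that vanishes at all
nodes. The sum of these bumps over all such `m` is invisible to the rule, and its integral is
comparable to the number of the `m`. By the vanishing moments of `Ψ_1`, its norm is at most a
constant times `2^{sℓ}` times the `1/θ`-th power of that number (`exists_fNorm_bumpDist_le`). The
quotient of integral and norm is the lower bound. -/

namespace Frolov

noncomputable section

set_option linter.unusedSectionVars false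

/-! ### Tempered distributions under the integral of a convolution. -/

section Exchange

open SchwartzMap BoundedContinuousFunction

variable {E : Type} [NormedAddCommGroup E] [InnerProductSpace ℝ E] [FiniteDimensional ℝ E]
  [MeasurableSpace E] [BorelSpace E]

theorem exists_weighted_bound {F : Type} [NormedAddCommGroup F] [NormedSpace ℝ F]
    (h : 𝓢(E, F)) (k n : ℕ) :
    ∃ B, 0 ≤ B ∧ ∀ x, (1 + ‖x‖) ^ k * ‖iteratedFDeriv ℝ n h x‖ ≤ B :=
  ⟨_, by positivity, fun x => one_add_le_sup_seminorm_apply (𝕜 := ℝ) (m := (k, n)) le_rfl le_rfl h x⟩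

theorem weight_le (k : ℕ) (x z : E) : (1 + ‖x‖) ^ k ≤ (1 + ‖x - z‖) ^ k * (1 + ‖z‖) ^ k := by
  rw [← mul_pow]
  refine pow_le_pow_left₀ (by positivity) ?_ k
  have := norm_le_norm_sub_add x z
  nlinarith [norm_nonneg (x - z), norm_nonneg z]

/-- One differentiation under the integral, dominated by `‖u‖` times a bound for the derivative of
`h`, reduces order `n + 1` for `h` to order `n` for its derivative. The value space therefore
changes along the induction and has to be quantified after `n`. -/
theorem iteratedFDeriv_integral_smul_comp_sub (u : 𝓢(E, ℂ)) (n : ℕ) :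
    ∀ {F : Type} [NormedAddCommGroup F] [NormedSpace ℂ F] [CompleteSpace F] (h : 𝓢(E, F)) (x : E),
    iteratedFDeriv ℝ n (fun x => ∫ y, u y • h (x - y)) x =
      ∫ y, u y • iteratedFDeriv ℝ n h (x - y) := by
  induction n with
  | zero =>
    intro F _ _ _ h x
    ext v
    simp only [iteratedFDeriv_zero_apply]
    have := (continuousMultilinearCurryFin0 ℝ E F).symm.toContinuousLinearEquiv.integral_comp_comm
      (fun y => u y • h (x - y)) (μ := volume)
    have h2 : ∀ y, u y • iteratedFDeriv ℝ 0 h (x - y) =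
      (continuousMultilinearCurryFin0 ℝ E F).symm.toContinuousLinearEquiv (u y • h (x - y)) := by
      intro y
      ext v
      simp
    simp_rw [h2]
    rw [this]
    simp
  | succ n ih =>
    intro F _ _ _ h x
    have hd : (fun z => fderiv ℝ (fun x => ∫ y, u y • h (x - y)) z) =
        fun z => ∫ y, u y • (fderivCLM ℝ E F h) (z - y) := by
      funext z
      refine HasFDerivAt.fderiv ?_
      obtain ⟨B, hB0, hB⟩ := exists_weighted_bound h 0 1
      obtain ⟨B', hB0', hB'⟩ := exists_weighted_bound h 0 0
      refine hasFDerivAt_integral_of_dominated_of_fderiv_le (s := Set.univ)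
        (bound := fun y => ‖u y‖ * B) (F' := fun z y => u y • (fderivCLM ℝ E F h) (z - y))
        Filter.univ_mem ?_ ?_ ?_ ?_ ?_ ?_
      · exact Filter.Eventually.of_forall fun z => Continuous.aestronglyMeasurable (by fun_prop)
      · refine (u.integrable (μ := volume)).smul_of_top_left ?_ |>.congr (Filter.Eventually.of_forall fun y => rfl)
        refine memLp_top_of_bound (Continuous.aestronglyMeasurable (by fun_prop)) B'
          (Filter.Eventually.of_forall fun y => ?_)
        simpa using hB' (z - y)
      · exact Continuous.aestronglyMeasurable (by fun_prop)
      · refine Filter.Eventually.of_forall fun y z _ => ?_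
        rw [norm_smul]
        gcongr
        simpa [norm_iteratedFDeriv_one] using hB (z - y)
      · exact (u.integrable (μ := volume)).norm.mul_const B
      · refine Filter.Eventually.of_forall fun y z _ => ?_
        have h1 : HasFDerivAt (fun x => h (x - y)) (fderiv ℝ h (z - y)) z :=
          (hasFDerivAt_comp_sub y).2 (h.hasFDerivAt (z - y))
        exact h1.const_smul (u y)
    rw [iteratedFDeriv_succ_eq_comp_right, Function.comp_apply, hd, ih]
    have h2 : ∀ y, u y • iteratedFDeriv ℝ (n + 1) h (x - y) =
      (continuousMultilinearCurryRightEquiv' ℝ n E F).symm.toContinuousLinearEquiv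
        (u y • iteratedFDeriv ℝ n (fderivCLM ℝ E F h) (x - y)) := by
      intro y
      rw [iteratedFDeriv_succ_eq_comp_right]
      ext v
      simp
      rfl
    simp_rw [h2]
    exact (ContinuousLinearEquiv.integral_comp_comm (𝕜 := ℝ) (X := E) (μ := volume) (E := E [×n]→L[ℝ] E →L[ℝ] F)
      (F := E [×(n + 1)]→L[ℝ] F)
      (continuousMultilinearCurryRightEquiv' ℝ n E F).symm.toContinuousLinearEquiv _).symm

/-- Bounded continuous functions with values in the `n`-linear forms. -/
def JetSpace (E : Type) [NormedAddCommGroup E] [InnerProductSpace ℝ E] (n : ℕ) : Type :=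
  E →ᵇ (E [×n]→L[ℝ] ℂ)

instance (n : ℕ) : NormedAddCommGroup (JetSpace E n) :=
  inferInstanceAs (NormedAddCommGroup (E →ᵇ (E [×n]→L[ℝ] ℂ)))

instance (n : ℕ) : NormedSpace ℂ (JetSpace E n) :=
  inferInstanceAs (NormedSpace ℂ (E →ᵇ (E [×n]→L[ℝ] ℂ)))

instance (n : ℕ) : CompleteSpace (JetSpace E n) :=
  inferInstanceAs (CompleteSpace (E →ᵇ (E [×n]→L[ℝ] ℂ)))

/-- Evaluation at a point. -/
def JetSpace.eval (n : ℕ) (x : E) : JetSpace E n →L[ℂ] (E [×n]→L[ℝ] ℂ) :=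
  evalCLM (α := E) (β := E [×n]→L[ℝ] ℂ) ℂ x

theorem JetSpace.ext {n : ℕ} {v w : JetSpace E n} (h : ∀ x, eval n x v = eval n x w) : v = w :=
  BoundedContinuousFunction.ext h

theorem JetSpace.norm_le {n : ℕ} {v : JetSpace E n} {C : ℝ} (hC : 0 ≤ C) :
    ‖v‖ ≤ C ↔ ∀ x, ‖eval n x v‖ ≤ C :=
  BoundedContinuousFunction.norm_le (α := E) (β := E [×n]→L[ℝ] ℂ) hC

/-- The function `(1 + ‖x‖) ^ K • D^n φ x`. -/
def weightedDeriv (K n : ℕ) (φ : 𝓢(E, ℂ)) : JetSpace E n :=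
  ofNormedAddCommGroup
    (fun x => ((1 + ‖x‖) ^ K : ℝ) • iteratedFDeriv ℝ n φ x)
    (by
      have := (φ.smooth ⊤).continuous_iteratedFDeriv (m := n) (by exact_mod_cast le_top)
      fun_prop)
    (exists_weighted_bound φ K n).choose
    (fun x => by
      rw [norm_smul, Real.norm_of_nonneg (by positivity)]
      exact (exists_weighted_bound φ K n).choose_spec.2 x)

theorem eval_weightedDeriv (K n : ℕ) (φ : 𝓢(E, ℂ)) (x : E) :
    JetSpace.eval n x (weightedDeriv K n φ) =
      ((1 + ‖x‖) ^ K : ℝ) • iteratedFDeriv ℝ n φ x := rfl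

/-- The derivatives of order at most `N`, weighted by `(1 + ‖x‖) ^ K`. -/
def jet (K N : ℕ) : 𝓢(E, ℂ) →ₗ[ℂ] ((n : Fin (N + 1)) → JetSpace E n) where
  toFun φ n := weightedDeriv K n φ
  map_add' φ ψ := by
    funext n
    refine JetSpace.ext fun x => ?_
    have := iteratedFDeriv_add_apply (𝕜 := ℝ) (i := (n : ℕ)) (x := x)
      ((φ.smooth ⊤).contDiffAt.of_le (by exact_mod_cast le_top))
      ((ψ.smooth ⊤).contDiffAt.of_le (by exact_mod_cast le_top))
    have h2 : ⇑(φ + ψ) = ⇑φ + ⇑ψ := rfl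
    rw [Pi.add_apply, map_add, eval_weightedDeriv, eval_weightedDeriv, eval_weightedDeriv, h2,
      this, smul_add]
  map_smul' c φ := by
    funext n
    refine JetSpace.ext fun x => ?_
    have := iteratedFDeriv_const_smul_apply (𝕜 := ℝ) (i := (n : ℕ)) (x := x) (a := c)
      ((φ.smooth ⊤).contDiffAt.of_le (by exact_mod_cast le_top))
    have h2 : ⇑(c • φ) = c • ⇑φ := rfl
    rw [RingHom.id_apply, Pi.smul_apply, map_smul, eval_weightedDeriv, eval_weightedDeriv, h2, this,
      smul_comm]

theorem jet_apply (K N : ℕ) (φ : 𝓢(E, ℂ)) (n : Fin (N + 1)) (x : E) :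
    JetSpace.eval n x (jet K N φ n) = ((1 + ‖x‖) ^ K : ℝ) • iteratedFDeriv ℝ n φ x := rfl

/-- Continuity of `T` involves only finitely many Schwartz seminorms; `K` and `N` are the largest
orders of weight and derivative among them. -/
theorem exists_norm_le_jet (T : 𝓢'(E, ℂ)) : ∃ (K N : ℕ) (C : ℝ), 0 ≤ C ∧
    ∀ φ, ‖T φ‖ ≤ C * ‖jet K N φ‖ := by
  obtain ⟨s, C, hC, hT⟩ := Seminorm.bound_of_continuous (schwartz_withSeminorms ℂ E ℂ)
    ((normSeminorm ℂ ℂ).comp (T : 𝓢(E, ℂ) →ₗ[ℂ] ℂ)) (continuous_norm.comp (map_continuous T))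
  refine ⟨s.sup Prod.fst, s.sup Prod.snd, C, C.2, fun φ => (hT φ).trans ?_⟩
  rw [_root_.smul_apply, NNReal.smul_def, smul_eq_mul]
  refine mul_le_mul_of_nonneg_left ?_ C.2
  refine Seminorm.finset_sup_apply_le (norm_nonneg _) fun i hi => ?_
  refine SchwartzMap.seminorm_le_bound _ _ _ _ (norm_nonneg _) fun x => ?_
  have h1 : i.1 ≤ s.sup Prod.fst := Finset.le_sup (f := Prod.fst) hi
  have h2 : i.2 ≤ s.sup Prod.snd := Finset.le_sup (f := Prod.snd) hi
  refine le_trans ?_ (((JetSpace.norm_le (norm_nonneg _)).1 le_rfl x).trans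
    (norm_le_pi_norm (jet (s.sup Prod.fst) (s.sup Prod.snd) φ) ⟨i.2, by omega⟩))
  rw [jet_apply, norm_smul, Real.norm_of_nonneg (by positivity)]
  gcongr
  calc ‖x‖ ^ i.1 ≤ (1 + ‖x‖) ^ i.1 := by gcongr; linarith
    _ ≤ _ := pow_le_pow_right₀ (by linarith [norm_nonneg x]) h1

/-- The weight at `x` splits into the weight at `x - y`, absorbed by the decay of `h`, and the
weight at `y`, which is the polynomial growth. -/
theorem norm_jet_translate_le (K N : ℕ) (h : 𝓢(E, ℂ)) :
    ∃ C, 0 ≤ C ∧ ∀ y, ‖jet K N (compSubConstCLM ℂ y h)‖ ≤ C * (1 + ‖y‖) ^ K := by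
  choose B hB0 hB using exists_weighted_bound h K
  refine ⟨∑ n ∈ Finset.range (N + 1), B n, Finset.sum_nonneg fun n _ => hB0 n, fun y => ?_⟩
  have hC : 0 ≤ ∑ n ∈ Finset.range (N + 1), B n := Finset.sum_nonneg fun n _ => hB0 n
  refine (pi_norm_le_iff_of_nonneg (by positivity)).2 fun n => ?_
  refine (JetSpace.norm_le (by positivity)).2 fun x => ?_
  rw [jet_apply, norm_smul, Real.norm_of_nonneg (by positivity)]
  have h1 : iteratedFDeriv ℝ n (compSubConstCLM ℂ y h) x = iteratedFDeriv ℝ n h (x - y) :=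
    iteratedFDeriv_comp_sub n y x
  rw [h1]
  calc (1 + ‖x‖) ^ K * ‖iteratedFDeriv ℝ n h (x - y)‖
      ≤ ((1 + ‖x - y‖) ^ K * (1 + ‖y‖) ^ K) * ‖iteratedFDeriv ℝ n h (x - y)‖ := by
        gcongr; exact weight_le K x y
    _ = ((1 + ‖x - y‖) ^ K * ‖iteratedFDeriv ℝ n h (x - y)‖) * (1 + ‖y‖) ^ K := by ring
    _ ≤ B n * (1 + ‖y‖) ^ K := by gcongr; exact hB n _
    _ ≤ _ := by
        gcongr
        exact Finset.single_le_sum (fun n _ => hB0 n) (Finset.mem_range.2 n.2)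

theorem continuous_jet_translate (K N : ℕ) (h : 𝓢(E, ℂ)) :
    Continuous fun y => jet K N (compSubConstCLM ℂ y h) := by
  refine continuous_pi fun n => ?_
  obtain ⟨B, hB0, hB⟩ := exists_weighted_bound h K (n + 1)
  refine continuous_iff_continuousAt.2 fun y₀ => ?_
  -- For `z` within distance one of `y₀`, the weight at `x` is at most `(2 + ‖y₀‖)^K` times the
  -- weight at `x - z`. Bounding one more derivative of `h` thus gives a Lipschitz constant that is
  -- uniform in `x`.
  refine continuousAt_of_locally_lipschitz (r := 1) one_pos (B * (2 + ‖y₀‖) ^ K) fun y hy => ?_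
  rw [dist_eq_norm]
  refine (JetSpace.norm_le (by positivity)).2 fun x => ?_
  have hs : JetSpace.eval n x (jet K N (compSubConstCLM ℂ y h) n -
      jet K N (compSubConstCLM ℂ y₀ h) n) = ((1 + ‖x‖) ^ K : ℝ) •
        (iteratedFDeriv ℝ n (compSubConstCLM ℂ y h) x -
          iteratedFDeriv ℝ n (compSubConstCLM ℂ y₀ h) x) := by
    rw [map_sub, jet_apply, jet_apply]
    exact (smul_sub _ _ _).symm
  rw [hs, norm_smul, Real.norm_of_nonneg (by positivity)]
  have h1 : ∀ y, iteratedFDeriv ℝ n (compSubConstCLM ℂ y h) x = iteratedFDeriv ℝ n h (x - y) :=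
    fun y => iteratedFDeriv_comp_sub n y x
  rw [h1, h1]
  have hw : 0 < (1 + ‖x‖) ^ K := by positivity
  have hdiff : Differentiable ℝ (iteratedFDeriv ℝ n h) :=
    (h.smooth ⊤).differentiable_iteratedFDeriv (by exact_mod_cast ENat.natCast_lt_top _)
  have := Convex.norm_image_sub_le_of_norm_fderiv_le (𝕜 := ℝ)
    (f := iteratedFDeriv ℝ n h) (s := Metric.ball (x - y₀) 1) (x := x - y₀) (y := x - y)
    (C := B * (2 + ‖y₀‖) ^ K / (1 + ‖x‖) ^ K)
    (fun z _ => hdiff.differentiableAt)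
    (fun w hw' => ?_) (convex_ball _ _) (Metric.mem_ball_self one_pos)
    (by rw [Metric.mem_ball, dist_sub_left]; exact hy)
  · calc _ ≤ (1 + ‖x‖) ^ K * (B * (2 + ‖y₀‖) ^ K / (1 + ‖x‖) ^ K * ‖x - y - (x - y₀)‖) := by gcongr
      _ = _ := by rw [sub_sub_sub_cancel_left, dist_comm, dist_eq_norm]; field_simp
  · obtain ⟨z, rfl⟩ : ∃ z, w = x - z := ⟨x - w, by abel⟩
    have hz : ‖z - y₀‖ < 1 := by
      rw [Metric.mem_ball, dist_eq_norm, sub_sub_sub_cancel_left, norm_sub_rev] at hw'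
      exact hw'
    rw [norm_fderiv_iteratedFDeriv, le_div_iff₀ hw]
    have hz' : 1 + ‖z‖ ≤ 2 + ‖y₀‖ := by
      have h3 := norm_le_norm_sub_add z y₀
      linarith
    calc ‖iteratedFDeriv ℝ (n + 1) h (x - z)‖ * (1 + ‖x‖) ^ K
        ≤ ‖iteratedFDeriv ℝ (n + 1) h (x - z)‖ * ((1 + ‖x - z‖) ^ K * (1 + ‖z‖) ^ K) := by
          gcongr; exact weight_le K x z
      _ = ((1 + ‖x - z‖) ^ K * ‖iteratedFDeriv ℝ (n + 1) h (x - z)‖) * (1 + ‖z‖) ^ K := by ring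
      _ ≤ B * (2 + ‖y₀‖) ^ K := by gcongr; exact hB _

/-- The derivative of order zero makes `jet` injective, so `T` is a bounded functional on its range.
Hahn–Banach extends it to the whole Banach space of jets, where Bochner integrals exist and commute
with it. -/
theorem exists_jet_functional (T : 𝓢'(E, ℂ)) : ∃ (K N : ℕ)
    (G : StrongDual ℂ ((n : Fin (N + 1)) → JetSpace E n)),
    ∀ φ, T φ = G (jet K N φ) := by
  obtain ⟨K, N, C, hC, hT⟩ := exists_norm_le_jet T
  have hinj : Function.Injective (jet (E := E) K N) := by
    refine (injective_iff_map_eq_zero _).2 fun φ hφ => ?_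
    ext x
    have h1 : JetSpace.eval _ x (jet K N φ 0) = 0 := by
      rw [hφ]
      exact map_zero _
    have : _ = (0 : ℂ) := congrArg (fun w => w 0) h1
    rw [jet_apply] at this
    have hw : ((1 : ℝ) + ‖x‖) ≠ 0 := by positivity
    have h2 : ((1 + ‖x‖) ^ K : ℝ) • φ x = 0 := this
    exact (smul_eq_zero.1 h2).resolve_left (pow_ne_zero _ hw)
  let e := LinearEquiv.ofInjective (jet (E := E) K N) hinj
  let g : LinearMap.range (jet (E := E) K N) →L[ℂ] ℂ :=
    LinearMap.mkContinuous ((T : 𝓢(E, ℂ) →ₗ[ℂ] ℂ) ∘ₗ (e.symm : _ →ₗ[ℂ] 𝓢(E, ℂ))) C (fun w => by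
      have h1 : jet K N (e.symm w) = w := congrArg Subtype.val (e.apply_symm_apply w)
      have h2 := hT (e.symm w)
      rw [h1] at h2
      exact h2)
  obtain ⟨G, hG, -⟩ := exists_extension_norm_eq (LinearMap.range (jet (E := E) K N)) g
  refine ⟨K, N, G, fun φ => ?_⟩
  have h3 := hG (e φ)
  have h4 : ((e φ : LinearMap.range (jet (E := E) K N)) : (n : Fin (N + 1)) → JetSpace E n)
    = jet K N φ := rfl
  rw [h4] at h3
  rw [h3]
  change T φ = T (e.symm (e φ))
  rw [e.symm_apply_apply]

theorem continuous_apply_translate (T : 𝓢'(E, ℂ)) (h : 𝓢(E, ℂ)) :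
    Continuous fun y => T (compSubConstCLM ℂ y h) := by
  obtain ⟨K, N, G, hG⟩ := exists_jet_functional T
  simp_rw [hG]
  exact G.continuous.comp (continuous_jet_translate K N h)

theorem norm_apply_translate_le (T : 𝓢'(E, ℂ)) (h : 𝓢(E, ℂ)) :
    ∃ (K : ℕ) (C : ℝ), 0 ≤ C ∧ ∀ y, ‖T (compSubConstCLM ℂ y h)‖ ≤ C * (1 + ‖y‖) ^ K := by
  obtain ⟨K, N, G, hG⟩ := exists_jet_functional T
  obtain ⟨C, hC, h1⟩ := norm_jet_translate_le K N h
  refine ⟨K, ‖G‖ * C, by positivity, fun y => ?_⟩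
  rw [hG, mul_assoc]
  exact (G.le_opNorm _).trans (by gcongr; exact h1 y)

theorem integrable_mul_one_add_norm_pow (u : 𝓢(E, ℂ)) (K : ℕ) :
    Integrable fun y => ‖u y‖ * (1 + ‖y‖) ^ K := by
  refine Integrable.mono' (g := fun y => 2 ^ K * (‖y‖ ^ 0 * ‖u y‖ + ‖y‖ ^ K * ‖u y‖)) ?_
    (Continuous.aestronglyMeasurable (by fun_prop)) (Filter.Eventually.of_forall fun y => ?_)
  · exact ((u.integrable_pow_mul volume 0).add (u.integrable_pow_mul volume K)).const_mul _
  · rw [Real.norm_of_nonneg (by positivity)]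
    have h1 : (1 + ‖y‖) ^ K ≤ 2 ^ K * (1 + ‖y‖ ^ K) := by
      refine (add_pow_le zero_le_one (norm_nonneg y) K).trans ?_
      rw [one_pow]
      gcongr
      · norm_num
      · omega
    calc ‖u y‖ * (1 + ‖y‖) ^ K ≤ ‖u y‖ * (2 ^ K * (1 + ‖y‖ ^ K)) := by gcongr
      _ = _ := by ring

/-- A tempered distribution may be applied under the integral of a convolution. -/
theorem apply_convolution (T : 𝓢'(E, ℂ)) (u h : 𝓢(E, ℂ)) :
    T (convolution (ContinuousLinearMap.mul ℂ ℂ) u h) =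
      ∫ y, u y * T (compSubConstCLM ℂ y h) := by
  obtain ⟨K, N, G, hG⟩ := exists_jet_functional T
  obtain ⟨C, hC, hjet⟩ := norm_jet_translate_le K N h
  have hint : Integrable fun y => u y • jet K N (compSubConstCLM ℂ y h) := by
    refine Integrable.mono' (g := fun y => C * (‖u y‖ * (1 + ‖y‖) ^ K))
      ((integrable_mul_one_add_norm_pow u K).const_mul C)
      (u.continuous.smul (continuous_jet_translate K N h)).aestronglyMeasurable
      (Filter.Eventually.of_forall fun y => ?_)
    rw [norm_smul]
    calc _ ≤ ‖u y‖ * (C * (1 + ‖y‖) ^ K) := by gcongr; exact hjet y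
      _ = _ := by ring
  -- The integral on the right is taken in the Banach space of jets. Evaluations are continuous
  -- there, so the identity reduces to differentiation under the integral at each point and order.
  have hkey : jet K N (convolution (ContinuousLinearMap.mul ℂ ℂ) u h) =
      ∫ y, u y • jet K N (compSubConstCLM ℂ y h) := by
    funext n
    refine JetSpace.ext fun x => ?_
    let ev : ((n : Fin (N + 1)) → JetSpace E n) →L[ℂ] (E [×n]→L[ℝ] ℂ) :=
      (JetSpace.eval n x).comp (ContinuousLinearMap.proj n)
    change _ = ev (∫ y, u y • jet K N (compSubConstCLM ℂ y h))
    rw [← ev.integral_comp_comm hint]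
    have h1 : ∀ y, ev (u y • jet K N (compSubConstCLM ℂ y h)) =
        ((1 + ‖x‖) ^ K : ℝ) • (u y • iteratedFDeriv ℝ n h (x - y)) := by
      intro y
      have h2 : iteratedFDeriv ℝ n (compSubConstCLM ℂ y h) x = iteratedFDeriv ℝ n h (x - y) :=
        iteratedFDeriv_comp_sub n y x
      rw [map_smul]
      change u y • JetSpace.eval n x (jet K N (compSubConstCLM ℂ y h) n) = _
      rw [jet_apply, h2, smul_comm]
    simp_rw [h1]
    rw [integral_smul, ← iteratedFDeriv_integral_smul_comp_sub u n h x, jet_apply]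
    congr 2
    funext z
    rw [convolution_apply, convolution_def]
    rfl
  rw [hG, hkey, ← G.integral_comp_comm hint]
  refine integral_congr_ae (Filter.Eventually.of_forall fun y => ?_)
  simp [hG]

end Exchange

/-! ### Supports of distributions and uniqueness of continuous representatives. -/

section Support

variable {E : Type} [NormedAddCommGroup E] [InnerProductSpace ℝ E] [FiniteDimensional ℝ E]
  [MeasurableSpace E] [BorelSpace E]

/-- A tempered distribution vanishes on the compactly supported test functions whose support is
disjoint from its support. -/
theorem apply_eq_zero_of_disjoint_dsupport (f : 𝓢'(E, ℂ)) (φ : 𝓢(E, ℂ))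
    (hc : HasCompactSupport φ) (hd : Disjoint (tsupport φ) (Distribution.dsupport f)) :
    f φ = 0 := by
  have h1 : ∀ x : E, ∃ U : Set E, IsOpen U ∧ (x ∈ tsupport φ → x ∈ U) ∧
      Distribution.IsVanishingOn f U := by
    intro x
    by_cases hx : x ∈ tsupport φ
    · obtain ⟨U, hU, ho, hxU⟩ :=
        (Distribution.notMem_dsupport_iff (f := f) x).1 (Set.disjoint_left.1 hd hx)
      exact ⟨U, ho, fun _ => hxU, hU⟩
    · refine ⟨∅, isOpen_empty, fun h => absurd h hx, fun u hu => ?_⟩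
      have h2 : u = 0 := by
        ext y
        exact congrFun (tsupport_eq_empty_iff.1 (Set.subset_empty_iff.1 hu)) y
      rw [h2, map_zero]
  choose U hUo hUx hUv using h1
  obtain ⟨t, ht⟩ := hc.isCompact.elim_finite_subcover U hUo
    fun x hx => Set.mem_iUnion.2 ⟨x, hUx x hx⟩
  -- A partition of unity splits the test function into finitely many, each supported in one open
  -- set on which the distribution vanishes.
  obtain ⟨ρ, hρ⟩ := SmoothPartitionOfUnity.exists_isSubordinate (modelWithCornersSelf ℝ E)
    (isClosed_tsupport φ) (fun i : t => U i) (fun i => hUo i) (by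
      refine ht.trans fun x hx => ?_
      obtain ⟨i, hi, hxi⟩ := Set.mem_iUnion₂.1 hx
      exact Set.mem_iUnion.2 ⟨⟨i, hi⟩, hxi⟩)
  have hsm : ∀ i, ContDiff ℝ ∞ fun x => ((ρ i x : ℝ) : ℂ) * φ x := fun i =>
    (Complex.ofRealCLM.contDiff.comp (ρ i).contMDiff.contDiff).mul (φ.smooth ⊤)
  have hcs : ∀ i, HasCompactSupport fun x => ((ρ i x : ℝ) : ℂ) * φ x := fun i => hc.mul_left
  have hsum : φ = ∑ i, (hcs i).toSchwartzMap (hsm i) := by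
    ext x
    rw [_root_.sum_apply]
    change φ x = ∑ i, ((ρ i x : ℝ) : ℂ) * φ x
    rw [← Finset.sum_mul]
    by_cases hx : x ∈ tsupport φ
    · have h2 := ρ.sum_eq_one hx
      rw [finsum_eq_sum_of_fintype] at h2
      rw [← Complex.ofReal_sum, h2, Complex.ofReal_one, one_mul]
    · rw [image_eq_zero_of_notMem_tsupport hx, mul_zero]
  rw [hsum, map_sum]
  refine Finset.sum_eq_zero fun i _ => hUv i _ ?_
  refine subset_trans (closure_mono fun x hx => ?_) (hρ i)
  have h2 : ((ρ i x : ℝ) : ℂ) * φ x ≠ 0 := hx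
  have h3 : ((ρ i x : ℝ) : ℂ) ≠ 0 := left_ne_zero_of_mul h2
  exact Complex.ofReal_ne_zero.1 h3

/-- A continuous function is determined on an open set by its integrals against the test functions
that are supported there. -/
theorem eqOn_of_forall_integral_eq {g₁ g₂ : E → ℂ} (hg₁ : Continuous g₁) (hg₂ : Continuous g₂)
    {U : Set E} (hU : IsOpen U)
    (h : ∀ φ : 𝓢(E, ℂ), HasCompactSupport φ → tsupport φ ⊆ U → ∫ x, φ x * g₁ x = ∫ x, φ x * g₂ x) :
    Set.EqOn g₁ g₂ U := by
  have hae : ∀ᵐ x ∂(volume : Measure E), x ∈ U → (g₁ - g₂) x = 0 := by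
    refine hU.ae_eq_zero_of_integral_contDiff_smul_eq_zero
      ((hg₁.sub hg₂).locallyIntegrable.locallyIntegrableOn U) fun φ hφ hc hs => ?_
    have h1 : HasCompactSupport fun x => ((φ x : ℝ) : ℂ) := hc.comp_left Complex.ofReal_zero
    have h2 : ContDiff ℝ ∞ fun x => ((φ x : ℝ) : ℂ) := Complex.ofRealCLM.contDiff.comp hφ
    have h3 := h (h1.toSchwartzMap h2) h1
      (subset_trans (tsupport_comp_subset Complex.ofReal_zero φ) hs)
    have hi : ∀ g : E → ℂ, Continuous g → Integrable fun x => ((φ x : ℝ) : ℂ) * g x :=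
      fun g hg => (h2.continuous.mul hg).integrable_of_hasCompactSupport h1.mul_right
    have h4 : ∀ x, φ x • (g₁ - g₂) x = ((φ x : ℝ) : ℂ) * g₁ x - ((φ x : ℝ) : ℂ) * g₂ x := by
      intro x
      rw [Pi.sub_apply, Complex.real_smul, mul_sub]
    simp_rw [h4]
    rw [integral_sub (hi _ hg₁) (hi _ hg₂), sub_eq_zero]
    exact h3
  have h5 : g₁ =ᵐ[volume.restrict U] g₂ := by
    refine (ae_restrict_iff' hU.measurableSet).2 (hae.mono fun x hx hxU => ?_)
    exact sub_eq_zero.1 (hx hxU)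
  exact Measure.eqOn_open_of_ae_eq h5 hU hg₁.continuousOn hg₂.continuousOn

end Support

variable {L d : ℕ}

theorem isClosed_unitCube : IsClosed (unitCube d) := by
  have : unitCube d = ⋂ i, (fun x : EuclideanSpace ℝ (Fin d) => x i) ⁻¹' Set.Icc 0 1 := by
    ext x
    simp [unitCube]
  rw [this]
  exact isClosed_iInter fun i => isClosed_Icc.preimage (by fun_prop)

/-- One radius serves all `j`, because the dilation by `2^j ≥ 1` only shrinks the support of `psi1`.
-/
theorem Kernels.exists_support_radius (Ψ : Kernels L) :
    ∃ R : ℝ, 0 < R ∧ ∀ j t, Ψ.psi j t ≠ 0 → |t| ≤ R := by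
  obtain ⟨R₀, h0⟩ := Ψ.hasCompactSupport_psi0.isCompact.isBounded.exists_norm_le
  obtain ⟨R₁, h1⟩ := Ψ.hasCompactSupport_psi1.isCompact.isBounded.exists_norm_le
  refine ⟨max 1 (max R₀ R₁), by positivity, fun j t ht => ?_⟩
  cases j with
  | zero => exact (h0 t (subset_tsupport _ ht)).trans (by simp)
  | succ j =>
    have h2 : Ψ.psi1 (2 ^ j * t) ≠ 0 := right_ne_zero_of_mul ht
    have h3 := h1 _ (subset_tsupport _ h2)
    rw [Real.norm_eq_abs, abs_mul, abs_of_pos (by positivity)] at h3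
    have h4 : (1 : ℝ) ≤ 2 ^ j := one_le_pow₀ (by norm_num)
    have h5 : |t| ≤ 2 ^ j * |t| := le_mul_of_one_le_left (abs_nonneg t) h4
    exact (h5.trans h3).trans (by simp)

/-- The local means of a distribution that is supported in the unit cube vanish outside a fixed
cube. -/
theorem Kernels.conv_eq_zero (Ψ : Kernels L) {R : ℝ}
    (hR : ∀ j t, Ψ.psi j t ≠ 0 → |t| ≤ R) {f : 𝓢'(EuclideanSpace ℝ (Fin d), ℂ)}
    (hf : Distribution.dsupport f ⊆ unitCube d) (m : Fin d → ℕ) {x : EuclideanSpace ℝ (Fin d)}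
    {i : Fin d} (hx : x i < -R ∨ 1 + R < x i) : Ψ.conv m f x = 0 := by
  refine apply_eq_zero_of_disjoint_dsupport f _ (Ψ.hasCompactSupport_tensor_sub m x) ?_
  refine Disjoint.mono_right hf (Set.disjoint_left.2 fun y hy hyc => ?_)
  have hcl : IsClosed {y : EuclideanSpace ℝ (Fin d) | |x i - y i| ≤ R} :=
    isClosed_le (by fun_prop) (by fun_prop)
  have h1 : |x i - y i| ≤ R := by
    refine closure_minimal (fun z hz => ?_) hcl hy
    have h2 : ∏ i, Ψ.psi (m i) ((x - z) i) ≠ 0 := hz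
    exact hR _ _ (Finset.prod_ne_zero_iff.1 h2 i (Finset.mem_univ i))
  have h3 := abs_le.1 h1
  have h4 := hyc i
  rcases hx with hx | hx
  · linarith
  · linarith

/-! ### Admissibility of the Frolov lattice and of its dual. -/

section Algebra

open Polynomial

/-- The polynomial `(t - 1)(t - 3) ⋯ (t - (2d - 1)) - 1`. -/
def frolovPoly (d : ℕ) : ℤ[X] := ∏ j : Fin d, (X - C (2 * ((j : ℕ) : ℤ) + 1)) - 1

theorem natDegree_prod_linear {R : Type*} [CommRing R] [Nontrivial R] {d : ℕ} (a : Fin d → R) :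
    (∏ j, (X - C (a j))).natDegree = d := by
  rw [natDegree_prod_of_monic _ _ fun j _ => monic_X_sub_C _]
  simp

theorem monic_frolovPoly {d : ℕ} (hd : 1 ≤ d) : (frolovPoly d).Monic := by
  refine (monic_prod_of_monic _ _ fun j _ => monic_X_sub_C _).sub_of_left ?_
  have h := natDegree_prod_linear fun j : Fin d => 2 * ((j : ℕ) : ℤ) + 1
  refine degree_lt_degree ?_
  rw [h, natDegree_one]
  omega

theorem natDegree_frolovPoly {d : ℕ} (hd : 1 ≤ d) : (frolovPoly d).natDegree = d := by
  have h := natDegree_prod_linear fun j : Fin d => 2 * ((j : ℕ) : ℤ) + 1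
  rw [frolovPoly, natDegree_sub_eq_left_of_natDegree_lt, h]
  rw [h, natDegree_one]
  omega

/-- At the `d` odd integers `1, 3, …, 2d - 1` the polynomial equals `-1`, so two integer factors
take the values `1` and `-1` there, in some order. Their sum has `d` zeros and degree less than `d`;
hence it vanishes, which is impossible for monic factors. -/
theorem irreducible_frolovPoly {d : ℕ} (hd : 1 ≤ d) : Irreducible (frolovPoly d) := by
  refine (monic_frolovPoly hd).irreducible_iff_natDegree'.2 ⟨fun h => ?_, fun f g hf hg hfg hmem => ?_⟩
  · have := natDegree_frolovPoly hd
    rw [h, natDegree_one] at this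
    omega
  · rw [natDegree_frolovPoly hd, Finset.mem_Ioc] at hmem
    have hdeg : f.natDegree + g.natDegree = d := by
      rw [← hf.natDegree_mul hg, hfg, natDegree_frolovPoly hd]
    have hz : f + g = 0 := by
      refine eq_zero_of_natDegree_lt_card_of_eval_eq_zero (f + g)
        (f := fun j : Fin d => 2 * ((j : ℕ) : ℤ) + 1) (fun i j hij => ?_) (fun j => ?_) ?_
      · simp only at hij
        exact Fin.ext (by omega)
      · have h1 := congrArg (eval (2 * ((j : ℕ) : ℤ) + 1)) hfg
        rw [eval_mul, frolovPoly, eval_sub, eval_prod, eval_one,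
          Finset.prod_eq_zero (Finset.mem_univ j) (by simp), zero_sub] at h1
        rw [eval_add]
        rcases Int.eq_one_or_neg_one_of_mul_eq_neg_one h1 with h2 | h2
        · rw [h2] at h1 ⊢
          omega
        · rw [h2] at h1 ⊢
          omega
      · refine lt_of_le_of_lt (natDegree_add_le f g) ?_
        rw [Fintype.card_fin]
        exact max_lt (by omega) (by omega)
    have h3 : g = -f := (neg_eq_of_add_eq_zero_right hz).symm
    have h4 : g.leadingCoeff = -1 := by rw [h3, leadingCoeff_neg, hf.leadingCoeff]
    rw [hg.leadingCoeff] at h4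
    norm_num at h4

variable {d : ℕ} {ξ : Fin d → ℝ}

theorem IsFrolovRoots.map_eq (hξ : IsFrolovRoots ξ) :
    (frolovPoly d).map (Int.castRingHom ℝ) = ∏ j, (X - C (ξ j)) := by
  refine Polynomial.funext fun t => ?_
  have h := hξ.2 t
  simp only [frolovPoly, Polynomial.map_sub, Polynomial.map_prod, map_X, map_C, Polynomial.map_one,
    eval_sub, eval_prod, eval_X, eval_C, eval_one]
  simpa using h

/-- Symmetric integer polynomials take integer values at the roots. -/
theorem IsFrolovRoots.exists_int_eq_aeval (hξ : IsFrolovRoots ξ) (f : MvPolynomial (Fin d) ℤ)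
    (hf : f.IsSymmetric) : ∃ z : ℤ, MvPolynomial.aeval ξ f = (z : ℝ) := by
  obtain ⟨g, hg⟩ := MvPolynomial.esymmAlgHom_fin_surjective ℤ (le_refl d) ⟨f, hf⟩
  have hg' : f = MvPolynomial.aeval
      (fun i : Fin d => MvPolynomial.esymm (Fin d) ℤ ((i : ℕ) + 1)) g := by
    rw [← MvPolynomial.esymmAlgHom_apply, hg]
  -- By Vieta, the elementary symmetric functions of the roots are, up to sign, coefficients of an
  -- integer polynomial; they generate all symmetric polynomials.
  have he : ∀ i : Fin d, ∃ z : ℤ,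
      MvPolynomial.aeval ξ (MvPolynomial.esymm (Fin d) ℤ ((i : ℕ) + 1)) = (z : ℝ) := by
    intro i
    rw [MvPolynomial.aeval_esymm_eq_multiset_esymm]
    have h1 := Multiset.prod_X_sub_C_coeff (Finset.univ.val.map ξ) (k := d - (i + 1)) (by simp)
    have h2 : (Multiset.map (fun t => X - C t) (Finset.univ.val.map ξ)).prod =
        ∏ j, (X - C (ξ j)) := by
      rw [Multiset.map_map]
      rfl
    have h3 : (Finset.univ.val.map ξ).card - (d - ((i : ℕ) + 1)) = i + 1 := by
      simp
      omega
    rw [h2, ← hξ.map_eq, h3, coeff_map] at h1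
    refine ⟨(-1) ^ ((i : ℕ) + 1) * (frolovPoly d).coeff (d - (i + 1)), ?_⟩
    push_cast
    rw [show ((frolovPoly d).coeff (d - (i + 1)) : ℝ) = _ from h1, ← mul_assoc, ← mul_pow]
    norm_num
  choose z hz using he
  refine ⟨MvPolynomial.aeval z g, ?_⟩
  rw [hg', ← AlgHom.comp_apply, MvPolynomial.comp_aeval]
  simp_rw [hz]
  have := MvPolynomial.map_aeval (R := ℤ) z (Int.castRingHom ℝ) g
  rw [← eq_intCast (Int.castRingHom ℝ), this, MvPolynomial.aeval_def,
    MvPolynomial.coe_eval₂Hom]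
  congr 1

/-- By Gauss' lemma the monic polynomial stays irreducible over `ℚ`, so it is the minimal polynomial
of each `ξ i`, and its degree is `d`. -/
theorem IsFrolovRoots.aeval_ne_zero (hξ : IsFrolovRoots ξ) {q : ℤ[X]} (hq : q ≠ 0)
    (hdeg : q.natDegree < d) (i : Fin d) : aeval (ξ i) q ≠ 0 := by
  intro h0
  have hd : 1 ≤ d := by omega
  have hirr := ((monic_frolovPoly hd).irreducible_iff_irreducible_map_fraction_map (K := ℚ)).1
    (irreducible_frolovPoly hd)
  have hroot : aeval (ξ i) ((frolovPoly d).map (algebraMap ℤ ℚ)) = 0 := by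
    rw [aeval_map_algebraMap, aeval_def, ← eval_map]
    change eval (ξ i) ((frolovPoly d).map (Int.castRingHom ℝ)) = 0
    rw [hξ.map_eq, eval_prod]
    exact Finset.prod_eq_zero (Finset.mem_univ i) (by simp)
  have hmin := minpoly.eq_of_irreducible_of_monic hirr hroot ((monic_frolovPoly hd).map _)
  have hdvd : (frolovPoly d).map (algebraMap ℤ ℚ) ∣ q.map (algebraMap ℤ ℚ) := by
    rw [hmin]
    exact minpoly.dvd ℚ (ξ i) (by rw [aeval_map_algebraMap, h0])
  have hinj : Function.Injective (algebraMap ℤ ℚ) := (algebraMap ℤ ℚ).injective_int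
  have h1 := natDegree_le_of_dvd hdvd ((Polynomial.map_ne_zero_iff hinj).2 hq)
  rw [natDegree_map_eq_of_injective hinj, natDegree_map_eq_of_injective hinj,
    natDegree_frolovPoly hd] at h1
  omega

/-- The polynomial with given coefficients. -/
def coeffPoly (k : Fin d → ℤ) : ℤ[X] := ∑ j : Fin d, C (k j) * X ^ (j : ℕ)

theorem aeval_coeffPoly (k : Fin d → ℤ) (i : Fin d) :
    aeval (ξ i) (coeffPoly k) = (Matrix.vandermonde ξ).mulVec (fun j => (k j : ℝ)) i := by
  simp [coeffPoly, Matrix.mulVec, dotProduct, Matrix.vandermonde_apply, mul_comm]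

/-- The norm form of the lattice takes nonzero integer values. -/
theorem IsFrolovRoots.one_le_abs_prod (hξ : IsFrolovRoots ξ) {k : Fin d → ℤ} (hk : k ≠ 0) :
    1 ≤ |∏ i, (Matrix.vandermonde ξ).mulVec (fun j => (k j : ℝ)) i| := by
  have hq : coeffPoly k ≠ 0 := by
    intro h0
    refine hk (_root_.funext fun j => ?_)
    have h1 := congrArg (fun q => coeff q (j : ℕ)) h0
    simp only [coeffPoly, finsetSum_coeff, coeff_C_mul, coeff_X_pow, coeff_zero] at h1
    rw [Finset.sum_eq_single j (fun b _ hb => by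
      rw [if_neg (fun h => hb (Fin.ext h.symm)), mul_zero]) (by simp)] at h1
    simpa using h1
  obtain ⟨j₀, hj₀⟩ := Function.ne_iff.1 hk
  have hd : 0 < d := j₀.pos
  have hdeg : (coeffPoly k).natDegree < d := by
    refine lt_of_le_of_lt (natDegree_sum_le_of_forall_le (n := d - 1) _ _ fun j _ => ?_) (by omega)
    refine (natDegree_C_mul_X_pow_le _ _).trans (by omega)
  -- A lattice point has the coordinates `q(ξ_i)`, with `q` the polynomial whose coefficients are
  -- `k`. The product `∏ q(X_i)` is symmetric, so its value is an integer, and no factor vanishes.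
  obtain ⟨z, hz⟩ := hξ.exists_int_eq_aeval
    (∏ i, aeval (MvPolynomial.X i) (coeffPoly k)) (fun e => by
      rw [map_prod]
      refine Fintype.prod_equiv e _ _ fun i => ?_
      have h1 := (aeval_algHom_apply (MvPolynomial.rename (R := ℤ) e) (MvPolynomial.X i)
        (coeffPoly k))
      rw [MvPolynomial.rename_X] at h1
      exact h1.symm)
  have hz' : ∏ i, (Matrix.vandermonde ξ).mulVec (fun j => (k j : ℝ)) i = z := by
    rw [← hz, map_prod]
    refine Finset.prod_congr rfl fun i _ => ?_
    rw [← aeval_coeffPoly, ← aeval_algHom_apply, MvPolynomial.aeval_X]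
  have hne : (z : ℝ) ≠ 0 := by
    rw [← hz']
    refine Finset.prod_ne_zero_iff.2 fun i _ => ?_
    rw [← aeval_coeffPoly]
    exact hξ.aeval_ne_zero hq hdeg i
  rw [hz']
  have hz0 : z ≠ 0 := by exact_mod_cast hne
  exact_mod_cast Int.one_le_abs hz0

theorem IsFrolovRoots.det_ne_zero (hξ : IsFrolovRoots ξ) : (Matrix.vandermonde ξ).det ≠ 0 :=
  Matrix.det_vandermonde_ne_zero_iff.2 hξ.1

/-- The dual lattice is admissible as well. -/
theorem IsFrolovRoots.one_le_abs_prod_dual (hξ : IsFrolovRoots ξ) {k : Fin d → ℤ} (hk : k ≠ 0)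
    {w : Fin d → ℝ} (hw : (Matrix.vandermonde ξ).transpose.mulVec w = fun j => (k j : ℝ)) :
    1 ≤ ((Matrix.vandermonde ξ).det ^ 2) ^ d * |∏ i, w i| := by
  set V := Matrix.vandermonde ξ with hV
  have hpow : ∀ e : ℕ, ∃ z : ℤ, ∑ i, ξ i ^ e = z := by
    intro e
    obtain ⟨z, hz⟩ := hξ.exists_int_eq_aeval (MvPolynomial.psum (Fin d) ℤ e)
      (MvPolynomial.psum_isSymmetric _ _ _)
    exact ⟨z, by simpa [MvPolynomial.psum] using hz⟩
  choose z hz using hpow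
  -- The Gram matrix `VᵀV` consists of power sums of the roots, hence of integers. With `k' =
  -- adj(VᵀV) k` one has `V k' = (det V)² w`, so a multiple of the dual point is a point of the
  -- original lattice, to which `one_le_abs_prod` applies.
  set G : Matrix (Fin d) (Fin d) ℤ := Matrix.of fun a b => z (a + b) with hG
  have hGV : G.map (Int.cast : ℤ → ℝ) = V.transpose * V := by
    ext a b
    simp [hG, hV, Matrix.mul_apply, Matrix.vandermonde_apply, ← hz, pow_add]
  have hdet : V.det ≠ 0 := hξ.det_ne_zero
  set k' : Fin d → ℤ := G.adjugate.mulVec k with hk'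
  have hadj : (fun j => (k' j : ℝ)) =
      (V.transpose * V).adjugate.mulVec (fun j => (k j : ℝ)) := by
    have h1 : G.adjugate.map (Int.cast : ℤ → ℝ) = (V.transpose * V).adjugate := by
      rw [← hGV]
      exact (Int.castRingHom ℝ).map_adjugate G
    rw [← h1]
    funext j
    simp [hk', Matrix.mulVec, dotProduct]
  have hVk : V.mulVec (fun j => (k' j : ℝ)) = (V.det ^ 2) • w := by
    have hu : IsUnit V.transpose.det := by
      rw [Matrix.det_transpose]
      exact isUnit_iff_ne_zero.2 hdet
    have hinj : Function.Injective V.transpose.mulVec :=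
      Matrix.mulVec_injective_of_isUnit ((Matrix.isUnit_iff_isUnit_det _).2 hu)
    refine hinj ?_
    rw [hadj, Matrix.mulVec_smul, hw, Matrix.mulVec_mulVec, Matrix.mulVec_mulVec,
      Matrix.mul_adjugate, Matrix.smul_mulVec, Matrix.one_mulVec, Matrix.det_mul,
      Matrix.det_transpose, sq]
  have hk0 : k' ≠ 0 := by
    intro h0
    have h1 : V.mulVec (fun j => (k' j : ℝ)) = 0 := by
      have : (fun j => (k' j : ℝ)) = 0 := by
        funext j
        simp [h0]
      rw [this, Matrix.mulVec_zero]
    rw [hVk] at h1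
    have h2 : w = 0 := (smul_eq_zero.1 h1).resolve_left (pow_ne_zero _ hdet)
    rw [h2, Matrix.mulVec_zero] at hw
    refine hk (_root_.funext fun j => ?_)
    have := congrFun hw j
    simpa using this.symm
  have h1 := hξ.one_le_abs_prod hk0
  rw [← hV, hVk] at h1
  simpa [Finset.prod_mul_distrib, abs_mul] using h1

/-! The scaled lattice. -/

theorem scale_pow (ξ : Fin d → ℝ) (hd : 1 ≤ d) (n : ℕ) :
    (((n : ℝ) * |(Matrix.vandermonde ξ).det|) ^ (-(1 / (d : ℝ)))) ^ d =
      ((n : ℝ) * |(Matrix.vandermonde ξ).det|)⁻¹ := by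
  have h0 : 0 ≤ (n : ℝ) * |(Matrix.vandermonde ξ).det| := by positivity
  have hd' : (d : ℝ) ≠ 0 := by positivity
  rw [← Real.rpow_natCast, ← Real.rpow_mul h0, neg_mul, one_div, inv_mul_cancel₀ hd',
    Real.rpow_neg_one]

theorem IsFrolovRoots.le_abs_prod (hξ : IsFrolovRoots ξ) (hd : 1 ≤ d) (n : ℕ)
    {k : Fin d → ℤ} (hk : k ≠ 0) :
    |(Matrix.vandermonde ξ).det|⁻¹ / n ≤
      |∏ i, (latticeMatrix ξ n).mulVec (fun j => (k j : ℝ)) i| := by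
  have h1 := hξ.one_le_abs_prod hk
  simp only [latticeMatrix, Matrix.smul_mulVec, Pi.smul_apply, smul_eq_mul, Finset.prod_mul_distrib,
    Finset.prod_const, Finset.card_univ, Fintype.card_fin]
  rw [scale_pow ξ hd n, abs_mul,
    abs_of_nonneg (a := ((n : ℝ) * |(Matrix.vandermonde ξ).det|)⁻¹) (by positivity), mul_inv, div_eq_inv_mul]
  exact le_mul_of_one_le_right (by positivity) h1

theorem IsFrolovRoots.le_abs_prod_dual (hξ : IsFrolovRoots ξ) (hd : 1 ≤ d) {n : ℕ} (hn : 1 ≤ n)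
    {k : Fin d → ℤ} (hk : k ≠ 0) {w : Fin d → ℝ}
    (hw : (latticeMatrix ξ n).transpose.mulVec w = fun j => (k j : ℝ)) :
    |(Matrix.vandermonde ξ).det| / ((Matrix.vandermonde ξ).det ^ 2) ^ d * n ≤ |∏ i, w i| := by
  set D := (Matrix.vandermonde ξ).det with hD
  have hD0 : D ≠ 0 := hξ.det_ne_zero
  have hn' : (0 : ℝ) < n := by exact_mod_cast hn
  set c := ((n : ℝ) * |D|) ^ (-(1 / (d : ℝ))) with hc
  have h2 : (Matrix.vandermonde ξ).transpose.mulVec (c • w) = fun j => (k j : ℝ) := by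
    rw [← hw, latticeMatrix, Matrix.transpose_smul, Matrix.smul_mulVec, Matrix.mulVec_smul]
  have h1 := hξ.one_le_abs_prod_dual hk h2
  simp only [Pi.smul_apply, smul_eq_mul, Finset.prod_mul_distrib,
    Finset.prod_const, Finset.card_univ, Fintype.card_fin] at h1
  have h3 := scale_pow ξ hd n
  rw [← hD, ← hc] at h3
  rw [h3, abs_mul, abs_of_nonneg (by positivity)] at h1
  have hD1 : 0 < |D| := abs_pos.2 hD0
  have h4 : 0 < (D ^ 2) ^ d := by positivity
  rw [div_mul_eq_mul_div, div_le_iff₀ h4]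
  have h5 : (D ^ 2) ^ d * ((n * |D|)⁻¹ * |∏ i, w i|) = (|∏ i, w i| * (D ^ 2) ^ d) / (|D| * n) := by
    field_simp
  rw [h5, one_le_div (by positivity)] at h1
  exact h1

theorem IsFrolovRoots.abs_det_latticeMatrix (hξ : IsFrolovRoots ξ) (hd : 1 ≤ d) {n : ℕ}
    (hn : 1 ≤ n) : |(latticeMatrix ξ n).det| = (n : ℝ)⁻¹ := by
  have hn' : (0 : ℝ) < n := by exact_mod_cast hn
  have hD1 : 0 < |(Matrix.vandermonde ξ).det| := abs_pos.2 hξ.det_ne_zero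
  rw [latticeMatrix, Matrix.det_smul, Fintype.card_fin, scale_pow ξ hd n, abs_mul,
    abs_of_nonneg (by positivity)]
  field_simp

end Algebra

/-! ### Counting points whose differences have large coordinate products. -/

section Counting

variable {d : ℕ} {ι : Type*}

/-- The sum `∑ 3 / (1 + b²)` over the integers. -/
def floorSum : ℝ := ∑' b : ℤ, 3 / (1 + (b : ℝ) ^ 2)

theorem summable_floorSum : Summable fun b : ℤ => 3 / (1 + (b : ℝ) ^ 2) := by
  have h : Summable fun b : ℤ => ((b : ℝ) ^ 2)⁻¹ := by
    simpa using (Real.summable_one_div_int_pow (p := 2)).2 (by norm_num)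
  have h2 : Summable fun b : ℤ => 3 / (1 + (b : ℝ) ^ 2) := by
    refine Summable.of_norm_bounded_eventually (h.mul_left 3) ?_
    refine Set.Finite.subset (Set.finite_singleton 0) fun b hb => ?_
    by_contra hb0
    refine hb ?_
    have hb1 : 0 < (b : ℝ) ^ 2 := by
      have : (b : ℝ) ≠ 0 := by exact_mod_cast hb0
      positivity
    change ‖3 / (1 + (b : ℝ) ^ 2)‖ ≤ 3 * ((b : ℝ) ^ 2)⁻¹
    rw [Real.norm_of_nonneg (by positivity), div_eq_mul_inv]
    gcongr
    linarith
  exact h2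

theorem floorSum_nonneg : 0 ≤ floorSum := tsum_nonneg fun b => by positivity

/-- Since `|⌊t⌋| ≤ |t| + 1`, the square of `⌊t⌋` is at most `2t² + 2`; this is where the factor `3`
comes from. -/
theorem inv_one_add_sq_le_floor (t : ℝ) :
    (1 + t ^ 2)⁻¹ ≤ 3 / (1 + (⌊t⌋ : ℝ) ^ 2) := by
  rw [inv_eq_one_div, div_le_div_iff₀ (by positivity) (by positivity)]
  have h1 := Int.floor_le t
  have h2 := Int.lt_floor_add_one t
  nlinarith [sq_nonneg (2 * t - 1), sq_nonneg (t - ⌊t⌋ - 1), sq_nonneg (t + 1), sq_nonneg t]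

/-- Points whose differences have large coordinate products are separated by the cells of a grid
with small cells. -/
theorem floor_injOn {Z : ι → Fin d → ℝ} {δ : ℝ}
    (hsep : ∀ k k', k ≠ k' → δ ≤ |∏ i, (Z k i - Z k' i)|) {b : Fin d → ℝ} (hb : ∀ i, 0 < b i)
    (hd : 1 ≤ d) (hbδ : ∏ i, b i ≤ δ) (y : Fin d → ℝ) :
    Function.Injective fun k i => ⌊(Z k i - y i) / b i⌋ := by
  intro k k' hkk
  by_contra hne
  have h1 := hsep k k' hne
  have h2 : ∀ i, |Z k i - Z k' i| < b i := by
    intro i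
    have h3 := Int.abs_sub_lt_one_of_floor_eq_floor (congrFun hkk i)
    rw [← sub_div, abs_div, abs_of_pos (hb i), div_lt_one (hb i)] at h3
    simpa using h3
  rw [Finset.abs_prod] at h1
  have : Nonempty (Fin d) := ⟨⟨0, hd⟩⟩
  have h4 : ∏ i, |Z k i - Z k' i| < ∏ i, b i := by
    by_cases h0 : ∃ i, Z k i - Z k' i = 0
    · obtain ⟨i, hi⟩ := h0
      rw [Finset.prod_eq_zero (Finset.mem_univ i) (by rw [hi, abs_zero])]
      exact Finset.prod_pos fun i _ => hb i
    · push Not at h0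
      exact Finset.prod_lt_prod_of_nonempty (fun i _ => abs_pos.2 (h0 i)) (fun i _ => h2 i)
        Finset.univ_nonempty
  linarith

theorem prod_update_div {a : Fin d → ℝ} (i₀ : Fin d) (N : ℝ) :
    ∏ i, Function.update a i₀ (a i₀ / N) i = (∏ i, a i) / N := by
  rw [Finset.prod_update_of_mem (Finset.mem_univ _), div_mul_eq_mul_div,
    ← Finset.mul_prod_erase _ a (Finset.mem_univ i₀), Finset.sdiff_singleton_eq_erase]

/-- Dividing one side of the box by `N` makes its volume at most `δ`, so the cells of the resulting
grid contain at most one point each and the sum is dominated by a product of sums over `ℤ`.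
Shrinking that side costs the factor `N²`. -/
theorem sum_prod_inv_le {Z : ι → Fin d → ℝ} {δ : ℝ}
    (hsep : ∀ k k', k ≠ k' → δ ≤ |∏ i, (Z k i - Z k' i)|) {a : Fin d → ℝ} (ha : ∀ i, 0 < a i)
    (hd : 1 ≤ d) {N : ℕ} (hN : 1 ≤ N) (haδ : ∏ i, a i ≤ N * δ) (y : Fin d → ℝ) (F : Finset ι) :
    ∑ k ∈ F, ∏ i, (1 + ((Z k i - y i) / a i) ^ 2)⁻¹ ≤ floorSum ^ d * (N : ℝ) ^ 2 := by
  classical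
  have hN0 : (1 : ℝ) ≤ N := by exact_mod_cast hN
  set i₀ : Fin d := ⟨0, hd⟩
  set b : Fin d → ℝ := Function.update a i₀ (a i₀ / N) with hbdef
  have hb : ∀ i, 0 < b i := by
    intro i
    by_cases hi : i = i₀
    · rw [hi, hbdef, Function.update_self]
      exact div_pos (ha _) (by linarith)
    · rw [hbdef, Function.update_of_ne hi]
      exact ha i
  have hinj := floor_injOn hsep hb hd (by
    rw [hbdef, prod_update_div, div_le_iff₀ (by linarith), mul_comm]
    exact haδ) y
  set Φ : ι → Fin d → ℤ := fun k i => ⌊(Z k i - y i) / b i⌋ with hΦ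
  have hterm : ∀ k, ∏ i, (1 + ((Z k i - y i) / a i) ^ 2)⁻¹ ≤
      (N : ℝ) ^ 2 * ∏ i, 3 / (1 + (Φ k i : ℝ) ^ 2) := by
    intro k
    have h1 : ∀ i, (1 + ((Z k i - y i) / a i) ^ 2)⁻¹ ≤
        (if i = i₀ then (N : ℝ) ^ 2 else 1) * (1 + ((Z k i - y i) / b i) ^ 2)⁻¹ := by
      intro i
      by_cases hi : i = i₀
      · rw [if_pos hi, hi, hbdef, Function.update_self]
        have h2 : (Z k i₀ - y i₀) / (a i₀ / N) = N * ((Z k i₀ - y i₀) / a i₀) := by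
          field_simp
        rw [h2, ← div_eq_mul_inv, inv_eq_one_div, div_le_div_iff₀ (by positivity) (by positivity)]
        nlinarith [sq_nonneg ((Z k i₀ - y i₀) / a i₀), one_le_pow₀ hN0 (n := 2)]
      · rw [if_neg hi, one_mul, hbdef, Function.update_of_ne hi]
    calc _ ≤ ∏ i, ((if i = i₀ then (N : ℝ) ^ 2 else 1) * (3 / (1 + (Φ k i : ℝ) ^ 2))) := by
          refine Finset.prod_le_prod (fun i _ => by positivity) fun i _ => (h1 i).trans ?_
          refine mul_le_mul_of_nonneg_left (inv_one_add_sq_le_floor _) ?_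
          split_ifs <;> positivity
      _ = _ := by rw [Finset.prod_mul_distrib, Finset.prod_ite_eq' _ _ _, if_pos (Finset.mem_univ _)]
  obtain ⟨B, hB⟩ : ∃ B : Finset ℤ, ∀ k ∈ F, ∀ i, Φ k i ∈ B :=
    ⟨F.biUnion fun k => Finset.univ.image (Φ k), fun k hk i =>
      Finset.mem_biUnion.2 ⟨k, hk, Finset.mem_image_of_mem _ (Finset.mem_univ i)⟩⟩
  calc ∑ k ∈ F, ∏ i, (1 + ((Z k i - y i) / a i) ^ 2)⁻¹
      ≤ ∑ k ∈ F, (N : ℝ) ^ 2 * ∏ i, 3 / (1 + (Φ k i : ℝ) ^ 2) := Finset.sum_le_sum fun k _ => hterm k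
    _ = (N : ℝ) ^ 2 * ∑ k ∈ F, ∏ i, 3 / (1 + (Φ k i : ℝ) ^ 2) := by rw [Finset.mul_sum]
    _ = (N : ℝ) ^ 2 * ∑ v ∈ F.image Φ, ∏ i, 3 / (1 + (v i : ℝ) ^ 2) := by
        rw [Finset.sum_image fun k _ k' _ h => hinj h]
    _ ≤ (N : ℝ) ^ 2 * ∑ v ∈ Fintype.piFinset fun _ : Fin d => B, ∏ i, 3 / (1 + (v i : ℝ) ^ 2) := by
        refine mul_le_mul_of_nonneg_left (Finset.sum_le_sum_of_subset_of_nonneg (fun v hv => ?_)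
          fun v _ _ => Finset.prod_nonneg fun i _ => by positivity) (by positivity)
        obtain ⟨k, hk, rfl⟩ := Finset.mem_image.1 hv
        exact Fintype.mem_piFinset.2 (hB k hk)
    _ = (N : ℝ) ^ 2 * ∏ _i : Fin d, ∑ b ∈ B, 3 / (1 + (b : ℝ) ^ 2) := by
        rw [Finset.sum_prod_piFinset B fun _ b => 3 / (1 + (b : ℝ) ^ 2)]
    _ ≤ (N : ℝ) ^ 2 * ∏ _i : Fin d, floorSum := by
        gcongr
        exact summable_floorSum.sum_le_tsum _ fun b _ => by positivity
    _ = _ := by rw [Finset.prod_const, Finset.card_univ, Fintype.card_fin, mul_comm]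

/-- On the grid with one side divided by `N`, the cell indices lie between `-N` and `N` in that
coordinate and between `-1` and `1` in the others. Here `2M + 1 ≤ 3M` for `M ≥ 1`. -/
theorem card_le_of_mem_box {Z : ι → Fin d → ℝ} {δ : ℝ}
    (hsep : ∀ k k', k ≠ k' → δ ≤ |∏ i, (Z k i - Z k' i)|) {ρ : ℝ} (hρ : 0 < ρ)
    (hd : 1 ≤ d) {N : ℕ} (hN : 1 ≤ N) (hρδ : ρ ^ d ≤ N * δ) (y : Fin d → ℝ) (F : Finset ι)
    (hF : ∀ k ∈ F, ∀ i, |Z k i - y i| ≤ ρ) : F.card ≤ 3 ^ d * N := by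
  classical
  have hN0 : (1 : ℝ) ≤ N := by exact_mod_cast hN
  set i₀ : Fin d := ⟨0, hd⟩
  set b : Fin d → ℝ := Function.update (fun _ => ρ) i₀ (ρ / N) with hbdef
  have hb : ∀ i, 0 < b i := by
    intro i
    by_cases hi : i = i₀
    · rw [hi, hbdef, Function.update_self]
      exact div_pos hρ (by linarith)
    · rw [hbdef, Function.update_of_ne hi]
      exact hρ
  have hinj := floor_injOn hsep hb hd (by
    have h1 := prod_update_div (a := fun _ : Fin d => ρ) i₀ N
    rw [hbdef, h1, div_le_iff₀ (by linarith), mul_comm, Finset.prod_const, Finset.card_univ,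
      Fintype.card_fin]
    exact hρδ) y
  set M : Fin d → ℕ := Function.update (fun _ => 1) i₀ N with hM
  have hfl : ∀ (t : ℝ) (m : ℕ), |t| ≤ m → ⌊t⌋ ∈ Finset.Icc (-(m : ℤ)) m := by
    intro t m ht
    have h1 := abs_le.1 ht
    rw [Finset.mem_Icc]
    refine ⟨Int.le_floor.2 (by push_cast; exact h1.1), ?_⟩
    have := (Int.floor_le t).trans h1.2
    exact_mod_cast this
  have hsub : F.image (fun k i => ⌊(Z k i - y i) / b i⌋) ⊆
      Fintype.piFinset fun i => Finset.Icc (-(M i : ℤ)) (M i) := by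
    intro v hv
    obtain ⟨k, hk, rfl⟩ := Finset.mem_image.1 hv
    refine Fintype.mem_piFinset.2 fun i => hfl _ _ ?_
    rw [abs_div, abs_of_pos (hb i), div_le_iff₀ (hb i)]
    refine (hF k hk i).trans (le_of_eq ?_)
    by_cases hi : i = i₀
    · rw [hi, hbdef, hM, Function.update_self, Function.update_self]
      field_simp
    · rw [hbdef, hM, Function.update_of_ne hi, Function.update_of_ne hi]
      simp
  have h2 := Finset.card_le_card hsub
  rw [Finset.card_image_of_injective _ hinj, Fintype.card_piFinset] at h2
  refine h2.trans ?_
  calc ∏ i, (Finset.Icc (-(M i : ℤ)) (M i)).card ≤ ∏ i, 3 * M i := by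
        refine Finset.prod_le_prod (fun _ _ => Nat.zero_le _) fun i _ => ?_
        have hMi : 1 ≤ M i := by
          by_cases hi : i = i₀
          · rw [hi, hM, Function.update_self]
            exact hN
          · rw [hM, Function.update_of_ne hi]
        rw [Int.card_Icc]
        omega
    _ = 3 ^ d * N := by
        rw [Finset.prod_mul_distrib, Finset.prod_const, Finset.card_univ, Fintype.card_fin, hM,
          Finset.prod_update_of_mem (Finset.mem_univ _), Finset.prod_const_one, mul_one]

end Counting

/-! ### Points of the scaled lattice and their separation. -/

section Lattice

variable {d : ℕ} {ξ : Fin d → ℝ}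

/-- The points of the lattice `T_n(ℤ^d)`. -/
def latticePoint (ξ : Fin d → ℝ) (n : ℕ) (k : Fin d → ℤ) : EuclideanSpace ℝ (Fin d) :=
  WithLp.toLp 2 ((latticeMatrix ξ n).mulVec fun j => (k j : ℝ))

theorem latticePoint_apply (ξ : Fin d → ℝ) (n : ℕ) (k : Fin d → ℤ) (i : Fin d) :
    latticePoint ξ n k i = (latticeMatrix ξ n).mulVec (fun j => (k j : ℝ)) i := rfl

theorem latticePoint_sub (ξ : Fin d → ℝ) (n : ℕ) (k k' : Fin d → ℤ) :
    latticePoint ξ n k - latticePoint ξ n k' = latticePoint ξ n (k - k') := by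
  ext i
  rw [PiLp.sub_apply, latticePoint_apply, latticePoint_apply, latticePoint_apply, ← Pi.sub_apply,
    ← Matrix.mulVec_sub]
  congr 2
  funext j
  simp

/-- The separation constant of the lattices. -/
def separation (ξ : Fin d → ℝ) : ℝ := |(Matrix.vandermonde ξ).det|⁻¹

theorem IsFrolovRoots.separation_pos (hξ : IsFrolovRoots ξ) : 0 < separation ξ :=
  inv_pos.2 (abs_pos.2 hξ.det_ne_zero)

theorem IsFrolovRoots.separated (hξ : IsFrolovRoots ξ) (hd : 1 ≤ d) (n : ℕ)
    (k k' : Fin d → ℤ) (h : k ≠ k') :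
    separation ξ / n ≤ |∏ i, (latticePoint ξ n k i - latticePoint ξ n k' i)| := by
  have h1 := hξ.le_abs_prod hd n (sub_ne_zero.2 h)
  refine h1.trans (le_of_eq ?_)
  congr 1
  refine Finset.prod_congr rfl fun i _ => ?_
  rw [← PiLp.sub_apply, latticePoint_sub, latticePoint_apply]

end Lattice

/-! ### A product majorant and its sums over the lattice. -/

section Decay

variable {d : ℕ}

theorem integral_prod_coord {𝕜 : Type*} [RCLike 𝕜] (f : Fin d → ℝ → 𝕜) :
    ∫ x : EuclideanSpace ℝ (Fin d), ∏ i, f i (x i) = ∏ i, ∫ t, f i t := by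
  rw [← integral_fintype_prod_volume_eq_prod f]
  exact (EuclideanSpace.volume_preserving_symm_measurableEquiv_toLp (Fin d)).integral_comp
    (MeasurableEquiv.measurableEmbedding _) (fun x : Fin d → ℝ => ∏ i, f i (x i))

theorem integrable_prod_coord {𝕜 : Type*} [RCLike 𝕜] {f : Fin d → ℝ → 𝕜}
    (hf : ∀ i, Integrable (f i)) :
    Integrable fun x : EuclideanSpace ℝ (Fin d) => ∏ i, f i (x i) :=
  ((EuclideanSpace.volume_preserving_symm_measurableEquiv_toLp (Fin d)).integrable_comp_emb
    (MeasurableEquiv.measurableEmbedding _)).2 (Integrable.fintype_prod hf)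

/-- The majorant `∏ 2^{m_i} / (1 + (2^{m_i} x_i)²)`. -/
def majorant (m : Fin d → ℕ) (x : EuclideanSpace ℝ (Fin d)) : ℝ :=
  ∏ i, 2 ^ m i * (1 + (2 ^ m i * x i) ^ 2)⁻¹

theorem majorant_nonneg (m : Fin d → ℕ) (x : EuclideanSpace ℝ (Fin d)) : 0 ≤ majorant m x :=
  Finset.prod_nonneg fun i _ => by positivity

theorem continuous_majorant (m : Fin d → ℕ) : Continuous (majorant m) := by
  unfold majorant
  refine continuous_finsetProd _ fun i _ => continuous_const.mul (Continuous.inv₀ (by fun_prop) ?_)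
  intro x
  positivity

theorem majorant_le (m : Fin d → ℕ) (x : EuclideanSpace ℝ (Fin d)) :
    majorant m x ≤ 2 ^ ∑ i, m i := by
  rw [← Finset.prod_pow_eq_pow_sum]
  refine Finset.prod_le_prod (fun i _ => by positivity) fun i _ => ?_
  refine mul_le_of_le_one_right (by positivity) (inv_le_one_of_one_le₀ ?_)
  nlinarith [sq_nonneg (2 ^ m i * x i)]

theorem majorant_neg (m : Fin d → ℕ) (x : EuclideanSpace ℝ (Fin d)) :
    majorant m (-x) = majorant m x := by
  simp [majorant]

theorem integrable_majorant (m : Fin d → ℕ) : Integrable (majorant m) := by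
  refine integrable_prod_coord (f := fun i t => 2 ^ m i * (1 + (2 ^ m i * t) ^ 2)⁻¹) fun i => ?_
  exact (integrable_inv_one_add_sq.comp_mul_left' (by positivity)).const_mul _

theorem integral_majorant (m : Fin d → ℕ) : ∫ x, majorant m x = Real.pi ^ d := by
  have h := integral_prod_coord (d := d) fun i (t : ℝ) => 2 ^ m i * (1 + (2 ^ m i * t) ^ 2)⁻¹
  unfold majorant
  rw [h]
  have h1 : ∀ i, ∫ t : ℝ, 2 ^ m i * (1 + (2 ^ m i * t) ^ 2)⁻¹ = Real.pi := by
    intro i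
    rw [integral_const_mul, Measure.integral_comp_mul_left (fun t => (1 + t ^ 2)⁻¹),
      integral_univ_inv_one_add_sq, abs_of_pos (by positivity), smul_eq_mul]
    field_simp
  simp_rw [h1]
  rw [Finset.prod_const, Finset.card_univ, Fintype.card_fin]

theorem lintegral_majorant (m : Fin d → ℕ) (y : EuclideanSpace ℝ (Fin d)) :
    ∫⁻ x, ENNReal.ofReal (majorant m (y - x)) = ENNReal.ofReal (Real.pi ^ d) := by
  rw [lintegral_sub_left_eq_self (fun x => ENNReal.ofReal (majorant m x)),
    ← ofReal_integral_eq_lintegral_ofReal (integrable_majorant m)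
    (Filter.Eventually.of_forall fun x => majorant_nonneg m x), integral_majorant]

variable {ξ : Fin d → ℝ}

/-- Pointwise bound for the sum of the majorant over the lattice. -/
theorem IsFrolovRoots.sum_majorant_le (hξ : IsFrolovRoots ξ) (hd : 1 ≤ d) {n : ℕ} (hn : 1 ≤ n)
    (m : Fin d → ℕ) {N : ℕ} (hN : 1 ≤ N) (hNn : (n : ℝ) ≤ N * separation ξ * 2 ^ ∑ i, m i)
    (y : EuclideanSpace ℝ (Fin d)) (F : Finset (Fin d → ℤ)) :
    ∑ k ∈ F, majorant m (latticePoint ξ n k - y) ≤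
      2 ^ (∑ i, m i) * (floorSum ^ d * (N : ℝ) ^ 2) := by
  have h := sum_prod_inv_le (hξ.separated hd n) (a := fun i => (2 ^ m i)⁻¹)
    (fun i => by positivity) hd hN (by
      rw [Finset.prod_inv_distrib, Finset.prod_pow_eq_pow_sum]
      have hn' : (0 : ℝ) < n := by exact_mod_cast hn
      rw [← mul_div_assoc, le_div_iff₀ hn', inv_mul_le_iff₀ (by positivity), mul_comm]
      exact hNn) (fun i => y i) F
  refine le_trans (le_of_eq ?_) (mul_le_mul_of_nonneg_left h (by positivity : (0 : ℝ) ≤ 2 ^ ∑ i, m i))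
  rw [Finset.mul_sum]
  refine Finset.sum_congr rfl fun k _ => ?_
  rw [majorant, Finset.prod_mul_distrib, Finset.prod_pow_eq_pow_sum]
  congr 1
  refine Finset.prod_congr rfl fun i _ => ?_
  rw [PiLp.sub_apply, div_inv_eq_mul, mul_comm]

/-- The cube `[-R, 1 + R]^d`. -/
def cube (d : ℕ) (R : ℝ) : Set (EuclideanSpace ℝ (Fin d)) := {x | ∀ i, -R ≤ x i ∧ x i ≤ 1 + R}

theorem isCompact_cube (R : ℝ) : IsCompact (cube d R) := by
  have : cube d R = WithLp.toLp 2 '' (Set.pi Set.univ fun _ => Set.Icc (-R) (1 + R)) := by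
    ext x
    refine ⟨fun h => ⟨fun i => x i, fun i _ => h i, rfl⟩, ?_⟩
    rintro ⟨v, hv, rfl⟩ i
    exact hv i (Set.mem_univ i)
  rw [this]
  exact (isCompact_univ_pi fun _ => isCompact_Icc).image (PiLp.continuous_toLp 2 _)

theorem IsFrolovRoots.card_mem_cube_le (hξ : IsFrolovRoots ξ) (hd : 1 ≤ d) {R : ℝ} (hR : 0 ≤ R)
    {n : ℕ} (hn : 1 ≤ n) {N : ℕ} (hN : (R + 1) ^ d * n ≤ N * separation ξ)
    (y : EuclideanSpace ℝ (Fin d)) (F : Finset (Fin d → ℤ))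
    (hF : ∀ k ∈ F, latticePoint ξ n k - y ∈ cube d R) : F.card ≤ 3 ^ d * N := by
  have hn' : (0 : ℝ) < n := by exact_mod_cast hn
  have hN1 : 1 ≤ N := by
    rcases Nat.eq_zero_or_pos N with h | h
    · rw [h, Nat.cast_zero, zero_mul] at hN
      have : 0 < (R + 1) ^ d * n := by positivity
      linarith
    · exact h
  refine card_le_of_mem_box (hξ.separated hd n) (ρ := R + 1) (by positivity) hd hN1
    (by rw [← mul_div_assoc, le_div_iff₀ hn']; exact hN) (fun i => y i) F fun k hk i => ?_
  have h1 := hF k hk i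
  rw [PiLp.sub_apply] at h1
  rw [abs_le]
  constructor <;> linarith [h1.1, h1.2]

/-- Mean bound for the sum of the majorant over the lattice. -/
theorem IsFrolovRoots.lintegral_sum_majorant_le (hξ : IsFrolovRoots ξ) (hd : 1 ≤ d) {R : ℝ}
    (hR : 0 ≤ R) {n : ℕ} (hn : 1 ≤ n) {N : ℕ} (hN : (R + 1) ^ d * n ≤ N * separation ξ)
    (m : Fin d → ℕ) (F : Finset (Fin d → ℤ)) :
    ∫⁻ y in cube d R, ∑ k ∈ F, ENNReal.ofReal (majorant m (latticePoint ξ n k - y)) ≤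
      (3 ^ d * N : ℕ) * ENNReal.ofReal (Real.pi ^ d) := by
  classical
  have hmeas : Measurable fun z : EuclideanSpace ℝ (Fin d) => ENNReal.ofReal (majorant m z) :=
    (continuous_majorant m).measurable.ennreal_ofReal
  have hcube : MeasurableSet (cube d R) := (isCompact_cube R).measurableSet
  -- With the difference of lattice point and `y` as new variable, the majorant leaves the lattice
  -- sum. What remains is the number of lattice points in a translate of the cube.
  calc ∫⁻ y in cube d R, ∑ k ∈ F, ENNReal.ofReal (majorant m (latticePoint ξ n k - y))
      = ∑ k ∈ F, ∫⁻ y in cube d R, ENNReal.ofReal (majorant m (latticePoint ξ n k - y)) :=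
        lintegral_finsetSum _ fun k _ => hmeas.comp (measurable_const.sub measurable_id)
    _ = ∑ k ∈ F, ∫⁻ z, (cube d R).indicator (fun _ => ENNReal.ofReal (majorant m z))
          (latticePoint ξ n k - z) := by
        refine Finset.sum_congr rfl fun k _ => ?_
        rw [← lintegral_indicator hcube,
          ← lintegral_sub_left_eq_self _ (latticePoint ξ n k)]
        refine lintegral_congr fun z => ?_
        simp only [Set.indicator, sub_sub_cancel]
    _ = ∫⁻ z, ∑ k ∈ F, (cube d R).indicator (fun _ => ENNReal.ofReal (majorant m z))
          (latticePoint ξ n k - z) := by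
        refine (lintegral_finsetSum _ fun k _ => ?_).symm
        have h1 : MeasurableSet {z | latticePoint ξ n k - z ∈ cube d R} :=
          hcube.preimage (measurable_const.sub measurable_id)
        exact hmeas.indicator h1
    _ ≤ ∫⁻ z, (3 ^ d * N : ℕ) * ENNReal.ofReal (majorant m z) := by
        refine lintegral_mono fun z => ?_
        have h1 : ∀ k, (cube d R).indicator (fun _ => ENNReal.ofReal (majorant m z))
            (latticePoint ξ n k - z) = if latticePoint ξ n k - z ∈ cube d R then
              ENNReal.ofReal (majorant m z) else 0 := fun k => by
          simp only [Set.indicator]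
        simp_rw [h1]
        rw [← Finset.sum_filter, Finset.sum_const, nsmul_eq_mul]
        gcongr
        refine hξ.card_mem_cube_le hd hR hn hN z _ fun k hk => ?_
        exact (Finset.mem_filter.1 hk).2
    _ = _ := by
        rw [lintegral_const_mul _ hmeas]
        congr 1
        have := lintegral_majorant m 0
        simpa [majorant_neg] using this

end Decay

/-! ### Poisson summation over the integer vectors. -/

section Poisson

variable {d : ℕ}

/-- The integer vector `k` as a real vector. -/
def intVec (k : Fin d → ℤ) : Fin d → ℝ := fun i => (k i : ℝ)

/-- The character `z ↦ exp(-2πi k·z)`. -/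
def charNeg (k : Fin d → ℤ) (z : Fin d → ℝ) : ℂ :=
  Complex.exp (-(2 * Real.pi * Complex.I * ∑ i, (k i : ℂ) * (z i : ℂ)))

theorem mFourier_neg_coe (k : Fin d → ℤ) (z : Fin d → ℝ) :
    UnitAddTorus.mFourier (-k) (fun i => (z i : UnitAddCircle)) = charNeg k z := by
  change ∏ i, (fourier ((-k) i)) (z i : UnitAddCircle) = _
  simp_rw [fourier_coe_apply]
  rw [← Complex.exp_sum, charNeg, Finset.mul_sum, ← Finset.sum_neg_distrib]
  congr 1
  refine Finset.sum_congr rfl fun i _ => ?_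
  simp
  ring

theorem continuous_charNeg (k : Fin d → ℤ) : Continuous (charNeg k) := by
  unfold charNeg
  fun_prop

theorem norm_charNeg (k : Fin d → ℤ) (z : Fin d → ℝ) : ‖charNeg k z‖ = 1 := by
  rw [charNeg, Complex.norm_exp]
  simp [Complex.mul_re]

theorem coe_add_intVec (z : Fin d → ℝ) (l : Fin d → ℤ) :
    (fun i => ((z + intVec l) i : UnitAddCircle)) = fun i => (z i : UnitAddCircle) := by
  funext i
  simp [intVec]

theorem charNeg_add (k l : Fin d → ℤ) (z : Fin d → ℝ) :
    charNeg k (z + intVec l) = charNeg k z := by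
  rw [← mFourier_neg_coe, coe_add_intVec, mFourier_neg_coe]

/-- The half-open unit cell at an integer vector. -/
def unitCell (l : Fin d → ℤ) : Set (Fin d → ℝ) := {x | ∀ i, x i ∈ Set.Ioc (l i : ℝ) (l i + 1)}

theorem measurableSet_unitCell (l : Fin d → ℤ) : MeasurableSet (unitCell l) :=
  MeasurableSet.univ_pi' fun _ => measurableSet_Ioc

theorem unitCell_subset (l : Fin d → ℤ) :
    unitCell l ⊆ Set.Icc (intVec l) (fun i => (l i : ℝ) + 1) :=
  fun _ hx => ⟨fun i => (hx i).1.le, fun i => (hx i).2⟩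

theorem volume_unitCell_zero : volume (unitCell (0 : Fin d → ℤ)) = 1 := by
  have : unitCell (0 : Fin d → ℤ) = Set.pi Set.univ fun _ => Set.Ioc (0 : ℝ) 1 := by
    ext x
    simp [unitCell]
  rw [this, volume_pi_pi]
  simp

theorem iUnion_unitCell : ⋃ l : Fin d → ℤ, unitCell l = Set.univ := by
  refine Set.eq_univ_of_forall fun x => Set.mem_iUnion.2 ⟨fun i => ⌈x i⌉ - 1, fun i => ?_⟩
  push_cast
  have h1 := Int.ceil_lt_add_one (x i)
  have h2 := Int.le_ceil (x i)
  constructor <;> linarith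

theorem disjoint_unitCell : Pairwise (Function.onFun Disjoint (unitCell (d := d))) := by
  intro l l' hne
  refine Set.disjoint_left.2 fun x hx hx' => hne (funext fun i => ?_)
  have h1 : (l i : ℝ) < l' i + 1 := (hx i).1.trans_le (hx' i).2
  have h2 : (l' i : ℝ) < l i + 1 := (hx' i).1.trans_le (hx i).2
  have h1' : l i < l' i + 1 := by exact_mod_cast h1
  have h2' : l' i < l i + 1 := by exact_mod_cast h2
  omega

theorem setIntegral_unitCell (g : (Fin d → ℝ) → ℂ) (l : Fin d → ℤ) :
    ∫ z in unitCell 0, g (z + intVec l) = ∫ z in unitCell l, g z := by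
  have h := (measurePreserving_add_right (volume : Measure (Fin d → ℝ))
    (intVec l)).setIntegral_preimage_emb (measurableEmbedding_addRight _) g (unitCell l)
  rw [← h]
  congr 2
  ext z
  simp only [unitCell, Set.mem_ofPred_eq, Set.mem_preimage, Pi.add_apply, intVec, Set.mem_Ioc]
  refine forall_congr' fun i => ?_
  simp
  intro _
  rw [add_comm (z i), add_le_add_iff_left]

/-- If the Fourier transform of `u` vanishes at the nonzero integer vectors, then the sum of `u`
over the integer vectors is its integral. -/
theorem tsum_eq_integral_of_charNeg (u : (Fin d → ℝ) → ℂ) (hu : Continuous u) (hi : Integrable u)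
    (hb : ∀ R : ℝ, ∃ b : (Fin d → ℤ) → ℝ, Summable b ∧
      ∀ k z, (∀ i, |z i| ≤ R) → ‖u (z + intVec k)‖ ≤ b k)
    (hF : ∀ k ≠ 0, ∫ z, charNeg k z * u z = 0) :
    ∑' k, u (intVec k) = ∫ z, u z := by
  set S : (Fin d → ℝ) → ℂ := fun z => ∑' k, u (z + intVec k) with hS
  have hScont : Continuous S := by
    refine continuous_iff_continuousAt.2 fun z₀ => ?_
    obtain ⟨b, hbs, hbb⟩ := hb (‖z₀‖ + 1)
    refine (continuousOn_tsum (s := Metric.ball z₀ 1) (fun k => by fun_prop) hbs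
      fun k z hz => hbb k z fun i => ?_).continuousAt (Metric.ball_mem_nhds _ one_pos)
    rw [Metric.mem_ball, dist_eq_norm] at hz
    have h1 := norm_le_norm_sub_add z z₀
    have h2 := norm_le_pi_norm z i
    rw [Real.norm_eq_abs] at h2
    linarith
  have hSper : ∀ z l, S (z + intVec l) = S z := by
    intro z l
    simp only [hS]
    rw [← (Equiv.addLeft l).tsum_eq (fun k => u (z + intVec k))]
    refine tsum_congr fun k => ?_
    congr 1
    funext i
    simp [intVec, add_assoc]
  -- The periodization `S` is constant on the fibres of the quotient map onto the torus, so it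
  -- descends to a continuous function `U`.
  let π : C(Fin d → ℝ, UnitAddTorus (Fin d)) :=
    ⟨fun z i => (z i : UnitAddCircle), by fun_prop⟩
  have hπ : Topology.IsQuotientMap π :=
    (IsOpenQuotientMap.piMap fun _ : Fin d =>
      (QuotientAddGroup.isOpenQuotientMap_mk :
        IsOpenQuotientMap (QuotientAddGroup.mk : ℝ → UnitAddCircle))).isQuotientMap
  have hfac : Function.FactorsThrough (⟨S, hScont⟩ : C(Fin d → ℝ, ℂ)) π := by
    intro z z' hzz
    have h1 : ∀ i, ∃ l : ℤ, z' i = z i + l := by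
      intro i
      have h2 : ((z i : ℝ) : UnitAddCircle) = (z' i : ℝ) := congrFun hzz i
      obtain ⟨l, hl⟩ := AddSubgroup.mem_zmultiples_iff.1 (QuotientAddGroup.eq.1 h2)
      refine ⟨l, ?_⟩
      simp at hl
      linarith
    choose l hl using h1
    have h3 : z' = z + intVec l := funext hl
    change S z = S z'
    rw [h3, hSper]
  let U : C(UnitAddTorus (Fin d), ℂ) := hπ.lift ⟨S, hScont⟩ hfac
  have hU : ∀ z : Fin d → ℝ, U (fun i => (z i : UnitAddCircle)) = S z := fun z =>
    congrArg (fun f : C(Fin d → ℝ, ℂ) => f z) (hπ.lift_comp ⟨S, hScont⟩ hfac)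
  -- Unfolding: the integer translates of the unit cell tile the space and the character is
  -- periodic, so a Fourier coefficient of `U` is a value of the Fourier transform of `u`.
  have hcoeff : ∀ k, UnitAddTorus.mFourierCoeff U k = ∫ z, charNeg k z * u z := by
    intro k
    rw [UnitAddTorus.mFourierCoeff_eq_integral _ _ (0 : Fin d → ℝ)]
    have h0 : {x : Fin d → ℝ | ∀ i, x i ∈ Set.Ioc ((0 : Fin d → ℝ) i) ((0 : Fin d → ℝ) i + 1)} =
        unitCell 0 := by
      ext x
      simp [unitCell]
    rw [h0]
    simp_rw [mFourier_neg_coe, hU, smul_eq_mul, hS, ← tsum_mul_left]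
    obtain ⟨b, hbs, hbb⟩ := hb 1
    have hcell : ∀ z ∈ unitCell (0 : Fin d → ℤ), ∀ i, |z i| ≤ 1 := by
      intro z hz i
      have := hz i
      simp only [Pi.zero_apply, Int.cast_zero, zero_add, Set.mem_Ioc] at this
      rw [abs_le]
      constructor <;> linarith [this.1, this.2]
    have hcont : ∀ l, Continuous fun z => charNeg k z * u (z + intVec l) := fun l =>
      (continuous_charNeg k).mul (by fun_prop)
    have hint : ∀ l, IntegrableOn (fun z => charNeg k z * u (z + intVec l)) (unitCell 0) :=
      fun l => ((hcont l).continuousOn.integrableOn_compact isCompact_Icc).mono_set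
        (unitCell_subset 0)
    have hsumm : Summable fun l => ∫ z in unitCell 0, ‖charNeg k z * u (z + intVec l)‖ := by
      refine Summable.of_nonneg_of_le (fun l => integral_nonneg fun z => norm_nonneg _)
        (fun l => ?_) hbs
      have h1 : ∀ z ∈ unitCell (0 : Fin d → ℤ), ‖charNeg k z * u (z + intVec l)‖ ≤ b l := by
        intro z hz
        rw [norm_mul, norm_charNeg, one_mul]
        exact hbb l z (hcell z hz)
      calc ∫ z in unitCell 0, ‖charNeg k z * u (z + intVec l)‖
          ≤ ∫ z in unitCell (0 : Fin d → ℤ), b l := by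
            refine setIntegral_mono_on (hint l).norm ?_ (measurableSet_unitCell 0) h1
            exact integrableOn_const (by rw [volume_unitCell_zero]; exact ENNReal.one_ne_top)
        _ = b l := by
            rw [setIntegral_const, measureReal_def, volume_unitCell_zero]
            simp
    have h1 := hasSum_integral_of_summable_integral_norm hint hsumm
    have h2 : ∀ l, ∫ z in unitCell 0, charNeg k z * u (z + intVec l) =
        ∫ z in unitCell l, charNeg k z * u z := by
      intro l
      rw [← setIntegral_unitCell (fun z => charNeg k z * u z) l]
      simp_rw [charNeg_add]
    simp_rw [h2] at h1
    have hint2 : Integrable fun z => charNeg k z * u z :=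
      hi.bdd_mul (c := 1) (continuous_charNeg k).aestronglyMeasurable
        (Filter.Eventually.of_forall fun z => (norm_charNeg k z).le)
    have h3 := hasSum_integral_iUnion (s := unitCell (d := d)) measurableSet_unitCell
      disjoint_unitCell hint2.integrableOn
    rw [iUnion_unitCell, setIntegral_univ] at h3
    exact h1.unique h3
  -- Only the coefficient at zero survives. The Fourier series of the continuous function `U` is
  -- thus summable and represents it pointwise, in particular at the origin.
  have hzero : ∀ k ∉ ({0} : Finset (Fin d → ℤ)), UnitAddTorus.mFourierCoeff U k = 0 := by
    intro k hk
    rw [hcoeff, hF k (by simpa using hk)]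
  have h4 := UnitAddTorus.hasSum_mFourier_series_apply_of_summable
    (summable_of_ne_finset_zero hzero) (fun _ => ((0 : ℝ) : UnitAddCircle))
  have h5 := hU 0
  simp only [Pi.zero_apply] at h5
  rw [h5] at h4
  have h6 := h4.unique (hasSum_sum_of_ne_finset_zero (s := {0}) fun k hk => by
    rw [hzero k hk, zero_smul])
  rw [Finset.sum_singleton, UnitAddTorus.mFourier_zero, hcoeff] at h6
  have h7 : S 0 = ∑' k, u (intVec k) := by simp [hS]
  have h8 : ∀ z, charNeg (0 : Fin d → ℤ) z = 1 := fun z => by simp [charNeg]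
  rw [← h7, h6]
  simp [h8]

end Poisson

/-! ### Poisson summation over the Frolov lattice. -/

section LatticeSum

variable {d : ℕ} {ξ : Fin d → ℝ}

/-- In each coordinate `1 + z² ≤ 2(1 + R²)(1 + (z + v)²)`. This makes the summability of lattice
sums uniform on bounded sets of shifts. -/
theorem majorant_add_le (z v : EuclideanSpace ℝ (Fin d)) {R : ℝ} (hv : ∀ i, |v i| ≤ R) :
    majorant 0 (z + v) ≤ (2 * (1 + R ^ 2)) ^ d * majorant 0 z := by
  have h : (2 * (1 + R ^ 2)) ^ d = ∏ _i : Fin d, (2 * (1 + R ^ 2)) := by simp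
  rw [h, majorant, majorant, ← Finset.prod_mul_distrib]
  refine Finset.prod_le_prod (fun i _ => by positivity) fun i _ => ?_
  simp only [Pi.zero_apply, pow_zero, one_mul, PiLp.add_apply]
  rw [← div_eq_mul_inv, inv_eq_one_div, div_le_div_iff₀ (by positivity) (by positivity)]
  have h1 : v i ^ 2 ≤ R ^ 2 := sq_le_sq' (by linarith [(abs_le.1 (hv i)).1]) (abs_le.1 (hv i)).2
  nlinarith [sq_nonneg (z i + 2 * v i), mul_nonneg (sq_nonneg R) (sq_nonneg (z i + v i)),
    sq_nonneg (z i + v i)]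

theorem IsFrolovRoots.summable_majorant (hξ : IsFrolovRoots ξ) (hd : 1 ≤ d) {n : ℕ} (hn : 1 ≤ n)
    (m : Fin d → ℕ) (y : EuclideanSpace ℝ (Fin d)) :
    Summable fun k => majorant m (latticePoint ξ n k - y) := by
  obtain ⟨N, hN⟩ := exists_nat_ge ((n : ℝ) / separation ξ)
  rw [div_le_iff₀ hξ.separation_pos] at hN
  have hn' : (0 : ℝ) < n := by exact_mod_cast hn
  have hN1 : 1 ≤ N := by
    rcases Nat.eq_zero_or_pos N with h | h
    · rw [h, Nat.cast_zero, zero_mul] at hN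
      linarith
    · exact h
  refine summable_of_sum_le (fun k => majorant_nonneg m _) fun F =>
    hξ.sum_majorant_le hd hn m hN1 (hN.trans ?_) y F
  have : (1 : ℝ) ≤ 2 ^ ∑ i, m i := one_le_pow₀ (by norm_num)
  have h2 : 0 ≤ N * separation ξ := mul_nonneg (Nat.cast_nonneg _) hξ.separation_pos.le
  exact le_mul_of_one_le_right h2 this

/-- The lattice sum of a function whose Fourier transform vanishes at the nonzero points of the dual
lattice. -/
theorem IsFrolovRoots.tsum_latticePoint_eq (hξ : IsFrolovRoots ξ) (hd : 1 ≤ d) {n : ℕ} (hn : 1 ≤ n)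
    {Λ : EuclideanSpace ℝ (Fin d) → ℂ} (hc : Continuous Λ) {C : ℝ}
    (hΛ : ∀ x, ‖Λ x‖ ≤ C * majorant 0 x)
    (hF : ∀ k : Fin d → ℤ, k ≠ 0 → ∀ w : EuclideanSpace ℝ (Fin d),
      (latticeMatrix ξ n).transpose.mulVec (fun i => w i) = intVec k → 𝓕 Λ w = 0)
    (y : EuclideanSpace ℝ (Fin d)) :
    (n : ℂ)⁻¹ * ∑' k, Λ (latticePoint ξ n k - y) = ∫ x, Λ x := by
  set T := latticeMatrix ξ n with hT
  have hn' : (0 : ℝ) < n := by exact_mod_cast hn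
  have hdetabs := hξ.abs_det_latticeMatrix hd hn
  have hdet : T.det ≠ 0 := by
    intro h0
    rw [← hT, h0, abs_zero] at hdetabs
    have : (0 : ℝ) < (n : ℝ)⁻¹ := inv_pos.2 hn'
    linarith
  have hC : 0 ≤ C := by
    have h1 := (norm_nonneg _).trans (hΛ 0)
    have h2 : majorant (0 : Fin d → ℕ) 0 = 1 := by simp [majorant]
    rwa [h2, mul_one] at h1
  have hΛi : Integrable Λ := ((integrable_majorant 0).const_mul C).mono' hc.aestronglyMeasurable
    (Filter.Eventually.of_forall hΛ)
  set A : (Fin d → ℝ) → EuclideanSpace ℝ (Fin d) := fun z => WithLp.toLp 2 (T.mulVec z) with hA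
  have hAc : Continuous A := (PiLp.continuous_toLp 2 _).comp (by fun_prop)
  -- The factor `n` is `|det T|⁻¹`, by the normalisation of the generator.
  have hchange : ∀ G : EuclideanSpace ℝ (Fin d) → ℂ, ∫ z, G (A z) = n * ∫ x, G x := by
    intro G
    have hemb : MeasurableEmbedding (Matrix.toLin' T) := by
      have := ((Matrix.toLin' T).equivOfDetNeZero
        (by rwa [LinearMap.det_toLin'])).toContinuousLinearEquiv.toHomeomorph.measurableEmbedding
      exact this
    have h1 := hemb.integral_map (μ := volume) (fun v => G (WithLp.toLp 2 v))
    rw [Real.map_matrix_volume_pi_eq_smul_volume_pi hdet, integral_smul_measure, abs_inv, hdetabs,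
      inv_inv, ENNReal.toReal_ofReal hn'.le] at h1
    have h2 := (EuclideanSpace.volume_preserving_symm_measurableEquiv_toLp (Fin d)).integral_comp
      (MeasurableEquiv.measurableEmbedding _) (fun v : Fin d → ℝ => G (WithLp.toLp 2 v))
    have h3 : ∫ z, G (A z) = ∫ z, G (WithLp.toLp 2 (Matrix.toLin' T z)) := by
      simp [hA, Matrix.toLin'_apply]
    rw [h3, ← h1, ← h2]
    rw [Complex.real_smul]
    simp
  have hAk : ∀ k z, A (z + intVec k) = latticePoint ξ n k + A z := by
    intro k z
    simp only [hA, Matrix.mulVec_add]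
    rw [add_comm]
    rfl
  have hmain := tsum_eq_integral_of_charNeg (fun z => Λ (A z - y)) (by fun_prop) ?_ ?_ ?_
  · have h1 : ∀ k, A (intVec k) = latticePoint ξ n k := fun k => rfl
    simp only [h1] at hmain
    rw [hmain, hchange fun x => Λ (x - y), integral_sub_right_eq_self, ← mul_assoc,
      inv_mul_cancel₀ (by exact_mod_cast hn'.ne'), one_mul]
  · have hemb : MeasurableEmbedding (Matrix.toLin' T) := by
      have := ((Matrix.toLin' T).equivOfDetNeZero
        (by rwa [LinearMap.det_toLin'])).toContinuousLinearEquiv.toHomeomorph.measurableEmbedding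
      exact this
    have h1 : Integrable (fun v : Fin d → ℝ => Λ (WithLp.toLp 2 v - y)) := by
      refine (((EuclideanSpace.volume_preserving_symm_measurableEquiv_toLp (Fin d)).symm
        _).integrable_comp_emb (MeasurableEquiv.measurableEmbedding _)).2 (hΛi.comp_sub_right y)
    have h2 := hemb.integrable_map_iff (μ := volume) (g := fun v : Fin d → ℝ => Λ (WithLp.toLp 2 v - y))
    rw [Real.map_matrix_volume_pi_eq_smul_volume_pi hdet] at h2
    exact h2.1 (h1.smul_measure ENNReal.ofReal_ne_top)
  · intro R
    -- `R'` bounds the coordinates of `A z - y` for `z` in the cube of radius `R`; the majorant is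
    -- then moved back to the lattice point itself.
    set R' : ℝ := (∑ i, ∑ j, |T i j|) * |R| + ‖y‖ with hR'
    refine ⟨fun k => C * ((2 * (1 + R' ^ 2)) ^ d * majorant 0 (latticePoint ξ n k - 0)),
      ((hξ.summable_majorant hd hn 0 0).mul_left _).mul_left _, fun k z hz => ?_⟩
    refine (hΛ _).trans (mul_le_mul_of_nonneg_left ?_ hC)
    rw [hAk, add_sub_assoc, sub_zero]
    refine majorant_add_le _ _ fun i => ?_
    have h1 : |(A z - y) i| ≤ |A z i| + ‖y‖ := by
      rw [PiLp.sub_apply]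
      refine (abs_sub _ _).trans (add_le_add_right ?_ _)
      exact PiLp.norm_apply_le y i
    refine h1.trans (add_le_add_left ?_ _)
    have h2 : A z i = ∑ j, T i j * z j := rfl
    rw [h2]
    calc |∑ j, T i j * z j| ≤ ∑ j, |T i j * z j| := Finset.abs_sum_le_sum_abs _ _
      _ ≤ ∑ j, |T i j| * |R| := by
          refine Finset.sum_le_sum fun j _ => ?_
          rw [abs_mul]
          exact mul_le_mul_of_nonneg_left ((hz j).trans (le_abs_self R)) (abs_nonneg _)
      _ = (∑ j, |T i j|) * |R| := by rw [Finset.sum_mul]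
      _ ≤ _ := mul_le_mul_of_nonneg_right (Finset.single_le_sum
          (f := fun i => ∑ j, |T i j|) (fun i _ => Finset.sum_nonneg fun j _ => abs_nonneg _)
          (Finset.mem_univ i)) (abs_nonneg _)
  · intro k hk
    -- The dual point belonging to `k`: since `k · z = ⟨T z, w⟩`, the character becomes an
    -- exponential of frequency `w` after the change of variables, and the shift by `y` contributes
    -- only a phase.
    set w : EuclideanSpace ℝ (Fin d) := WithLp.toLp 2 ((T.transpose)⁻¹.mulVec (intVec k)) with hw
    have hdetT : IsUnit T.transpose.det := by
      rw [Matrix.det_transpose]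
      exact isUnit_iff_ne_zero.2 hdet
    have hTw : T.transpose.mulVec (fun i => w i) = intVec k := by
      change T.transpose.mulVec ((T.transpose)⁻¹.mulVec (intVec k)) = _
      rw [Matrix.mulVec_mulVec, Matrix.mul_nonsing_inv _ hdetT, Matrix.one_mulVec]
    have hchar : ∀ z, charNeg k z =
        Complex.exp ((-(2 * Real.pi * inner ℝ (A z) w) : ℝ) * Complex.I) := by
      intro z
      have h1 : inner ℝ (A z) w = ∑ i, (k i : ℝ) * z i := by
        have h2 : ∑ i, (k i : ℝ) * z i = intVec k ⬝ᵥ z := rfl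
        rw [h2, ← hTw, Matrix.mulVec_transpose, ← Matrix.dotProduct_mulVec,
          EuclideanSpace.inner_eq_star_dotProduct]
        simp [hA]
      rw [h1, charNeg]
      congr 1
      push_cast
      ring
    have h3 := hchange fun x =>
      Complex.exp ((-(2 * Real.pi * inner ℝ x w) : ℝ) * Complex.I) * Λ (x - y)
    simp_rw [hchar]
    rw [h3, ← integral_add_right_eq_self _ y]
    have h4 : ∀ x, Complex.exp ((-(2 * Real.pi * inner ℝ (x + y) w) : ℝ) * Complex.I) *
        Λ (x + y - y) = Complex.exp ((-(2 * Real.pi * inner ℝ y w) : ℝ) * Complex.I) *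
          (Complex.exp ((-(2 * Real.pi * inner ℝ x w) : ℝ) * Complex.I) * Λ x) := by
      intro x
      rw [add_sub_cancel_right, ← mul_assoc, ← Complex.exp_add, inner_add_left]
      congr 2
      push_cast
      ring
    simp_rw [h4]
    have h5 := hF k hk w hTw
    rw [Real.fourier_eq'] at h5
    simp only [smul_eq_mul] at h5
    rw [integral_const_mul]
    have h6 : ∫ x, Complex.exp ((-(2 * Real.pi * inner ℝ x w) : ℝ) * Complex.I) * Λ x = 0 := by
      rw [← h5]
      refine integral_congr_ae (Filter.Eventually.of_forall fun x => ?_)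
      simp
    rw [h6]
    simp

end LatticeSum

/-! ### Dual kernels in one dimension. -/

section OneDim

theorem fourier_dilate (f : ℝ → ℂ) {c : ℝ} (hc : 0 < c) (t : ℝ) :
    𝓕 (fun x => (c : ℂ) * f (c * x)) t = 𝓕 f (t / c) := by
  rw [Real.fourier_eq', Real.fourier_eq']
  have h := Measure.integral_comp_mul_left
    (fun x => Complex.exp (↑(-2 * Real.pi * inner ℝ x (t / c)) * Complex.I) • f x) c
  have h2 : ∀ x : ℝ, Complex.exp (↑(-2 * Real.pi * inner ℝ x t) * Complex.I) • ((c : ℂ) * f (c * x))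
      = (c : ℂ) * (Complex.exp (↑(-2 * Real.pi * inner ℝ (c * x) (t / c)) * Complex.I) • f (c * x)) := by
    intro x
    have h3 : inner ℝ (c * x) (t / c) = inner ℝ x t := by
      simp only [RCLike.inner_apply, conj_trivial]
      field_simp
    rw [h3, smul_eq_mul, smul_eq_mul]
    ring
  simp_rw [h2]
  rw [integral_const_mul, h, abs_of_pos (inv_pos.2 hc), Complex.real_smul, ← mul_assoc]
  push_cast
  rw [mul_inv_cancel₀ (by exact_mod_cast hc.ne'), one_mul]

theorem fourierInv_stretch (f : ℝ → ℂ) {c : ℝ} (hc : 0 < c) (x : ℝ) :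
    𝓕⁻ (fun t => f (t / c)) x = c * 𝓕⁻ f (c * x) := by
  rw [Real.fourierInv_eq_fourier_neg, Real.fourierInv_eq_fourier_neg]
  have h := fourier_dilate (fun t => f t) (inv_pos.2 hc) (-x)
  have h2 : (fun t => f (t / c)) = fun t => (c : ℂ) * (((c⁻¹ : ℝ) : ℂ) * f (c⁻¹ * t)) := by
    funext t
    rw [← mul_assoc]
    push_cast
    rw [mul_inv_cancel₀ (by exact_mod_cast hc.ne'), one_mul, div_eq_inv_mul]
  have h3 : 𝓕 (fun t => (c : ℂ) * (((c⁻¹ : ℝ) : ℂ) * f (c⁻¹ * t))) (-x) =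
      c * 𝓕 (fun t => ((c⁻¹ : ℝ) : ℂ) * f (c⁻¹ * t)) (-x) := by
    rw [Real.fourier_eq', Real.fourier_eq', ← integral_const_mul]
    congr 1
    funext t
    simp only [smul_eq_mul]
    ring
  rw [h2, h3, h]
  congr 2
  field_simp

/-- Zeros of `g` lie outside the closed set `K`, where the quotient vanishes on an open set. -/
theorem contDiff_div_of_support {f g : ℝ → ℂ} (hf : ContDiff ℝ ∞ f) (hg : ContDiff ℝ ∞ g)
    {K : Set ℝ} (hK : IsClosed K) (hfK : ∀ t ∉ K, f t = 0) (hgK : ∀ t ∈ K, g t ≠ 0) :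
    ContDiff ℝ ∞ fun t => f t / g t := by
  refine contDiff_iff_contDiffAt.2 fun t => ?_
  by_cases ht : t ∈ K
  · simp_rw [div_eq_mul_inv]
    exact hf.contDiffAt.mul (hg.contDiffAt.inv (hgK t ht))
  · refine (contDiffAt_const (c := (0 : ℂ))).congr_of_eventuallyEq ?_
    filter_upwards [hK.isOpen_compl.mem_nhds ht] with x hx
    rw [hfK x hx, zero_div]

theorem contDiff_fourier {f : ℝ → ℂ} (hf : ContDiff ℝ ∞ f) (hc : HasCompactSupport f) :
    ContDiff ℝ ∞ (𝓕 f) :=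
  (𝓕 (hc.toSchwartzMap hf)).smooth ⊤

theorem exists_decay (f : 𝓢(ℝ, ℂ)) : ∃ C : ℝ, 0 ≤ C ∧ ∀ x, ‖f x‖ ≤ C * (1 + x ^ 2)⁻¹ := by
  obtain ⟨B, hB0, hB⟩ := exists_weighted_bound f 2 0
  refine ⟨B, hB0, fun x => ?_⟩
  rw [← div_eq_mul_inv, le_div_iff₀ (by positivity), mul_comm]
  have h1 := hB x
  rw [norm_iteratedFDeriv_zero] at h1
  refine le_trans ?_ h1
  gcongr
  rw [Real.norm_eq_abs]
  nlinarith [abs_nonneg x, sq_abs x]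

variable {L : ℕ}

/-- Band-limited kernels on the frequency side which complement the local means to a resolution of
the identity. -/
theorem Kernels.exists_dual (Ψ : Kernels L) : ∃ (l : ℕ → ℝ → ℂ) (χ : ℝ → ℂ) (ε C : ℝ),
    0 < ε ∧ 0 ≤ C ∧ (∀ j, ContDiff ℝ ∞ (l j)) ∧ (∀ j, HasCompactSupport (l j)) ∧
    ContDiff ℝ ∞ χ ∧ HasCompactSupport χ ∧ χ 0 = 1 ∧
    (∀ j t, ε * 2 ^ j ≤ |t| → l j t = 0) ∧
    (∀ j x, ‖𝓕⁻ (l j) x‖ ≤ C * (2 ^ j * (1 + (2 ^ j * x) ^ 2)⁻¹)) ∧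
    (∀ M t, ∑ j ∈ Finset.range (M + 1), l j t * 𝓕 (Ψ.psi j) t = χ (t / 2 ^ M)) := by
  obtain ⟨ε, hε, h0, h1⟩ := Ψ.tauberian
  -- The radii fit the Tauberian conditions: `χ` is supported in `|t| ≤ 3ε/4 < ε`, and `χ(t/2) -
  -- χ(t)` in `5ε/8 ≤ |t| ≤ 3ε/2`, which lies inside `ε/2 < |t| < 2ε`. Both may be divided by the
  -- Fourier transforms of the kernels.
  let b : ContDiffBump (0 : ℝ) := ⟨5 * ε / 8, 3 * ε / 4, by positivity, by linarith⟩
  set χ : ℝ → ℂ := fun t => (b t : ℂ) with hχ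
  have hχs : ContDiff ℝ ∞ χ := Complex.ofRealCLM.contDiff.comp b.contDiff
  have hχc : HasCompactSupport χ := b.hasCompactSupport.comp_left Complex.ofReal_zero
  have hχ1 : ∀ t, |t| ≤ 5 * ε / 8 → χ t = 1 := fun t ht => by
    rw [hχ]
    simp only
    rw [b.one_of_mem_closedBall (by rw [Metric.mem_closedBall, dist_zero_right]; exact ht),
      Complex.ofReal_one]
  have hχ0 : ∀ t, 3 * ε / 4 ≤ |t| → χ t = 0 := fun t ht => by
    rw [hχ]
    simp only
    rw [b.zero_of_le_dist (by rw [dist_zero_right]; exact ht), Complex.ofReal_zero]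
  set φ₁ : ℝ → ℂ := fun t => χ (t / 2) - χ t with hφ₁
  have hφ₁s : ContDiff ℝ ∞ φ₁ := (hχs.comp (contDiff_id.div_const 2)).sub hχs
  have hφ₁0 : ∀ t, t ∉ {t : ℝ | 5 * ε / 8 ≤ |t| ∧ |t| ≤ 3 * ε / 2} → φ₁ t = 0 := by
    intro t ht
    rw [Set.mem_ofPred_eq, not_and_or, not_le, not_le] at ht
    have h2 : |t / 2| = |t| / 2 := by rw [abs_div, abs_two]
    rcases ht with ht | ht
    · rw [hφ₁]
      simp only
      rw [hχ1 t ht.le, hχ1 (t / 2) (by rw [h2]; linarith), sub_self]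
    · rw [hφ₁]
      simp only
      rw [hχ0 t (by linarith), hχ0 (t / 2) (by rw [h2]; linarith), sub_self]
  have hK₁ : IsClosed {t : ℝ | 5 * ε / 8 ≤ |t| ∧ |t| ≤ 3 * ε / 2} :=
    isClosed_Icc.preimage continuous_abs
  have hK₀ : IsClosed {t : ℝ | |t| ≤ 3 * ε / 4} := isClosed_Iic.preimage continuous_abs
  have hF₀ := contDiff_fourier Ψ.contDiff_psi0 Ψ.hasCompactSupport_psi0
  have hF₁ := contDiff_fourier Ψ.contDiff_psi1 Ψ.hasCompactSupport_psi1
  have hne₀ : ∀ t ∈ {t : ℝ | |t| ≤ 3 * ε / 4}, 𝓕 Ψ.psi0 t ≠ 0 := fun t ht =>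
    h0 t (lt_of_le_of_lt ht (by linarith))
  have hne₁ : ∀ t ∈ {t : ℝ | 5 * ε / 8 ≤ |t| ∧ |t| ≤ 3 * ε / 2}, 𝓕 Ψ.psi1 t ≠ 0 := fun t ht =>
    h1 t (lt_of_lt_of_le (by linarith) ht.1) (lt_of_le_of_lt ht.2 (by linarith))
  have hχK : ∀ t ∉ {t : ℝ | |t| ≤ 3 * ε / 4}, χ t = 0 := fun t ht =>
    hχ0 t (not_le.1 ht).le
  set l₀ : ℝ → ℂ := fun t => χ t / 𝓕 Ψ.psi0 t with hl₀
  set l₁ : ℝ → ℂ := fun t => φ₁ t / 𝓕 Ψ.psi1 t with hl₁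
  have hl₀s : ContDiff ℝ ∞ l₀ := contDiff_div_of_support hχs hF₀ hK₀ hχK hne₀
  have hl₁s : ContDiff ℝ ∞ l₁ := contDiff_div_of_support hφ₁s hF₁ hK₁ hφ₁0 hne₁
  have hl₀0 : ∀ t, ε ≤ |t| → l₀ t = 0 := fun t ht => by
    rw [hl₀]
    simp only
    rw [hχ0 t (by linarith), zero_div]
  have hl₁0 : ∀ t, 2 * ε ≤ |t| → l₁ t = 0 := fun t ht => by
    rw [hl₁]
    simp only
    rw [hφ₁0 t (fun h => by linarith [h.2]), zero_div]
  have hcs : ∀ (f : ℝ → ℂ) (r : ℝ), (∀ t, r ≤ |t| → f t = 0) → HasCompactSupport f := by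
    intro f r hf
    refine HasCompactSupport.intro (K := Metric.closedBall 0 r) (isCompact_closedBall 0 r) ?_
    intro t ht
    rw [Metric.mem_closedBall, dist_zero_right, not_le] at ht
    exact hf t ht.le
  have hl₀c := hcs _ _ hl₀0
  have hl₁c := hcs _ _ hl₁0
  set l : ℕ → ℝ → ℂ := fun j => match j with
    | 0 => l₀
    | j + 1 => fun t => l₁ (t / 2 ^ j) with hl
  have hls : ∀ j t, ε * 2 ^ j ≤ |t| → l j t = 0 := by
    intro j t ht
    cases j with
    | zero => exact hl₀0 t (by simpa using ht)
    | succ j =>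
      refine hl₁0 _ ?_
      rw [abs_div, abs_of_pos (by positivity : (0 : ℝ) < 2 ^ j), le_div_iff₀ (by positivity)]
      rw [pow_succ] at ht
      linarith
  obtain ⟨C₀, hC₀, hd₀⟩ := exists_decay (𝓕⁻ (hl₀c.toSchwartzMap hl₀s))
  obtain ⟨C₁, hC₁, hd₁⟩ := exists_decay (𝓕⁻ (hl₁c.toSchwartzMap hl₁s))
  rw [SchwartzMap.fourierInv_coe] at hd₀ hd₁
  refine ⟨l, χ, ε, C₀ + 4 * C₁, hε, by positivity, fun j => ?_, fun j => hcs _ _ (hls j), hχs, hχc,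
    hχ1 0 (by simp; positivity), hls, fun j x => ?_, fun M t => ?_⟩
  · cases j with
    | zero => exact hl₀s
    | succ j => exact hl₁s.comp (contDiff_id.div_const _)
  · cases j with
    | zero =>
      refine (hd₀ x).trans ?_
      have : (0 : ℝ) ≤ (1 + x ^ 2)⁻¹ := by positivity
      simp only [pow_zero, one_mul]
      gcongr
      linarith
    | succ j =>
      have h2 : 𝓕⁻ (l (j + 1)) x = (2 ^ j : ℝ) * 𝓕⁻ l₁ (2 ^ j * x) :=
        fourierInv_stretch l₁ (by positivity) x
      rw [h2, norm_mul, Complex.norm_real, Real.norm_of_nonneg (by positivity)]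
      have h3 := hd₁ (2 ^ j * x)
      calc (2 : ℝ) ^ j * ‖𝓕⁻ l₁ (2 ^ j * x)‖ ≤ 2 ^ j * (C₁ * (1 + (2 ^ j * x) ^ 2)⁻¹) := by
            gcongr
            exact h3
        _ ≤ 2 ^ j * (C₁ * (4 * (1 + (2 ^ (j + 1) * x) ^ 2)⁻¹)) := by
            gcongr
            have h4 : (2 : ℝ) ^ (j + 1) * x = 2 * (2 ^ j * x) := by ring
            rw [← div_eq_mul_inv, inv_eq_one_div, div_le_div_iff₀ (by positivity) (by positivity),
              h4]
            nlinarith [sq_nonneg ((2 : ℝ) ^ j * x)]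
        _ = (2 * C₁) * (2 ^ (j + 1) * (1 + (2 ^ (j + 1) * x) ^ 2)⁻¹) := by
            rw [pow_succ]
            ring
        _ ≤ _ := by
            gcongr
            linarith
  -- The sum telescopes: the new term is `χ(t/2^{M+1}) - χ(t/2^M)`.
  · induction M with
    | zero =>
      rw [zero_add, Finset.sum_range_one, pow_zero, div_one]
      change l₀ t * 𝓕 Ψ.psi0 t = χ t
      by_cases ht : t ∈ {t : ℝ | |t| ≤ 3 * ε / 4}
      · exact div_mul_cancel₀ _ (hne₀ t ht)
      · rw [hl₀]
        simp only
        rw [hχK t ht, zero_div, zero_mul]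
    | succ M ih =>
      rw [Finset.sum_range_succ, ih]
      have h2 : 𝓕 (Ψ.psi (M + 1)) t = 𝓕 Ψ.psi1 (t / 2 ^ M) := by
        have := fourier_dilate Ψ.psi1 (c := 2 ^ M) (by positivity) t
        rw [← this]
        refine congrArg (fun g : ℝ → ℂ => 𝓕 g t) (funext fun x => ?_)
        simp [Kernels.psi]
      have h3 : l (M + 1) t * 𝓕 Ψ.psi1 (t / 2 ^ M) = φ₁ (t / 2 ^ M) := by
        change l₁ (t / 2 ^ M) * _ = _
        by_cases ht : t / 2 ^ M ∈ {t : ℝ | 5 * ε / 8 ≤ |t| ∧ |t| ≤ 3 * ε / 2}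
        · exact div_mul_cancel₀ _ (hne₁ _ ht)
        · rw [hl₁]
          simp only
          rw [hφ₁0 _ ht, zero_div, zero_mul]
      rw [h2, h3, hφ₁]
      simp only
      rw [div_div, ← pow_succ]
      ring

end OneDim

/-! ### Tensor products of test functions. -/

section Tensor

variable {d : ℕ}

/-- The tensor product of smooth compactly supported functions. -/
def tensorSchwartz (f : Fin d → ℝ → ℂ) (hf : ∀ i, ContDiff ℝ ∞ (f i))
    (hc : ∀ i, HasCompactSupport (f i)) : 𝓢(EuclideanSpace ℝ (Fin d), ℂ) :=
  HasCompactSupport.toSchwartzMap (f := fun x : EuclideanSpace ℝ (Fin d) => ∏ i, f i (x i))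
    (by
      refine HasCompactSupport.intro
        (K := WithLp.toLp 2 '' (Set.pi Set.univ fun i => tsupport (f i)))
        ((isCompact_univ_pi fun i => hc i).image (PiLp.continuous_toLp 2 _)) fun y hy => ?_
      by_contra hne
      refine hy ⟨fun i => y i, fun i _ => subset_tsupport _ ?_, rfl⟩
      exact (Finset.prod_ne_zero_iff.1 hne) i (Finset.mem_univ i))
    (contDiff_prod fun i _ => (hf i).comp
      (by fun_prop : ContDiff ℝ ∞ fun y : EuclideanSpace ℝ (Fin d) => y i))

variable {f : Fin d → ℝ → ℂ} {hf : ∀ i, ContDiff ℝ ∞ (f i)} {hc : ∀ i, HasCompactSupport (f i)}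

theorem tensorSchwartz_apply (x : EuclideanSpace ℝ (Fin d)) :
    tensorSchwartz f hf hc x = ∏ i, f i (x i) := rfl

theorem fourier_tensorSchwartz (w : EuclideanSpace ℝ (Fin d)) :
    𝓕 (tensorSchwartz f hf hc) w = ∏ i, 𝓕 (f i) (w i) := by
  rw [SchwartzMap.fourier_coe, Real.fourier_eq']
  simp_rw [Real.fourier_eq']
  rw [← integral_prod_coord]
  refine integral_congr_ae (Filter.Eventually.of_forall fun x => ?_)
  simp only [smul_eq_mul, tensorSchwartz_apply]
  rw [Finset.prod_mul_distrib, ← Complex.exp_sum]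
  congr 2
  rw [PiLp.inner_apply, Finset.mul_sum, Complex.ofReal_sum, Finset.sum_mul]

theorem fourierInv_tensorSchwartz (w : EuclideanSpace ℝ (Fin d)) :
    𝓕⁻ (tensorSchwartz f hf hc) w = ∏ i, 𝓕⁻ (f i) (w i) := by
  have h1 : 𝓕⁻ (tensorSchwartz f hf hc) w = 𝓕 (tensorSchwartz f hf hc) (-w) := by
    rw [SchwartzMap.fourierInv_coe, SchwartzMap.fourier_coe, Real.fourierInv_eq_fourier_neg]
  rw [h1, fourier_tensorSchwartz]
  simp_rw [Real.fourierInv_eq_fourier_neg]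
  rfl

end Tensor

/-! ### The reproducing formula. -/

section Reproducing

open SchwartzMap Filter Topology

variable {L d : ℕ}

/-- Band-limited kernels, given by their Fourier transforms `l j`, which complement the local means
to a resolution of the identity. -/
structure DualKernels (Ψ : Kernels L) where
  l : ℕ → ℝ → ℂ
  χ : ℝ → ℂ
  ε : ℝ
  C : ℝ
  ε_pos : 0 < ε
  C_nonneg : 0 ≤ C
  contDiff_l : ∀ j, ContDiff ℝ ∞ (l j)
  hasCompactSupport_l : ∀ j, HasCompactSupport (l j)
  contDiff_χ : ContDiff ℝ ∞ χ
  hasCompactSupport_χ : HasCompactSupport χ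
  χ_zero : χ 0 = 1
  l_eq_zero : ∀ j t, ε * 2 ^ j ≤ |t| → l j t = 0
  norm_fourierInv_l_le : ∀ j x, ‖𝓕⁻ (l j) x‖ ≤ C * (2 ^ j * (1 + (2 ^ j * x) ^ 2)⁻¹)
  sum_l : ∀ M t, ∑ j ∈ Finset.range (M + 1), l j t * 𝓕 (Ψ.psi j) t = χ (t / 2 ^ M)

theorem Kernels.nonempty_dualKernels (Ψ : Kernels L) : Nonempty (DualKernels Ψ) := by
  obtain ⟨l, χ, ε, C, h1, h2, h3, h4, h5, h6, h7, h8, h9, h10⟩ := Ψ.exists_dual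
  exact ⟨⟨l, χ, ε, C, h1, h2, h3, h4, h5, h6, h7, h8, h9, h10⟩⟩

variable {Ψ : Kernels L}

/-- The Fourier transform of the dual kernel. -/
def DualKernels.hat (D : DualKernels Ψ) (m : Fin d → ℕ) : 𝓢(EuclideanSpace ℝ (Fin d), ℂ) :=
  tensorSchwartz (fun i => D.l (m i)) (fun i => D.contDiff_l (m i))
    fun i => D.hasCompactSupport_l (m i)

/-- The dual kernel. -/
def DualKernels.kernel (D : DualKernels Ψ) (m : Fin d → ℕ) : 𝓢(EuclideanSpace ℝ (Fin d), ℂ) :=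
  𝓕⁻ (D.hat m)

theorem DualKernels.norm_kernel_le (D : DualKernels Ψ) (m : Fin d → ℕ)
    (x : EuclideanSpace ℝ (Fin d)) : ‖D.kernel m x‖ ≤ D.C ^ d * majorant m x := by
  have h : D.C ^ d = ∏ _i : Fin d, D.C := by simp
  rw [kernel, hat, fourierInv_tensorSchwartz, norm_prod, h, majorant, ← Finset.prod_mul_distrib]
  exact Finset.prod_le_prod (fun i _ => norm_nonneg _) fun i _ => D.norm_fourierInv_l_le _ _

theorem DualKernels.fourier_kernel_eq_zero (D : DualKernels Ψ) (m : Fin d → ℕ)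
    {w : EuclideanSpace ℝ (Fin d)} {i : Fin d} (h : D.ε * 2 ^ m i ≤ |w i|) :
    𝓕 (D.kernel m) w = 0 := by
  rw [kernel, FourierTransform.fourier_fourierInv_eq, hat, tensorSchwartz_apply]
  exact Finset.prod_eq_zero (Finset.mem_univ i) (D.l_eq_zero _ _ h)

theorem fourier_eq_fourierInv_neg (φ : 𝓢(EuclideanSpace ℝ (Fin d), ℂ))
    (w : EuclideanSpace ℝ (Fin d)) : 𝓕 φ w = 𝓕⁻ φ (-w) := by
  rw [fourierInv_coe, fourier_coe, Real.fourierInv_eq_fourier_neg, neg_neg]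

theorem fourier_fourier (φ : 𝓢(EuclideanSpace ℝ (Fin d), ℂ))
    (w : EuclideanSpace ℝ (Fin d)) : 𝓕 (𝓕 φ) w = φ (-w) := by
  rw [fourier_eq_fourierInv_neg, FourierTransform.fourierInv_fourier_eq]

/-- The reflected local mean `x ↦ Ψ_m(-x)`. -/
def Kernels.reflected (Ψ : Kernels L) (m : Fin d → ℕ) : 𝓢(EuclideanSpace ℝ (Fin d), ℂ) :=
  tensorSchwartz (fun i t => Ψ.psi (m i) (-t)) (fun i => (Ψ.contDiff_psi (m i)).comp contDiff_neg)
    fun i => show HasCompactSupport fun t => Ψ.psi (m i) (-t) from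
      (Ψ.hasCompactSupport_psi (m i)).comp_homeomorph (Homeomorph.neg ℝ)

theorem Kernels.test_eq (Ψ : Kernels L) (m : Fin d → ℕ) (y : EuclideanSpace ℝ (Fin d)) :
    Ψ.test m y = compSubConstCLM ℂ y (Ψ.reflected m) := by
  ext x
  rw [compSubConstCLM_apply]
  change ∏ i, Ψ.psi (m i) ((y - x) i) = ∏ i, Ψ.psi (m i) (-((x - y) i))
  simp

theorem Kernels.conv_eq (Ψ : Kernels L) (m : Fin d → ℕ) (f : 𝓢'(EuclideanSpace ℝ (Fin d), ℂ))
    (y : EuclideanSpace ℝ (Fin d)) : Ψ.conv m f y = f (compSubConstCLM ℂ y (Ψ.reflected m)) := by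
  rw [conv, test_eq]

theorem Kernels.continuous_conv (Ψ : Kernels L) (m : Fin d → ℕ)
    (f : 𝓢'(EuclideanSpace ℝ (Fin d), ℂ)) : Continuous (Ψ.conv m f) := by
  have : Ψ.conv m f = fun y => f (compSubConstCLM ℂ y (Ψ.reflected m)) := funext (Ψ.conv_eq m f)
  rw [this]
  exact continuous_apply_translate f _

theorem Kernels.fourier_reflected (Ψ : Kernels L) (m : Fin d → ℕ)
    (w : EuclideanSpace ℝ (Fin d)) : 𝓕 (Ψ.reflected m) w = ∏ i, 𝓕 (Ψ.psi (m i)) (-(w i)) := by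
  rw [reflected, fourier_tensorSchwartz]
  refine Finset.prod_congr rfl fun i _ => ?_
  rw [← Real.fourierInv_eq_fourier_neg, Real.fourierInv_eq_fourier_comp_neg]

/-- The index set `{0, …, M}^d`. -/
def indexBox (d M : ℕ) : Finset (Fin d → ℕ) := Fintype.piFinset fun _ => Finset.range (M + 1)

/-- The reflected kernel of the partial sums of the resolution of the identity. -/
def DualKernels.approx (D : DualKernels Ψ) (d M : ℕ) : 𝓢(EuclideanSpace ℝ (Fin d), ℂ) :=
  𝓕 (tensorSchwartz (fun _ t => D.χ (t / 2 ^ M))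
    (fun _ => D.contDiff_χ.comp (contDiff_id.div_const _))
    fun _ => by
      have h : (fun t : ℝ => D.χ (t / 2 ^ M)) = D.χ ∘ Homeomorph.mulRight₀ ((2 ^ M : ℝ)⁻¹)
          (by positivity) := by
        funext t
        simp [div_eq_mul_inv]
      rw [h]
      exact D.hasCompactSupport_χ.comp_homeomorph _)

/-- On the Fourier side convolutions are products, and the sum over the box of indices factors into
one-dimensional sums, which `sum_l` evaluates. The kernels occur reflected because they act on the
test function and not on the distribution. -/
theorem DualKernels.convolution_approx (D : DualKernels Ψ) (M : ℕ)
    (h : 𝓢(EuclideanSpace ℝ (Fin d), ℂ)) :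
    convolution (ContinuousLinearMap.mul ℂ ℂ) (D.approx d M) h = ∑ m ∈ indexBox d M,
      convolution (ContinuousLinearMap.mul ℂ ℂ)
        (convolution (ContinuousLinearMap.mul ℂ ℂ) (𝓕 (D.hat m)) h) (Ψ.reflected m) := by
  have key : 𝓕 (convolution (ContinuousLinearMap.mul ℂ ℂ) (D.approx d M) h) =
      𝓕 (∑ m ∈ indexBox d M, convolution (ContinuousLinearMap.mul ℂ ℂ)
        (convolution (ContinuousLinearMap.mul ℂ ℂ) (𝓕 (D.hat m)) h) (Ψ.reflected m)) := by
    have hs : 𝓕 (∑ m ∈ indexBox d M, convolution (ContinuousLinearMap.mul ℂ ℂ)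
        (convolution (ContinuousLinearMap.mul ℂ ℂ) (𝓕 (D.hat m)) h) (Ψ.reflected m)) =
        ∑ m ∈ indexBox d M, 𝓕 (convolution (ContinuousLinearMap.mul ℂ ℂ)
        (convolution (ContinuousLinearMap.mul ℂ ℂ) (𝓕 (D.hat m)) h) (Ψ.reflected m)) :=
      map_sum (FourierTransform.fourierCLM ℂ 𝓢(EuclideanSpace ℝ (Fin d), ℂ)) _ _
    rw [hs]
    ext w
    simp only [fourier_convolution, _root_.sum_apply, pairing_apply_apply,
      ContinuousLinearMap.mul_apply', fourier_fourier, Ψ.fourier_reflected, approx, hat,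
      tensorSchwartz_apply]
    simp_rw [mul_right_comm _ (𝓕 h w)]
    rw [← Finset.sum_mul]
    congr 1
    simp_rw [← Finset.prod_mul_distrib]
    rw [indexBox, Finset.sum_prod_piFinset (Finset.range (M + 1))
      (fun i j => D.l j ((-w) i) * 𝓕 (Ψ.psi j) (-(w i)))]
    refine Finset.prod_congr rfl fun i _ => ?_
    rw [PiLp.neg_apply, D.sum_l]
  have := congrArg (fun φ => 𝓕⁻ φ) key
  simpa only [FourierTransform.fourierInv_fourier_eq] using this

/-- The kernels are dilations of a single function of integral one, hence an approximate identity.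
-/
theorem DualKernels.approx_apply (D : DualKernels Ψ) (M : ℕ) (y : EuclideanSpace ℝ (Fin d)) :
    D.approx d M y = ((((2 : ℝ) ^ M) ^ d : ℝ) : ℂ) * D.approx d 0 (((2 : ℝ) ^ M) • y) := by
  have h : ((((2 : ℝ) ^ M) ^ d : ℝ) : ℂ) = ∏ _i : Fin d, (((2 : ℝ) ^ M : ℝ) : ℂ) := by simp
  rw [approx, approx, fourier_tensorSchwartz, fourier_tensorSchwartz, h,
    ← Finset.prod_mul_distrib]
  refine Finset.prod_congr rfl fun i _ => ?_
  have h1 := fourierInv_stretch D.χ (c := 2 ^ M) (by positivity) (-(y i))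
  rw [Real.fourierInv_eq_fourier_neg, Real.fourierInv_eq_fourier_neg, neg_neg, mul_neg, neg_neg] at h1
  rw [h1]
  simp

theorem DualKernels.integral_approx_zero (D : DualKernels Ψ) : ∫ y, D.approx d 0 y = 1 := by
  have h : ∀ φ : 𝓢(EuclideanSpace ℝ (Fin d), ℂ), ∫ y, φ y = 𝓕⁻ φ 0 := by
    intro φ
    rw [fourierInv_coe, Real.fourierInv_eq']
    simp
  rw [h, approx, FourierTransform.fourierInv_fourier_eq, tensorSchwartz_apply]
  simp [D.χ_zero]

/-- After `f` is moved under the convolution integral, the dilation passes to `y ↦ f(h(· - y))`.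
This function is continuous and of polynomial growth, so dominated convergence against a fixed
Schwartz function applies. -/
theorem DualKernels.tendsto_approx (D : DualKernels Ψ) (f : 𝓢'(EuclideanSpace ℝ (Fin d), ℂ))
    (h : 𝓢(EuclideanSpace ℝ (Fin d), ℂ)) :
    Tendsto (fun M => f (convolution (ContinuousLinearMap.mul ℂ ℂ) (D.approx d M) h)) atTop
      (𝓝 (f h)) := by
  set F : EuclideanSpace ℝ (Fin d) → ℂ := fun y => f (compSubConstCLM ℂ y h) with hF
  have hFc : Continuous F := continuous_apply_translate f h
  obtain ⟨K, C, hC, hFb⟩ := norm_apply_translate_le f h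
  have h1 : ∀ M, f (convolution (ContinuousLinearMap.mul ℂ ℂ) (D.approx d M) h) =
      ∫ z, D.approx d 0 z * F (((2 : ℝ) ^ M)⁻¹ • z) := by
    intro M
    rw [apply_convolution]
    have h2 := Measure.integral_comp_smul (μ := (volume : Measure (EuclideanSpace ℝ (Fin d))))
      (fun z => D.approx d 0 z * F (((2 : ℝ) ^ M)⁻¹ • z)) ((2 : ℝ) ^ M)
    rw [finrank_euclideanSpace_fin, abs_of_pos (by positivity)] at h2
    have h3 : ∀ y, D.approx d M y * f (compSubConstCLM ℂ y h) = (((2 : ℝ) ^ M) ^ d : ℝ) •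
        (D.approx d 0 (((2 : ℝ) ^ M) • y) * F (((2 : ℝ) ^ M)⁻¹ • ((2 : ℝ) ^ M) • y)) := by
      intro y
      rw [smul_smul, inv_mul_cancel₀ (by positivity), one_smul, D.approx_apply, Complex.real_smul, mul_assoc]
    simp_rw [h3]
    rw [integral_smul, h2, smul_smul, mul_inv_cancel₀ (by positivity), one_smul]
  simp_rw [h1]
  have h4 : f h = ∫ z, D.approx d 0 z * F 0 := by
    rw [integral_mul_const, D.integral_approx_zero, one_mul, hF]
    simp [compSubConstCLM_zero]
  rw [h4]
  refine tendsto_integral_of_dominated_convergence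
    (fun z => C * (‖D.approx d 0 z‖ * (1 + ‖z‖) ^ K)) (fun M => ?_)
    ((integrable_mul_one_add_norm_pow _ K).const_mul C) (fun M => ?_) ?_
  · exact Continuous.aestronglyMeasurable (by fun_prop)
  · refine Eventually.of_forall fun z => ?_
    rw [norm_mul]
    have h5 : ‖((2 : ℝ) ^ M)⁻¹ • z‖ ≤ ‖z‖ := by
      rw [norm_smul, norm_inv, Real.norm_of_nonneg (by positivity)]
      exact mul_le_of_le_one_left (norm_nonneg _)
        (inv_le_one_of_one_le₀ (one_le_pow₀ (by norm_num)))
    calc _ ≤ ‖D.approx d 0 z‖ * (C * (1 + ‖z‖) ^ K) := by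
          gcongr
          refine (hFb _).trans ?_
          gcongr
      _ = _ := by ring
  · refine Eventually.of_forall fun z => (tendsto_const_nhds.mul ?_)
    have h6 : Tendsto (fun M : ℕ => ((2 : ℝ) ^ M)⁻¹ • z) atTop (𝓝 ((0 : ℝ) • z)) := by
      refine Tendsto.smul_const ?_ z
      simp_rw [← inv_pow]
      exact tendsto_pow_atTop_nhds_zero_of_lt_one (by norm_num) (by norm_num)
    rw [zero_smul] at h6
    exact (hFc.tendsto 0).comp h6

/-- The component `Λ_m * Ψ_m * f`. -/
def DualKernels.piece (D : DualKernels Ψ) (f : 𝓢'(EuclideanSpace ℝ (Fin d), ℂ)) (m : Fin d → ℕ)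
    (x : EuclideanSpace ℝ (Fin d)) : ℂ :=
  ∫ y, D.kernel m (x - y) * Ψ.conv m f y

theorem Kernels.hasCompactSupport_conv (Ψ : Kernels L) {f : 𝓢'(EuclideanSpace ℝ (Fin d), ℂ)}
    (hf : Distribution.dsupport f ⊆ unitCube d) (m : Fin d → ℕ) :
    HasCompactSupport (Ψ.conv m f) := by
  obtain ⟨R, hR0, hR⟩ := Ψ.exists_support_radius
  refine HasCompactSupport.intro (isCompact_cube R) fun x hx => ?_
  have hx' : ¬ ∀ i, -R ≤ x i ∧ x i ≤ 1 + R := hx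
  push Not at hx'
  obtain ⟨i, hi⟩ := hx'
  refine Ψ.conv_eq_zero hR hf m (i := i) ?_
  by_cases h : -R ≤ x i
  · exact Or.inr (hi h)
  · exact Or.inl (not_le.1 h)

theorem Kernels.integrable_conv (Ψ : Kernels L) {f : 𝓢'(EuclideanSpace ℝ (Fin d), ℂ)}
    (hf : Distribution.dsupport f ⊆ unitCube d) (m : Fin d → ℕ) :
    Integrable (Ψ.conv m f) :=
  (Ψ.continuous_conv m f).integrable_of_hasCompactSupport (Ψ.hasCompactSupport_conv hf m)

theorem DualKernels.integrable_prod (D : DualKernels Ψ) {f : 𝓢'(EuclideanSpace ℝ (Fin d), ℂ)}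
    (hf : Distribution.dsupport f ⊆ unitCube d) (m : Fin d → ℕ)
    {h : EuclideanSpace ℝ (Fin d) → ℂ} (hh : Integrable h) :
    Integrable fun z : EuclideanSpace ℝ (Fin d) × EuclideanSpace ℝ (Fin d) =>
      D.kernel m (z.1 - z.2) * (h z.1 * Ψ.conv m f z.2) := by
  refine (hh.mul_prod (Ψ.integrable_conv hf m)).bdd_mul
    (c := SchwartzMap.seminorm ℝ 0 0 (D.kernel m)) ?_ ?_
  · exact Continuous.aestronglyMeasurable (by fun_prop)
  · exact Eventually.of_forall fun z => norm_le_seminorm ℝ _ _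

/-- Applying `f` under the outer convolution produces `Ψ_m * f`; Fubini then moves the reflected
dual kernel from the test function to `Ψ_m * f`. -/
theorem DualKernels.apply_convolution_eq (D : DualKernels Ψ)
    {f : 𝓢'(EuclideanSpace ℝ (Fin d), ℂ)}
    (hf : Distribution.dsupport f ⊆ unitCube d) (m : Fin d → ℕ)
    (h : 𝓢(EuclideanSpace ℝ (Fin d), ℂ)) :
    f (convolution (ContinuousLinearMap.mul ℂ ℂ)
        (convolution (ContinuousLinearMap.mul ℂ ℂ) (𝓕 (D.hat m)) h) (Ψ.reflected m)) =
      ∫ x, h x * D.piece f m x := by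
  rw [apply_convolution]
  have h1 : ∀ y, convolution (ContinuousLinearMap.mul ℂ ℂ) (𝓕 (D.hat m)) h y =
      ∫ x, D.kernel m (x - y) * h x := by
    intro y
    rw [convolution_apply, convolution_eq_swap]
    refine integral_congr_ae (Eventually.of_forall fun x => ?_)
    simp only [ContinuousLinearMap.mul_apply']
    rw [fourier_eq_fourierInv_neg, neg_sub]
    rfl
  simp_rw [h1, ← Ψ.conv_eq, piece]
  have h2 : ∀ y, (∫ x, D.kernel m (x - y) * h x) * Ψ.conv m f y =
      ∫ x, D.kernel m (x - y) * (h x * Ψ.conv m f y) := by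
    intro y
    rw [← integral_mul_const]
    simp_rw [mul_assoc]
  have h3 : ∀ x, h x * ∫ y, D.kernel m (x - y) * Ψ.conv m f y =
      ∫ y, D.kernel m (x - y) * (h x * Ψ.conv m f y) := by
    intro x
    rw [← integral_const_mul]
    refine integral_congr_ae (Eventually.of_forall fun y => ?_)
    ring
  simp_rw [h2, h3]
  exact (integral_integral_swap (D.integrable_prod hf m h.integrable)).symm

/-- The reproducing formula `f = ∑ Λ_m * Ψ_m * f`. -/
theorem DualKernels.tendsto_sum_piece (D : DualKernels Ψ)
    {f : 𝓢'(EuclideanSpace ℝ (Fin d), ℂ)}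
    (hf : Distribution.dsupport f ⊆ unitCube d) (h : 𝓢(EuclideanSpace ℝ (Fin d), ℂ)) :
    Tendsto (fun M => ∑ m ∈ indexBox d M, ∫ x, h x * D.piece f m x) atTop (𝓝 (f h)) := by
  refine (D.tendsto_approx f h).congr fun M => ?_
  rw [D.convolution_approx, map_sum]
  exact Finset.sum_congr rfl fun m _ => D.apply_convolution_eq hf m h

end Reproducing

/-! ### Hölder's inequality for a bounded integrable factor. -/

section Holder

/-- Hölder's inequality for a factor `e` with `‖e‖_∞ ≤ A` and `‖e‖_1 ≤ B`. -/
theorem lintegral_mul_le_of_le {α : Type*} [MeasurableSpace α] {μ : Measure α}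
    {f e : α → ℝ≥0∞} (hf : AEMeasurable f μ) (he : AEMeasurable e μ) {A B : ℝ≥0∞}
    (hA : ∀ x, e x ≤ A) (hB : ∫⁻ x, e x ∂μ ≤ B) {q : ℝ} (hq : 1 ≤ q) :
    ∫⁻ x, f x * e x ∂μ ≤ (∫⁻ x, f x ^ q ∂μ) ^ (1 / q) * A ^ (1 / q) * B ^ (1 - 1 / q) := by
  rcases hq.eq_or_lt with rfl | hq
  · simp only [ENNReal.rpow_one, div_one, sub_self, ENNReal.rpow_zero, mul_one]
    rw [← lintegral_mul_const'' _ hf]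
    exact lintegral_mono fun x => mul_le_mul_right (hA x) (f x)
  · have hpq := Real.HolderConjugate.conjExponent hq
    set q' := Real.conjExponent q
    have h0 := hpq.symm.pos
    have h1 := hpq.symm.lt
    have h2 : 1 / q' = 1 - 1 / q := by
      have := hpq.inv_add_inv_eq_one
      rw [one_div, one_div]
      linarith
    have h3 : (q' - 1) * (1 / q') = 1 / q := by
      rw [sub_mul, one_mul, mul_one_div_cancel h0.ne', h2]
      ring
    refine (ENNReal.lintegral_mul_le_Lp_mul_Lq μ hpq hf he).trans ?_
    rw [mul_assoc]
    refine mul_le_mul_right ?_ _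
    have h4 : ∫⁻ x, e x ^ q' ∂μ ≤ A ^ (q' - 1) * B := by
      refine le_trans ?_ (mul_le_mul_right hB _)
      rw [← lintegral_const_mul'' _ he]
      refine lintegral_mono fun x => ?_
      have : e x ^ q' = e x ^ (q' - 1) * e x := by
        conv_lhs => rw [show q' = (q' - 1) + 1 by ring]
        rw [ENNReal.rpow_add_of_nonneg _ _ (by linarith) zero_le_one, ENNReal.rpow_one]
      simp only [this]
      exact mul_le_mul_left (ENNReal.rpow_le_rpow (hA x) (by linarith)) _
    refine (ENNReal.rpow_le_rpow h4 (by positivity)).trans (le_of_eq ?_)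
    rw [ENNReal.mul_rpow_of_nonneg _ _ (by positivity), ← ENNReal.rpow_mul, h3, h2]

end Holder

/-! ### Components and their lattice sums in terms of `‖Ψ_m * f‖_q`. -/

section Level

variable {L d : ℕ} {Ψ : Kernels L}

/-- The norm `‖Ψ_m * f‖_{L_q}`. -/
def Kernels.levelNorm (Ψ : Kernels L) (q : ℝ) (f : 𝓢'(EuclideanSpace ℝ (Fin d), ℂ))
    (m : Fin d → ℕ) : ℝ≥0∞ := (∫⁻ y, ‖Ψ.conv m f y‖ₑ ^ q) ^ (1 / q)

theorem Kernels.exists_cube (Ψ : Kernels L) (d : ℕ) :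
    ∃ R : ℝ, 0 ≤ R ∧ ∀ f : 𝓢'(EuclideanSpace ℝ (Fin d), ℂ), Distribution.dsupport f ⊆ unitCube d →
      ∀ m x, x ∉ cube d R → Ψ.conv m f x = 0 := by
  obtain ⟨R, hR0, hR⟩ := Ψ.exists_support_radius
  refine ⟨R, hR0.le, fun f hf m x hx => ?_⟩
  have hx' : ¬ ∀ i, -R ≤ x i ∧ x i ≤ 1 + R := hx
  push Not at hx'
  obtain ⟨i, hi⟩ := hx'
  refine Ψ.conv_eq_zero hR hf m (i := i) ?_
  by_cases h : -R ≤ x i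
  · exact Or.inr (hi h)
  · exact Or.inl (not_le.1 h)

/-- Hölder's inequality for `Ψ_m * f`. -/
theorem Kernels.lintegral_conv_mul_le (Ψ : Kernels L) {R : ℝ}
    {f : 𝓢'(EuclideanSpace ℝ (Fin d), ℂ)} (m : Fin d → ℕ)
    (hf : ∀ x, x ∉ cube d R → Ψ.conv m f x = 0)
    {e : EuclideanSpace ℝ (Fin d) → ℝ≥0∞} (he : Measurable e) {A B : ℝ≥0∞}
    (hA : ∀ x, e x ≤ A) (hB : ∫⁻ x in cube d R, e x ≤ B) {q : ℝ} (hq : 1 ≤ q) :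
    ∫⁻ y, ‖Ψ.conv m f y‖ₑ * e y ≤ Ψ.levelNorm q f m * A ^ (1 / q) * B ^ (1 - 1 / q) := by
  have hm : Measurable fun y => ‖Ψ.conv m f y‖ₑ := (Ψ.continuous_conv m f).measurable.enorm
  have h1 : ∫⁻ y, ‖Ψ.conv m f y‖ₑ * e y = ∫⁻ y in cube d R, ‖Ψ.conv m f y‖ₑ * e y := by
    refine (setLIntegral_eq_of_support_subset ?_).symm
    intro y hy
    by_contra h
    exact hy (by simp [hf y h])
  rw [h1]
  refine (lintegral_mul_le_of_le hm.aemeasurable he.aemeasurable hA hB hq).trans ?_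
  refine mul_le_mul_left (mul_le_mul_left ?_ _) _
  exact ENNReal.rpow_le_rpow (setLIntegral_le_lintegral _ _) (by positivity)

theorem DualKernels.enorm_piece_le (D : DualKernels Ψ) (f : 𝓢'(EuclideanSpace ℝ (Fin d), ℂ))
    (m : Fin d → ℕ) (x : EuclideanSpace ℝ (Fin d)) :
    ‖D.piece f m x‖ₑ ≤ ENNReal.ofReal (D.C ^ d) *
      ∫⁻ y, ‖Ψ.conv m f y‖ₑ * ENNReal.ofReal (majorant m (x - y)) := by
  refine (enorm_integral_le_lintegral_enorm _).trans ?_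
  rw [← lintegral_const_mul' _ _ ENNReal.ofReal_ne_top]
  refine lintegral_mono fun y => ?_
  rw [enorm_mul, mul_comm ‖Ψ.conv m f y‖ₑ, ← mul_assoc, ← ENNReal.ofReal_mul (by have := D.C_nonneg; positivity)]
  refine mul_le_mul_left ?_ _
  rw [← ofReal_norm]
  exact ENNReal.ofReal_le_ofReal (D.norm_kernel_le m _)

theorem measurable_ofReal_majorant (m : Fin d → ℕ) :
    Measurable fun z : EuclideanSpace ℝ (Fin d) => ENNReal.ofReal (majorant m z) :=
  (continuous_majorant m).measurable.ennreal_ofReal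

theorem DualKernels.enorm_piece_le_levelNorm (D : DualKernels Ψ) {R : ℝ}
    {f : 𝓢'(EuclideanSpace ℝ (Fin d), ℂ)} (m : Fin d → ℕ)
    (hf : ∀ x, x ∉ cube d R → Ψ.conv m f x = 0) {q : ℝ} (hq : 1 ≤ q)
    (x : EuclideanSpace ℝ (Fin d)) :
    ‖D.piece f m x‖ₑ ≤ ENNReal.ofReal (D.C ^ d) * (Ψ.levelNorm q f m *
      ENNReal.ofReal (2 ^ ∑ i, m i) ^ (1 / q) * ENNReal.ofReal (Real.pi ^ d) ^ (1 - 1 / q)) := by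
  refine (D.enorm_piece_le f m x).trans (mul_le_mul_right ?_ _)
  refine Ψ.lintegral_conv_mul_le m hf ?_ (fun y => ENNReal.ofReal_le_ofReal (majorant_le m _)) ?_ hq
  · exact (measurable_ofReal_majorant m).comp (by fun_prop)
  · exact (setLIntegral_le_lintegral _ _).trans (lintegral_majorant m x).le

theorem DualKernels.lintegral_piece_le (D : DualKernels Ψ) {R : ℝ}
    {f : 𝓢'(EuclideanSpace ℝ (Fin d), ℂ)} (m : Fin d → ℕ)
    (hf : ∀ x, x ∉ cube d R → Ψ.conv m f x = 0) {q : ℝ} (hq : 1 ≤ q) :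
    ∫⁻ x, ‖D.piece f m x‖ₑ ≤ ENNReal.ofReal (D.C ^ d) * (Ψ.levelNorm q f m *
      volume (cube d R) ^ (1 - 1 / q) * ENNReal.ofReal (Real.pi ^ d)) := by
  have hm : Measurable fun y => ‖Ψ.conv m f y‖ₑ := (Ψ.continuous_conv m f).measurable.enorm
  refine (lintegral_mono fun x => D.enorm_piece_le f m x).trans ?_
  rw [lintegral_const_mul' _ _ ENNReal.ofReal_ne_top]
  refine mul_le_mul_right ?_ _
  rw [lintegral_lintegral_swap]
  · have h1 : ∀ y, ∫⁻ x, ‖Ψ.conv m f y‖ₑ * ENNReal.ofReal (majorant m (x - y)) =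
        ‖Ψ.conv m f y‖ₑ * ENNReal.ofReal (Real.pi ^ d) := by
      intro y
      have he : Measurable fun x => ENNReal.ofReal (majorant m (x - y)) :=
        (measurable_ofReal_majorant m).comp (by fun_prop)
      rw [lintegral_const_mul _ he, ← lintegral_majorant m y]
      simp_rw [← neg_sub y, majorant_neg]
    simp_rw [h1]
    rw [lintegral_mul_const _ hm]
    refine mul_le_mul_left ?_ _
    have := Ψ.lintegral_conv_mul_le m hf (e := fun _ => 1) (A := 1) (B := volume (cube d R))
      measurable_const (fun _ => le_rfl) (by simp) hq
    simpa using this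
  · refine Measurable.aemeasurable ?_
    exact (hm.comp measurable_snd).mul
      ((measurable_ofReal_majorant m).comp (measurable_fst.sub measurable_snd))

/-- The factor integrated against `|Ψ_m * f|` is the lattice sum of the majorant. Its supremum is
governed by `N`, that is by `n/2^{|m|}`, its integral over the cube by `N'`, that is by `n`;
Hölder's inequality interpolates between the two. -/
theorem DualKernels.sum_enorm_piece_le (D : DualKernels Ψ) {ξ : Fin d → ℝ}
    (hξ : IsFrolovRoots ξ) (hd : 1 ≤ d) {R : ℝ} (hR : 0 ≤ R) {n : ℕ} (hn : 1 ≤ n)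
    {f : 𝓢'(EuclideanSpace ℝ (Fin d), ℂ)} (m : Fin d → ℕ)
    (hf : ∀ x, x ∉ cube d R → Ψ.conv m f x = 0) {q : ℝ} (hq : 1 ≤ q)
    {N : ℕ} (hN : 1 ≤ N) (hNn : (n : ℝ) ≤ N * separation ξ * 2 ^ ∑ i, m i)
    {N' : ℕ} (hN' : (R + 1) ^ d * n ≤ N' * separation ξ) (F : Finset (Fin d → ℤ)) :
    ∑ k ∈ F, ‖D.piece f m (latticePoint ξ n k)‖ₑ ≤ ENNReal.ofReal (D.C ^ d) *
      (Ψ.levelNorm q f m *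
        ENNReal.ofReal (2 ^ (∑ i, m i) * (floorSum ^ d * (N : ℝ) ^ 2)) ^ (1 / q) *
        ((3 ^ d * N' : ℕ) * ENNReal.ofReal (Real.pi ^ d)) ^ (1 - 1 / q)) := by
  have hm : Measurable fun y => ‖Ψ.conv m f y‖ₑ := (Ψ.continuous_conv m f).measurable.enorm
  have he : ∀ k, Measurable fun y => ENNReal.ofReal (majorant m (latticePoint ξ n k - y)) :=
    fun k => (measurable_ofReal_majorant m).comp (by fun_prop)
  refine (Finset.sum_le_sum fun k _ => D.enorm_piece_le f m _).trans ?_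
  rw [← Finset.mul_sum]
  refine mul_le_mul_right ?_ _
  have he' : ∀ k ∈ F, Measurable fun y =>
      ‖Ψ.conv m f y‖ₑ * ENNReal.ofReal (majorant m (latticePoint ξ n k - y)) :=
    fun k _ => hm.mul (he k)
  rw [← lintegral_finsetSum _ he']
  simp_rw [← Finset.mul_sum]
  refine Ψ.lintegral_conv_mul_le m hf (Finset.measurable_sum _ fun k _ => he k) (fun y => ?_)
    (hξ.lintegral_sum_majorant_le hd hR hn hN' m F) hq
  rw [← ENNReal.ofReal_sum_of_nonneg fun k _ => majorant_nonneg m _]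
  exact ENNReal.ofReal_le_ofReal (hξ.sum_majorant_le hd hn m hN hNn y F)

end Level

/-! ### The cubature error on a single component. -/

section Representative

open Filter Topology

variable {L d : ℕ} {Ψ : Kernels L} {f : 𝓢'(EuclideanSpace ℝ (Fin d), ℂ)}

theorem DualKernels.piece_eq_convolution (D : DualKernels Ψ)
    (f : 𝓢'(EuclideanSpace ℝ (Fin d), ℂ)) (m : Fin d → ℕ) :
    D.piece f m = MeasureTheory.convolution (Ψ.conv m f) (D.kernel m)
      (ContinuousLinearMap.mul ℂ ℂ) volume := by
  funext x
  rw [convolution_def, piece]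
  simp_rw [ContinuousLinearMap.mul_apply', mul_comm (Ψ.conv m f _)]

theorem DualKernels.continuous_piece (D : DualKernels Ψ)
    (hf : Distribution.dsupport f ⊆ unitCube d) (m : Fin d → ℕ) : Continuous (D.piece f m) := by
  rw [D.piece_eq_convolution]
  exact (Ψ.hasCompactSupport_conv hf m).continuous_convolution_left _ (Ψ.continuous_conv m f)
    (D.kernel m).continuous.locallyIntegrable

theorem DualKernels.integral_piece (D : DualKernels Ψ)
    (hf : Distribution.dsupport f ⊆ unitCube d) (m : Fin d → ℕ) :
    ∫ x, D.piece f m x = (∫ y, Ψ.conv m f y) * ∫ x, D.kernel m x := by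
  rw [D.piece_eq_convolution, integral_convolution _ (Ψ.integrable_conv hf m)
    (D.kernel m).integrable]
  rfl

/-- The error of the cubature rule on the component `Λ_m * Ψ_m * f`. -/
def DualKernels.pieceError (D : DualKernels Ψ) (ξ : Fin d → ℝ) (n : ℕ)
    (f : 𝓢'(EuclideanSpace ℝ (Fin d), ℂ)) (m : Fin d → ℕ) : ℂ :=
  (∫ x, D.piece f m x) - (n : ℂ)⁻¹ * ∑' k, D.piece f m (latticePoint ξ n k)

theorem majorant_le_zero (m : Fin d → ℕ) (x : EuclideanSpace ℝ (Fin d)) :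
    majorant m x ≤ 2 ^ (∑ i, m i) * majorant 0 x := by
  rw [majorant, majorant, ← Finset.prod_pow_eq_pow_sum, ← Finset.prod_mul_distrib]
  refine Finset.prod_le_prod (fun i _ => by positivity) fun i _ => ?_
  have h : (1 : ℝ) ≤ 2 ^ m i := one_le_pow₀ (by norm_num)
  have h2 : x i ^ 2 ≤ (2 ^ m i * x i) ^ 2 := by
    rw [mul_pow]
    exact le_mul_of_one_le_left (sq_nonneg _) (one_le_pow₀ h)
  simp only [Pi.zero_apply, pow_zero, one_mul]
  gcongr

variable {ξ : Fin d → ℝ}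

theorem IsFrolovRoots.exists_nat_mul_separation (hξ : IsFrolovRoots ξ) {x : ℝ} (hx : 0 ≤ x) :
    ∃ N : ℕ, 1 ≤ N ∧ x ≤ N * separation ξ ∧ (N : ℝ) ≤ x / separation ξ + 1 := by
  have h0 := hξ.separation_pos
  refine ⟨⌊x / separation ξ⌋₊ + 1, by omega, ?_, ?_⟩
  · rw [← div_le_iff₀ h0]
    push_cast
    exact (Nat.lt_floor_add_one _).le
  · push_cast
    gcongr
    exact Nat.floor_le (by positivity)

/-- The rule is exact on the components of low frequency. -/
theorem DualKernels.pieceError_eq_zero (D : DualKernels Ψ) (hξ : IsFrolovRoots ξ) (hd : 1 ≤ d)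
    {n : ℕ} (hn : 1 ≤ n) (hf : Distribution.dsupport f ⊆ unitCube d) {m : Fin d → ℕ}
    (hm : D.ε ^ d * 2 ^ (∑ i, m i) ≤
      |(Matrix.vandermonde ξ).det| / ((Matrix.vandermonde ξ).det ^ 2) ^ d * n) :
    D.pieceError ξ n f m = 0 := by
  have hn' : (n : ℂ) ≠ 0 := by
    have : n ≠ 0 := by omega
    exact_mod_cast this
  have hC := D.C_nonneg
  -- Poisson summation, valid for every shift `y`: the lattice mean of the kernel is exactly its
  -- integral, so integrating against `Ψ_m * f` gives exactness on the component.
  have hpois : ∀ y, ∑' k, D.kernel m (latticePoint ξ n k - y) = n * ∫ x, D.kernel m x := by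
    intro y
    rw [← hξ.tsum_latticePoint_eq hd hn (Λ := D.kernel m) (D.kernel m).continuous
      (C := D.C ^ d * 2 ^ (∑ i, m i)) (fun x => ?_) (fun k hk w hw => ?_) y, ← mul_assoc,
      mul_inv_cancel₀ hn', one_mul]
    · rw [mul_assoc]
      exact (D.norm_kernel_le m x).trans
        (mul_le_mul_of_nonneg_left (majorant_le_zero m x) (by positivity))
    · have h1 := hξ.le_abs_prod_dual hd hn hk hw
      -- Otherwise the coordinate product of the dual point would be smaller than `ε^d 2^{|m|}`,
      -- against admissibility of the dual lattice and `hm`.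
      have h2 : ∃ i, D.ε * 2 ^ m i ≤ |w i| := by
        by_contra! h
        have h3 : |∏ i, w i| < ∏ i, (D.ε * 2 ^ m i) := by
          rw [Finset.abs_prod]
          by_cases h0 : ∃ i, w i = 0
          · obtain ⟨i, hi⟩ := h0
            rw [Finset.prod_eq_zero (Finset.mem_univ i) (by rw [hi, abs_zero])]
            exact Finset.prod_pos fun i _ => mul_pos D.ε_pos (by positivity)
          · push Not at h0
            have : Nonempty (Fin d) := ⟨⟨0, hd⟩⟩
            exact Finset.prod_lt_prod_of_nonempty (fun i _ => abs_pos.2 (h0 i)) (fun i _ => h i)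
              Finset.univ_nonempty
        rw [Finset.prod_mul_distrib, Finset.prod_pow_eq_pow_sum, Finset.prod_const,
          Finset.card_univ, Fintype.card_fin] at h3
        linarith
      obtain ⟨i, hi⟩ := h2
      exact D.fourier_kernel_eq_zero m hi
  obtain ⟨N, hN1, hN, -⟩ := hξ.exists_nat_mul_separation (Nat.cast_nonneg n)
  set B : ℝ := 2 ^ (∑ i, m i) * (floorSum ^ d * (N : ℝ) ^ 2)
  have hint : ∀ k, Integrable fun y => D.kernel m (latticePoint ξ n k - y) * Ψ.conv m f y := by
    intro k
    refine Continuous.integrable_of_hasCompactSupport ?_ (Ψ.hasCompactSupport_conv hf m).mul_left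
    have := Ψ.continuous_conv m f
    fun_prop
  have hsum : Summable fun k =>
      ∫ y, ‖D.kernel m (latticePoint ξ n k - y) * Ψ.conv m f y‖ := by
    refine summable_of_sum_le (c := ∫ y, D.C ^ d * B * ‖Ψ.conv m f y‖)
      (fun k => integral_nonneg fun y => norm_nonneg _) fun F => ?_
    rw [← integral_finsetSum _ fun k _ => (hint k).norm]
    refine integral_mono (integrable_finsetSum _ fun k _ => (hint k).norm)
      ((Ψ.integrable_conv hf m).norm.const_mul _) fun y => ?_
    simp only [norm_mul]
    rw [← Finset.sum_mul]
    refine mul_le_mul_of_nonneg_right ?_ (norm_nonneg _)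
    refine (Finset.sum_le_sum fun k _ => D.norm_kernel_le m _).trans ?_
    rw [← Finset.mul_sum]
    refine mul_le_mul_of_nonneg_left ?_ (by positivity)
    refine hξ.sum_majorant_le hd hn m hN1 (hN.trans ?_) y F
    exact le_mul_of_one_le_right (by have := hξ.separation_pos; positivity)
      (one_le_pow₀ (by norm_num))
  have hswap := (hasSum_integral_of_summable_integral_norm hint hsum).tsum_eq
  rw [pieceError, D.integral_piece hf]
  simp only [piece]
  rw [hswap]
  simp_rw [tsum_mul_right, hpois]
  rw [integral_const_mul, mul_assoc, ← mul_assoc, inv_mul_cancel₀ hn', one_mul]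
  ring

/-- This keeps constants independent of the integrability exponent `q`. -/
theorem rpow_le_one_add {x : ℝ≥0∞} {t : ℝ} (h0 : 0 ≤ t) (h1 : t ≤ 1) : x ^ t ≤ 1 + x := by
  rcases le_total x 1 with h | h
  · exact (ENNReal.rpow_le_one h h0).trans le_self_add
  · refine (ENNReal.rpow_le_rpow_of_exponent_le h h1).trans ?_
    rw [ENNReal.rpow_one]
    exact le_add_self

/-- Hölder bound for the error on the components of high frequency. -/
theorem DualKernels.enorm_pieceError_le (D : DualKernels Ψ) (hξ : IsFrolovRoots ξ) (hd : 1 ≤ d)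
    {c₀ : ℝ} (hc₀ : 0 < c₀) : ∃ K : ℝ≥0∞, K ≠ ⊤ ∧
      ∀ f : 𝓢'(EuclideanSpace ℝ (Fin d), ℂ), Distribution.dsupport f ⊆ unitCube d →
        ∀ n : ℕ, 1 ≤ n → ∀ m : Fin d → ℕ, c₀ * n ≤ 2 ^ ∑ i, m i → ∀ q : ℝ, 1 ≤ q →
          ‖D.pieceError ξ n f m‖ₑ ≤
            K * (Ψ.levelNorm q f m * ENNReal.ofReal (2 ^ (∑ i, m i) / n) ^ (1 / q)) := by
  obtain ⟨R, hR, hcube⟩ := Ψ.exists_cube d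
  have hs := hξ.separation_pos
  obtain ⟨N, hN1, hN, -⟩ := hξ.exists_nat_mul_separation (x := c₀⁻¹) (by positivity)
  set c := ENNReal.ofReal (D.C ^ d)
  set v := volume (cube d R)
  have hv : v ≠ ⊤ := (isCompact_cube R).measure_lt_top.ne
  set w := ENNReal.ofReal (Real.pi ^ d)
  set A := ENNReal.ofReal (floorSum ^ d * (N : ℝ) ^ 2)
  set B' : ℝ := 3 ^ d * ((R + 1) ^ d / separation ξ + 1)
  have hB' : 0 ≤ B' := by positivity
  set B := ENNReal.ofReal B' * w
  refine ⟨c * (1 + v) * w * (1 + ENNReal.ofReal c₀⁻¹) + c * (1 + A) * (1 + B), ?_, ?_⟩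
  · have : w ≠ ⊤ := ENNReal.ofReal_ne_top
    have : c ≠ ⊤ := ENNReal.ofReal_ne_top
    have : A ≠ ⊤ := ENNReal.ofReal_ne_top
    have : B ≠ ⊤ := ENNReal.mul_ne_top ENNReal.ofReal_ne_top ENNReal.ofReal_ne_top
    finiteness
  intro f hf n hn m hm q hq
  have hn' : (0 : ℝ) < n := by exact_mod_cast hn
  have hq0 : 0 ≤ 1 / q := by positivity
  have hq1 : 1 / q ≤ 1 := by rw [div_le_one (by linarith)]; exact hq
  set X := ENNReal.ofReal (2 ^ (∑ i, m i) / n) with hX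
  set ℓ := Ψ.levelNorm q f m
  have h1 : ‖∫ x, D.piece f m x‖ₑ ≤
      c * (1 + v) * w * (1 + ENNReal.ofReal c₀⁻¹) * (ℓ * X ^ (1 / q)) := by
    refine (enorm_integral_le_lintegral_enorm _).trans ?_
    refine (D.lintegral_piece_le m (hcube f hf m) hq).trans ?_
    have h2 : v ^ (1 - 1 / q) ≤ 1 + v := rpow_le_one_add (by linarith) (by linarith)
    -- The integral of the component carries no factor `X^{1/q}`. For high frequencies `X` is at
    -- least `c₀`, so the factor can be inserted at the cost of a constant.
    have h3 : 1 ≤ (1 + ENNReal.ofReal c₀⁻¹) * X ^ (1 / q) := by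
      have h4 : 1 ≤ ENNReal.ofReal c₀⁻¹ * X := by
        rw [hX, ← ENNReal.ofReal_mul (by positivity), ENNReal.one_le_ofReal, mul_div_assoc',
          le_div_iff₀ hn', one_mul, ← div_eq_inv_mul, le_div_iff₀ hc₀]
        linarith
      calc (1 : ℝ≥0∞) = 1 ^ (1 / q) := (ENNReal.one_rpow _).symm
        _ ≤ (ENNReal.ofReal c₀⁻¹ * X) ^ (1 / q) := ENNReal.rpow_le_rpow h4 hq0
        _ ≤ _ := by
            rw [ENNReal.mul_rpow_of_nonneg _ _ hq0]
            exact mul_le_mul_left (rpow_le_one_add hq0 hq1) _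
    calc c * (ℓ * v ^ (1 - 1 / q) * w) ≤ c * (ℓ * (1 + v) * w) *
          ((1 + ENNReal.ofReal c₀⁻¹) * X ^ (1 / q)) := by
          refine le_trans ?_ (le_mul_of_one_le_right' h3)
          gcongr
      _ = _ := by ring
  have h5 : ‖(n : ℂ)⁻¹ * ∑' k, D.piece f m (latticePoint ξ n k)‖ₑ ≤
      c * (1 + A) * (1 + B) * (ℓ * X ^ (1 / q)) := by
    obtain ⟨N', hN'1, hN', hN'2⟩ := hξ.exists_nat_mul_separation (x := (R + 1) ^ d * n)
      (by positivity)
    have hNn : (n : ℝ) ≤ N * separation ξ * 2 ^ ∑ i, m i := by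
      have : (n : ℝ) ≤ c₀⁻¹ * 2 ^ ∑ i, m i := by
        rw [← div_eq_inv_mul, le_div_iff₀ hc₀]
        linarith
      exact this.trans (mul_le_mul_of_nonneg_right hN (by positivity))
    have hsum : ‖∑' k, D.piece f m (latticePoint ξ n k)‖ₑ ≤ c * (ℓ *
        ENNReal.ofReal (2 ^ (∑ i, m i) * (floorSum ^ d * (N : ℝ) ^ 2)) ^ (1 / q) *
        ((3 ^ d * N' : ℕ) * w) ^ (1 - 1 / q)) := by
      refine enorm_tsum_le_tsum_enorm.trans ?_
      rw [ENNReal.tsum_eq_iSup_sum]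
      exact iSup_le fun F => D.sum_enorm_piece_le hξ hd hR hn m (hcube f hf m) hq hN1 hNn hN' F
    have hNB : ((3 ^ d * N' : ℕ) : ℝ≥0∞) ≤ ENNReal.ofReal B' * ENNReal.ofReal n := by
      rw [← ENNReal.ofReal_mul hB', ← ENNReal.ofReal_natCast]
      refine ENNReal.ofReal_le_ofReal ?_
      push_cast
      rw [mul_assoc]
      refine mul_le_mul_of_nonneg_left (hN'2.trans ?_) (by positivity)
      rw [add_mul, one_mul, mul_div_right_comm]
      gcongr
      exact_mod_cast hn
    have hX2 : ENNReal.ofReal (2 ^ (∑ i, m i) * (floorSum ^ d * (N : ℝ) ^ 2)) =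
        A * (ENNReal.ofReal n * X) := by
      have := floorSum_nonneg
      rw [hX, ← ENNReal.ofReal_mul (by positivity), ← ENNReal.ofReal_mul (by positivity)]
      congr 1
      field_simp
    -- The supremum bound contributes `n^{1/q}` and the mean bound `n^{1-1/q}`; together they cancel
    -- the weight `1/n` of the rule.
    have hnn : ENNReal.ofReal n ^ (1 / q) * ENNReal.ofReal n ^ (1 - 1 / q) = ENNReal.ofReal n := by
      rw [← ENNReal.rpow_add_of_nonneg _ _ hq0 (by linarith)]
      simp
    have hinv : ‖(n : ℂ)⁻¹‖ₑ * ENNReal.ofReal n = 1 := by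
      rw [← ofReal_norm, norm_inv, Complex.norm_natCast, ← ENNReal.ofReal_mul (by positivity),
        inv_mul_cancel₀ hn'.ne', ENNReal.ofReal_one]
    rw [enorm_mul]
    calc _ ≤ ‖(n : ℂ)⁻¹‖ₑ * (c * (ℓ * (A * (ENNReal.ofReal n * X)) ^ (1 / q) *
          (B * ENNReal.ofReal n) ^ (1 - 1 / q))) := by
          refine mul_le_mul_right (hsum.trans ?_) _
          rw [hX2]
          refine mul_le_mul_right (mul_le_mul_right (ENNReal.rpow_le_rpow ?_ (by linarith)) _) _
          refine (mul_le_mul_left hNB w).trans (le_of_eq ?_)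
          simp only [B]
          ring
      _ = (‖(n : ℂ)⁻¹‖ₑ * (ENNReal.ofReal n ^ (1 / q) * ENNReal.ofReal n ^ (1 - 1 / q))) *
          (c * A ^ (1 / q) * B ^ (1 - 1 / q) * (ℓ * X ^ (1 / q))) := by
          rw [ENNReal.mul_rpow_of_nonneg _ _ hq0, ENNReal.mul_rpow_of_nonneg _ _ hq0,
            ENNReal.mul_rpow_of_nonneg _ _ (by linarith : 0 ≤ 1 - 1 / q)]
          ring
      _ = c * A ^ (1 / q) * B ^ (1 - 1 / q) * (ℓ * X ^ (1 / q)) := by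
          rw [hnn, hinv, one_mul]
      _ ≤ _ := by
          gcongr
          · exact rpow_le_one_add hq0 hq1
          · exact rpow_le_one_add (by linarith) (by linarith)
  rw [pieceError, add_mul]
  exact (enorm_sub_le).trans (add_le_add h1 h5)

end Representative

/-! ### The continuous representative and the error as a sum over components. -/

section Rule

open Filter Topology

variable {L d : ℕ} {Ψ : Kernels L} {f : 𝓢'(EuclideanSpace ℝ (Fin d), ℂ)}

theorem tendsto_indexBox (d : ℕ) : Tendsto (indexBox d) atTop atTop := by
  refine tendsto_atTop_finset_of_monotone (fun M M' h m hm => ?_) fun m => ⟨∑ i, m i, ?_⟩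
  · rw [indexBox, Fintype.mem_piFinset] at hm ⊢
    intro i
    have := Finset.mem_range.1 (hm i)
    exact Finset.mem_range.2 (by omega)
  · rw [indexBox, Fintype.mem_piFinset]
    intro i
    have := Finset.single_le_sum (f := m) (fun _ _ => Nat.zero_le _) (Finset.mem_univ i)
    exact Finset.mem_range.2 (by omega)

/-- The sum of the components. -/
def DualKernels.total (D : DualKernels Ψ) (f : 𝓢'(EuclideanSpace ℝ (Fin d), ℂ))
    (x : EuclideanSpace ℝ (Fin d)) : ℂ := ∑' m, D.piece f m x

/-- The condition under which the components are summable. -/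
def Kernels.SummableLevels (Ψ : Kernels L) (p : ℝ) (f : 𝓢'(EuclideanSpace ℝ (Fin d), ℂ)) : Prop :=
  ∑' m : Fin d → ℕ, Ψ.levelNorm p f m * ENNReal.ofReal (2 ^ ∑ i, m i) ^ (1 / p) ≠ ⊤

theorem one_le_ofReal_two_pow_rpow (j : ℕ) {t : ℝ} (ht : 0 ≤ t) :
    1 ≤ ENNReal.ofReal (2 ^ j) ^ t := by
  rw [← ENNReal.one_rpow t]
  refine ENNReal.rpow_le_rpow ?_ ht
  rw [ENNReal.one_le_ofReal]
  exact one_le_pow₀ (by norm_num)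

/-- One quantity, the term of `SummableLevels`, dominates both norms: the supremum norm yields a
continuous sum, the `L_1` norm the interchange with the integral. -/
theorem DualKernels.exists_enorm_piece_le (D : DualKernels Ψ) (d : ℕ) {p : ℝ} (hp : 1 ≤ p) :
    ∃ K : ℝ≥0∞, K ≠ ⊤ ∧ ∀ f : 𝓢'(EuclideanSpace ℝ (Fin d), ℂ),
      Distribution.dsupport f ⊆ unitCube d → ∀ m : Fin d → ℕ,
      (∀ x, ‖D.piece f m x‖ₑ ≤
        K * (Ψ.levelNorm p f m * ENNReal.ofReal (2 ^ ∑ i, m i) ^ (1 / p))) ∧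
      ∫⁻ x, ‖D.piece f m x‖ₑ ≤
        K * (Ψ.levelNorm p f m * ENNReal.ofReal (2 ^ ∑ i, m i) ^ (1 / p)) := by
  obtain ⟨R, hR, hcube⟩ := Ψ.exists_cube d
  have hp0 : 0 ≤ 1 / p := by positivity
  have hp1 : 0 ≤ 1 - 1 / p := by
    have : 1 / p ≤ 1 := by rw [div_le_one (by linarith)]; exact hp
    linarith
  set c := ENNReal.ofReal (D.C ^ d)
  set v := volume (cube d R) ^ (1 - 1 / p)
  have hv : v ≠ ⊤ := ENNReal.rpow_ne_top_of_nonneg hp1 (isCompact_cube R).measure_lt_top.ne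
  set w := ENNReal.ofReal (Real.pi ^ d)
  have hw : w ^ (1 - 1 / p) ≠ ⊤ := ENNReal.rpow_ne_top_of_nonneg hp1 ENNReal.ofReal_ne_top
  have hw' : w ≠ ⊤ := ENNReal.ofReal_ne_top
  have hc : c ≠ ⊤ := ENNReal.ofReal_ne_top
  refine ⟨c * w ^ (1 - 1 / p) + c * v * w, by finiteness, fun f hf m => ⟨fun x => ?_, ?_⟩⟩
  · refine (D.enorm_piece_le_levelNorm m (hcube f hf m) hp x).trans ?_
    rw [add_mul]
    refine le_trans (le_of_eq ?_) le_self_add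
    ring
  · refine (D.lintegral_piece_le m (hcube f hf m) hp).trans ?_
    rw [add_mul]
    refine le_trans ?_ le_add_self
    calc _ = c * v * w * (Ψ.levelNorm p f m * 1) := by ring
      _ ≤ _ := by
        gcongr
        exact one_le_ofReal_two_pow_rpow _ hp0

theorem DualKernels.summable_norm_piece (D : DualKernels Ψ) {p : ℝ} (hp : 1 ≤ p)
    (hf : Distribution.dsupport f ⊆ unitCube d) (hs : Ψ.SummableLevels p f) :
    ∃ u : (Fin d → ℕ) → ℝ, Summable u ∧ (∀ m x, ‖D.piece f m x‖ ≤ u m) ∧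
      (∀ m, Integrable (D.piece f m)) ∧ Summable fun m => ∫ x, ‖D.piece f m x‖ := by
  obtain ⟨K, hK, h⟩ := D.exists_enorm_piece_le d hp
  set a : (Fin d → ℕ) → ℝ≥0∞ :=
    fun m => Ψ.levelNorm p f m * ENNReal.ofReal (2 ^ ∑ i, m i) ^ (1 / p)
  have ha : ∑' m, K * a m ≠ ⊤ := by
    rw [ENNReal.tsum_mul_left]
    exact ENNReal.mul_ne_top hK hs
  have hfin : ∀ m, K * a m ≠ ⊤ := fun m => ENNReal.ne_top_of_tsum_ne_top ha m
  refine ⟨fun m => (K * a m).toReal, ENNReal.summable_toReal ha, fun m x => ?_, fun m => ?_, ?_⟩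
  · rw [← toReal_enorm]
    exact ENNReal.toReal_mono (hfin m) ((h f hf m).1 x)
  · exact ⟨(D.continuous_piece hf m).aestronglyMeasurable,
      lt_of_le_of_lt (h f hf m).2 (hfin m).lt_top⟩
  · refine Summable.of_nonneg_of_le (fun m => integral_nonneg fun x => norm_nonneg _) (fun m => ?_)
      (ENNReal.summable_toReal ha)
    rw [integral_norm_eq_lintegral_enorm (D.continuous_piece hf m).aestronglyMeasurable]
    exact ENNReal.toReal_mono (hfin m) (h f hf m).2

theorem DualKernels.continuous_total (D : DualKernels Ψ) {p : ℝ} (hp : 1 ≤ p)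
    (hf : Distribution.dsupport f ⊆ unitCube d) (hs : Ψ.SummableLevels p f) :
    Continuous (D.total f) := by
  obtain ⟨u, hu, hb, -, -⟩ := D.summable_norm_piece hp hf hs
  exact continuous_tsum (fun m => D.continuous_piece hf m) hu hb

theorem DualKernels.apply_eq_integral_total (D : DualKernels Ψ) {p : ℝ} (hp : 1 ≤ p)
    (hf : Distribution.dsupport f ⊆ unitCube d) (hs : Ψ.SummableLevels p f)
    (φ : 𝓢(EuclideanSpace ℝ (Fin d), ℂ)) : f φ = ∫ x, φ x * D.total f x := by
  obtain ⟨u, hu, hb, hi, -⟩ := D.summable_norm_piece hp hf hs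
  have hint : ∀ m, Integrable fun x => φ x * D.piece f m x := fun m =>
    φ.integrable.mul_bdd (c := u m) (D.continuous_piece hf m).aestronglyMeasurable
      (Eventually.of_forall fun x => hb m x)
  have hsum : Summable fun m => ∫ x, ‖φ x * D.piece f m x‖ := by
    refine Summable.of_nonneg_of_le (fun m => integral_nonneg fun x => norm_nonneg _) (fun m => ?_)
      (hu.mul_left (∫ x, ‖φ x‖))
    rw [← integral_mul_const]
    refine integral_mono (hint m).norm (φ.integrable.norm.mul_const _) fun x => ?_
    simp only [norm_mul]
    exact mul_le_mul_of_nonneg_left (hb m x) (norm_nonneg _)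
  have h1 := hasSum_integral_of_summable_integral_norm hint hsum
  simp_rw [tsum_mul_left] at h1
  exact tendsto_nhds_unique (D.tendsto_sum_piece hf φ) (h1.comp (tendsto_indexBox d))

/-- Off the closed cube the function vanishes since it represents a distribution supported in the
cube; continuity extends this to the closure. -/
theorem DualKernels.total_eq_zero (D : DualKernels Ψ) {p : ℝ} (hp : 1 ≤ p)
    (hf : Distribution.dsupport f ⊆ unitCube d) (hs : Ψ.SummableLevels p f)
    {x : EuclideanSpace ℝ (Fin d)} (hx : x ∈ closure (unitCube d)ᶜ) : D.total f x = 0 := by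
  have hc := D.continuous_total hp hf hs
  have h : Set.EqOn (D.total f) (fun _ => 0) (unitCube d)ᶜ := by
    refine eqOn_of_forall_integral_eq hc continuous_const isClosed_unitCube.isOpen_compl
      fun φ hφ hsupp => ?_
    rw [← D.apply_eq_integral_total hp hf hs, apply_eq_zero_of_disjoint_dsupport f φ hφ]
    · simp
    · exact (Set.disjoint_compl_left_iff_subset.2 hf).mono_left hsupp
  exact closure_minimal (fun y hy => h hy) (isClosed_eq hc continuous_const) hx

/-- A point of the closed cube with a coordinate equal to `1` is a limit of points outside. Hence
lattice points outside the half-open cube contribute nothing, even if they lie in the closed one. -/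
theorem mem_closure_compl_unitCube {x : EuclideanSpace ℝ (Fin d)}
    (hx : ¬ ∀ i, 0 ≤ x i ∧ x i < 1) : x ∈ closure (unitCube d)ᶜ := by
  by_cases h : x ∈ unitCube d
  · push Not at hx
    obtain ⟨i, hi⟩ := hx
    have h1 : 1 ≤ x i := hi (h i).1
    have ht : Tendsto (fun k : ℕ => x + (1 / ((k : ℝ) + 1)) • EuclideanSpace.single i (1 : ℝ)) atTop
        (𝓝 (x + (0 : ℝ) • EuclideanSpace.single i (1 : ℝ))) :=
      tendsto_const_nhds.add (tendsto_one_div_add_atTop_nhds_zero_nat.smul_const _)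
    rw [zero_smul, add_zero] at ht
    refine mem_closure_of_tendsto ht (Eventually.of_forall fun k hk => ?_)
    have h2 := (hk i).2
    have h3 : 0 < 1 / ((k : ℝ) + 1) := by positivity
    simp only [PiLp.add_apply, PiLp.smul_apply, PiLp.single_apply, if_true, smul_eq_mul,
      mul_one] at h2
    linarith
  · exact subset_closure h

theorem DualKernels.isRepresentedBy_total (D : DualKernels Ψ) {p : ℝ} (hp : 1 ≤ p)
    (hf : Distribution.dsupport f ⊆ unitCube d) (hs : Ψ.SummableLevels p f) :
    IsRepresentedBy f (D.total f) :=
  ⟨D.continuous_total hp hf hs, fun _ hx => D.total_eq_zero hp hf hs (subset_closure hx),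
    D.apply_eq_integral_total hp hf hs⟩

variable {ξ : Fin d → ℝ}

theorem IsFrolovRoots.latticePoint_injective (hξ : IsFrolovRoots ξ) (hd : 1 ≤ d) {n : ℕ}
    (hn : 1 ≤ n) : Function.Injective (latticePoint ξ n) := by
  intro k k' h
  by_contra hne
  have h1 := hξ.separated hd n k k' hne
  have hn' : (0 : ℝ) < n := by exact_mod_cast hn
  rw [Finset.prod_eq_zero (Finset.mem_univ ⟨0, hd⟩) (by rw [h, sub_self]), abs_zero] at h1
  have := div_pos hξ.separation_pos hn'
  linarith

theorem nodes_eq_image (ξ : Fin d → ℝ) (n : ℕ) : nodes ξ n =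
    latticePoint ξ n '' {k | ∀ i, 0 ≤ latticePoint ξ n k i ∧ latticePoint ξ n k i < 1} := by
  ext x
  constructor
  · rintro ⟨⟨k, hk⟩, hx⟩
    have : latticePoint ξ n k = x := by
      ext i
      rw [hk, latticePoint_apply]
    exact ⟨k, by rw [Set.mem_ofPred_eq, this]; exact hx, this⟩
  · rintro ⟨k, hk, rfl⟩
    exact ⟨⟨k, fun i => rfl⟩, hk⟩

theorem IsFrolovRoots.rule_eq_tsum (hξ : IsFrolovRoots ξ) (hd : 1 ≤ d) {n : ℕ} (hn : 1 ≤ n)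
    {g : EuclideanSpace ℝ (Fin d) → ℂ} (hg : ∀ x, (¬ ∀ i, 0 ≤ x i ∧ x i < 1) → g x = 0) :
    rule ξ n g = (n : ℂ)⁻¹ * ∑' k, g (latticePoint ξ n k) := by
  set S : Set (Fin d → ℤ) := {k | ∀ i, 0 ≤ latticePoint ξ n k i ∧ latticePoint ξ n k i < 1} with hS
  have hinj := hξ.latticePoint_injective hd hn
  have hSf : S.Finite := by
    have := finite_nodes hξ hn
    rw [nodes_eq_image] at this
    exact this.of_finite_image hinj.injOn
  have hsupp : Function.support (fun k => g (latticePoint ξ n k)) ⊆ S := by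
    intro k hk
    by_contra h
    exact hk (hg _ h)
  rw [rule, one_div, nodes_eq_image, finsum_mem_image hinj.injOn, finsum_mem_def,
    Set.indicator_eq_self.2 hsupp, tsum_eq_finsum (hSf.subset hsupp)]

/-- The rule is a sum over all lattice points, since the representative vanishes at those that are
not nodes. The sums over lattice points and over components may then be interchanged. -/
theorem DualKernels.ruleError_le_tsum (D : DualKernels Ψ) (hξ : IsFrolovRoots ξ) (hd : 1 ≤ d)
    {n : ℕ} (hn : 1 ≤ n) {p : ℝ} (hp : 1 ≤ p)
    (hf : Distribution.dsupport f ⊆ unitCube d) (hs : Ψ.SummableLevels p f) :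
    ruleError ξ n f ≤ ∑' m, ‖D.pieceError ξ n f m‖ₑ := by
  obtain ⟨u, hu, hb, hi, hsi⟩ := D.summable_norm_piece hp hf hs
  obtain ⟨R, hR, hcube⟩ := Ψ.exists_cube d
  have hp0 : 0 ≤ 1 / p := by positivity
  have hp1 : 0 ≤ 1 - 1 / p := by
    have : 1 / p ≤ 1 := by rw [div_le_one (by linarith)]; exact hp
    linarith
  have hrep := D.isRepresentedBy_total hp hf hs
  refine (iInf₂_le (D.total f) hrep).trans ?_
  have h1 : HasSum (fun m => ∫ x, D.piece f m x) (∫ x, D.total f x) :=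
    hasSum_integral_of_summable_integral_norm hi hsi
  have h2 : ∫ x in unitCube d, D.total f x = ∫ x, D.total f x := by
    refine setIntegral_eq_integral_of_forall_compl_eq_zero fun x hx => hrep.2.1 x hx
  obtain ⟨N, hN1, hN, -⟩ := hξ.exists_nat_mul_separation (Nat.cast_nonneg n)
  obtain ⟨N', -, hN', -⟩ := hξ.exists_nat_mul_separation (x := (R + 1) ^ d * n) (by positivity)
  -- Absolute summability over pairs of a component and a lattice point. Here `n` is fixed, so `N`
  -- may be chosen for `2^{|m|} ≥ 1` and hence independently of `m`.
  have h3 : ∑' z : (Fin d → ℕ) × (Fin d → ℤ), ‖D.piece f z.1 (latticePoint ξ n z.2)‖ₑ ≠ ⊤ := by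
    rw [ENNReal.tsum_prod (f := fun m k => ‖D.piece f m (latticePoint ξ n k)‖ₑ)]
    set A := ENNReal.ofReal (floorSum ^ d * (N : ℝ) ^ 2) ^ (1 / p)
    have hA : A ≠ ⊤ := ENNReal.rpow_ne_top_of_nonneg hp0 ENNReal.ofReal_ne_top
    set B := (((3 ^ d * N' : ℕ) : ℝ≥0∞) * ENNReal.ofReal (Real.pi ^ d)) ^ (1 - 1 / p)
    have hB : B ≠ ⊤ := ENNReal.rpow_ne_top_of_nonneg hp1
      (ENNReal.mul_ne_top (ENNReal.natCast_ne_top _) ENNReal.ofReal_ne_top)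
    set c := ENNReal.ofReal (D.C ^ d)
    have hc : c ≠ ⊤ := ENNReal.ofReal_ne_top
    have hle : ∀ m, ∑' k, ‖D.piece f m (latticePoint ξ n k)‖ₑ ≤ c * A * B *
        (Ψ.levelNorm p f m * ENNReal.ofReal (2 ^ ∑ i, m i) ^ (1 / p)) := by
      intro m
      rw [ENNReal.tsum_eq_iSup_sum]
      refine iSup_le fun F => ?_
      refine (D.sum_enorm_piece_le hξ hd hR hn m (hcube f hf m) hp hN1 (hN.trans ?_) hN' F).trans
        (le_of_eq ?_)
      · exact le_mul_of_one_le_right (by have := hξ.separation_pos; positivity)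
          (one_le_pow₀ (by norm_num))
      · rw [ENNReal.ofReal_mul (by positivity), ENNReal.mul_rpow_of_nonneg _ _ hp0]
        ring
    refine ne_top_of_le_ne_top ?_ (ENNReal.tsum_le_tsum hle)
    rw [ENNReal.tsum_mul_left]
    exact ENNReal.mul_ne_top (by finiteness) hs
  have h4 : Summable (Function.uncurry fun m k => D.piece f m (latticePoint ξ n k)) :=
    (tsum_enorm_ne_top_iff_summable_norm.1 h3).of_norm
  have h5 : rule ξ n (D.total f) =
      ∑' m, (n : ℂ)⁻¹ * ∑' k, D.piece f m (latticePoint ξ n k) := by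
    rw [hξ.rule_eq_tsum hd hn fun x hx =>
      D.total_eq_zero hp hf hs (mem_closure_compl_unitCube hx), tsum_mul_left]
    congr 1
    exact h4.tsum_comm
  have h6 : Summable fun m => (n : ℂ)⁻¹ * ∑' k, D.piece f m (latticePoint ξ n k) :=
    h4.prod.mul_left _
  rw [h2, h5, ← h1.tsum_eq, ← h1.summable.tsum_sub h6]
  exact enorm_tsum_le_tsum_enorm

end Rule

/-! ### Sequence norms. -/

section SeqNorm

variable {ι : Type*} {θ : ℝ≥0∞}

theorem seqNorm_top (a : ι → ℝ≥0∞) : seqNorm ⊤ a = ⨆ m, a m := by rw [seqNorm, if_pos rfl]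

theorem seqNorm_of_ne_top (hθ : θ ≠ ⊤) (a : ι → ℝ≥0∞) :
    seqNorm θ a = (∑' m, a m ^ θ.toReal) ^ (1 / θ.toReal) := by rw [seqNorm, if_neg hθ]

theorem one_le_toReal (h1 : 1 ≤ θ) (hθ : θ ≠ ⊤) : 1 ≤ θ.toReal := by
  rw [← ENNReal.toReal_one]
  exact ENNReal.toReal_mono hθ h1

theorem seqNorm_rpow (h1 : 1 ≤ θ) (hθ : θ ≠ ⊤) (a : ι → ℝ≥0∞) :
    seqNorm θ a ^ θ.toReal = ∑' m, a m ^ θ.toReal := by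
  have := one_le_toReal h1 hθ
  rw [seqNorm_of_ne_top hθ, ← ENNReal.rpow_mul, one_div_mul_cancel (by positivity),
    ENNReal.rpow_one]

theorem le_seqNorm (h1 : 1 ≤ θ) (a : ι → ℝ≥0∞) (m : ι) : a m ≤ seqNorm θ a := by
  by_cases hθ : θ = ⊤
  · rw [hθ, seqNorm_top]
    exact le_iSup a m
  · have ht := one_le_toReal h1 hθ
    rw [← ENNReal.rpow_le_rpow_iff (z := θ.toReal) (by positivity), seqNorm_rpow h1 hθ]
    exact ENNReal.le_tsum (f := fun m => a m ^ θ.toReal) m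

/-- Pointwise `a^p ≤ ‖a‖_θ^{p-θ} a^θ`, since each entry is at most the `ℓ_θ` norm. -/
theorem seqNorm_antitone (h1 : 1 ≤ θ) {p : ℝ} (hp : θ ≤ ENNReal.ofReal p) (a : ι → ℝ≥0∞) :
    seqNorm (ENNReal.ofReal p) a ≤ seqNorm θ a := by
  have hθ : θ ≠ ⊤ := ne_top_of_le_ne_top ENNReal.ofReal_ne_top hp
  have ht := one_le_toReal h1 hθ
  have htp : θ.toReal ≤ p := by
    have h := ENNReal.toReal_mono ENNReal.ofReal_ne_top hp
    rcases le_total 0 p with h0 | h0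
    · rwa [ENNReal.toReal_ofReal h0] at h
    · rw [ENNReal.ofReal_of_nonpos h0, ENNReal.toReal_zero] at h
      linarith
  have hp0 : 0 < p := by linarith
  have hsp : (ENNReal.ofReal p).toReal = p := ENNReal.toReal_ofReal hp0.le
  have h2 := seqNorm_rpow (h1.trans hp) ENNReal.ofReal_ne_top a
  rw [hsp] at h2
  rw [← ENNReal.rpow_le_rpow_iff (z := p) hp0, h2]
  calc ∑' m, a m ^ p ≤ ∑' m, seqNorm θ a ^ (p - θ.toReal) * a m ^ θ.toReal := by
        refine ENNReal.tsum_le_tsum fun m => ?_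
        calc a m ^ p = a m ^ (p - θ.toReal) * a m ^ θ.toReal := by
              rw [← ENNReal.rpow_add_of_nonneg _ _ (by linarith) (by linarith), sub_add_cancel]
          _ ≤ _ := mul_le_mul_left
              (ENNReal.rpow_le_rpow (le_seqNorm h1 a m) (by linarith)) _
    _ = seqNorm θ a ^ p := by
        rw [ENNReal.tsum_mul_left, ← seqNorm_rpow h1 hθ,
          ← ENNReal.rpow_add_of_nonneg _ _ (by linarith) (by linarith), sub_add_cancel]

/-- Finite sums of `q`-th powers, `q ≤ θ`, in terms of the `ℓ_θ` norm. -/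
theorem sum_rpow_le_seqNorm (h1 : 1 ≤ θ) {q : ℝ} (hq : 1 ≤ q) (hqθ : q * (θ⁻¹).toReal ≤ 1)
    (a : ι → ℝ≥0∞) (S : Finset ι) :
    ∑ m ∈ S, a m ^ q ≤ (S.card : ℝ≥0∞) ^ (1 - q * (θ⁻¹).toReal) * seqNorm θ a ^ q := by
  by_cases hθ : θ = ⊤
  · rw [hθ, ENNReal.inv_top, ENNReal.toReal_zero, mul_zero, sub_zero, ENNReal.rpow_one,
      ← nsmul_eq_mul]
    exact Finset.sum_le_card_nsmul _ _ _ fun m _ =>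
      ENNReal.rpow_le_rpow (le_seqNorm le_top a m) (by linarith)
  · have ht := one_le_toReal h1 hθ
    set t := θ.toReal
    have hτ : (θ⁻¹).toReal = 1 / t := by rw [ENNReal.toReal_inv, one_div]
    have hqt : q ≤ t := by
      rw [hτ, mul_one_div, div_le_one (by linarith)] at hqθ
      exact hqθ
    have hr : 1 ≤ t / q := by rwa [one_le_div (by linarith)]
    have h2 := ENNReal.rpow_sum_le_const_mul_sum_rpow S (fun m => a m ^ q) hr
    have h3 : ∑ m ∈ S, (a m ^ q) ^ (t / q) ≤ seqNorm θ a ^ t := by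
      rw [seqNorm_rpow h1 hθ]
      refine le_trans (le_of_eq ?_) (ENNReal.sum_le_tsum S)
      refine Finset.sum_congr rfl fun m _ => ?_
      rw [← ENNReal.rpow_mul, mul_div_cancel₀ _ (by positivity)]
    have h4 := h2.trans (mul_le_mul_right h3 _)
    have hr0 : 0 < t / q := by positivity
    rw [← ENNReal.rpow_le_rpow_iff hr0, ENNReal.mul_rpow_of_nonneg _ _ hr0.le, ← ENNReal.rpow_mul,
      ← ENNReal.rpow_mul, hτ]
    refine h4.trans (le_of_eq ?_)
    congr 2 <;> field_simp

theorem measurable_seqNorm [Countable ι] {α : Type*} [MeasurableSpace α] {a : α → ι → ℝ≥0∞}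
    (ha : ∀ m, Measurable fun x => a x m) : Measurable fun x => seqNorm θ (a x) := by
  by_cases hθ : θ = ⊤
  · simp_rw [hθ, seqNorm_top]
    exact Measurable.iSup ha
  · simp_rw [seqNorm_of_ne_top hθ]
    exact (Measurable.tsum fun m => (ha m).pow_const _).pow_const _

end SeqNorm

/-! ### Norms of local means summed over sets of indices. -/

section LevelSums

variable {L d : ℕ} {Ψ : Kernels L} {f : 𝓢'(EuclideanSpace ℝ (Fin d), ℂ)} {θ : ℝ≥0∞} {s p : ℝ}

/-- The terms of the sequence whose `ℓ_θ` norm enters the norm of `𝐅^s_{p,θ}`. -/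
def Kernels.term (Ψ : Kernels L) (s : ℝ) (f : 𝓢'(EuclideanSpace ℝ (Fin d), ℂ))
    (x : EuclideanSpace ℝ (Fin d)) (m : Fin d → ℕ) : ℝ≥0∞ :=
  ENNReal.ofReal ((2 : ℝ) ^ (s * ∑ i, (m i : ℝ))) * ‖Ψ.conv m f x‖ₑ

theorem Kernels.fNorm_eq (Ψ : Kernels L) (s p : ℝ) (θ : ℝ≥0∞)
    (f : 𝓢'(EuclideanSpace ℝ (Fin d), ℂ)) :
    Ψ.fNorm s p θ f = (∫⁻ x, seqNorm θ (Ψ.term s f x) ^ p) ^ (1 / p) := rfl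

theorem Kernels.measurable_term (Ψ : Kernels L) (s : ℝ) (f : 𝓢'(EuclideanSpace ℝ (Fin d), ℂ))
    (m : Fin d → ℕ) : Measurable fun x => Ψ.term s f x m :=
  ((Ψ.continuous_conv m f).measurable.enorm).const_mul _

theorem Kernels.fNorm_antitone (Ψ : Kernels L) (s : ℝ) (hp : 1 ≤ p) (h1 : 1 ≤ θ)
    (hθ : θ ≤ ENNReal.ofReal p) (f : 𝓢'(EuclideanSpace ℝ (Fin d), ℂ)) :
    Ψ.fNorm s p (ENNReal.ofReal p) f ≤ Ψ.fNorm s p θ f :=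
  ENNReal.rpow_le_rpow (lintegral_mono fun _ =>
    ENNReal.rpow_le_rpow (seqNorm_antitone h1 hθ _) (by linarith)) (by positivity)

/-- The weight `2^{s|m|}`. -/
def weight (s : ℝ) (m : Fin d → ℕ) : ℝ≥0∞ := ENNReal.ofReal ((2 : ℝ) ^ (s * ∑ i, (m i : ℝ)))

theorem Kernels.weight_mul_levelNorm (Ψ : Kernels L) (s : ℝ) {q : ℝ} (hq : 1 ≤ q)
    (f : 𝓢'(EuclideanSpace ℝ (Fin d), ℂ)) (m : Fin d → ℕ) :
    weight s m * Ψ.levelNorm q f m = (∫⁻ x, Ψ.term s f x m ^ q) ^ (1 / q) := by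
  have hm : Measurable fun x => ‖Ψ.conv m f x‖ₑ ^ q :=
    ((Ψ.continuous_conv m f).measurable.enorm).pow_const _
  simp_rw [term, ENNReal.mul_rpow_of_nonneg _ _ (by linarith : 0 ≤ q)]
  rw [lintegral_const_mul _ hm, ENNReal.mul_rpow_of_nonneg _ _ (by positivity),
    ← ENNReal.rpow_mul, mul_one_div_cancel (by positivity), ENNReal.rpow_one]
  rfl

theorem Kernels.weight_mul_levelNorm_le (Ψ : Kernels L) (s : ℝ) (hp : 1 ≤ p) (h1 : 1 ≤ θ)
    (f : 𝓢'(EuclideanSpace ℝ (Fin d), ℂ)) (m : Fin d → ℕ) :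
    weight s m * Ψ.levelNorm p f m ≤ Ψ.fNorm s p θ f := by
  rw [Ψ.weight_mul_levelNorm s hp, Ψ.fNorm_eq]
  exact ENNReal.rpow_le_rpow (lintegral_mono fun x =>
    ENNReal.rpow_le_rpow (le_seqNorm h1 _ m) (by linarith)) (by positivity)

/-- Sums of the norms of the components over a finite set of levels. -/
theorem Kernels.exists_sum_weight_mul_levelNorm_le (Ψ : Kernels L) (d : ℕ) {p : ℝ} (hp : 1 ≤ p) :
    ∃ K : ℝ≥0∞, K ≠ ⊤ ∧ ∀ f : 𝓢'(EuclideanSpace ℝ (Fin d), ℂ),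
      Distribution.dsupport f ⊆ unitCube d → ∀ (s q : ℝ) (θ : ℝ≥0∞), 1 ≤ q → q ≤ p → 1 ≤ θ →
      q * (θ⁻¹).toReal ≤ 1 → ∀ S : Finset (Fin d → ℕ),
      ∑ m ∈ S, weight s m * Ψ.levelNorm q f m ≤
        K * (S.card : ℝ≥0∞) ^ (1 - (θ⁻¹).toReal) * Ψ.fNorm s p θ f := by
  obtain ⟨R, hR, hcube⟩ := Ψ.exists_cube d
  set v := volume (cube d R)
  have hv : v ≠ ⊤ := (isCompact_cube R).measure_lt_top.ne
  refine ⟨1 + v, by finiteness, fun f hf s q θ hq hqp h1 hqθ S => ?_⟩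
  have hq0 : 0 < q := by linarith
  have hp0 : 0 < p := by linarith
  set τ := (θ⁻¹).toReal
  have hτ : 0 ≤ τ := ENNReal.toReal_nonneg
  set h : EuclideanSpace ℝ (Fin d) → ℝ≥0∞ := fun x => seqNorm θ (Ψ.term s f x)
  have hh : Measurable h := measurable_seqNorm fun m => Ψ.measurable_term s f m
  have hinv : 1 / q ≤ 1 := by rw [div_le_one hq0]; exact hq
  have hpq : 1 / p ≤ 1 / q := one_div_le_one_div_of_le hq0 hqp
  have hp1 : 0 < 1 / p := by positivity
  have hτq : τ ≤ 1 / q := by rw [le_div_iff₀ hq0]; linarith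
  -- the exponents of the cardinality
  have e1 : ∑ m ∈ S, ∫⁻ x, Ψ.term s f x m ^ q ≤
      (S.card : ℝ≥0∞) ^ (1 - q * τ) * ∫⁻ x in cube d R, h x ^ q := by
    have hm : ∀ m ∈ S, Measurable fun x => Ψ.term s f x m ^ q :=
      fun m _ => (Ψ.measurable_term s f m).pow_const _
    rw [← lintegral_finsetSum _ hm]
    have hsupp : ∫⁻ x, ∑ m ∈ S, Ψ.term s f x m ^ q =
        ∫⁻ x in cube d R, ∑ m ∈ S, Ψ.term s f x m ^ q := by
      refine (setLIntegral_eq_of_support_subset fun x hx => ?_).symm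
      by_contra hxc
      refine hx (Finset.sum_eq_zero fun m _ => ?_)
      rw [term, hcube f hf m x hxc, enorm_zero, mul_zero, ENNReal.zero_rpow_of_pos hq0]
    rw [hsupp, ← lintegral_const_mul _ (hh.pow_const _)]
    exact lintegral_mono fun x => sum_rpow_le_seqNorm h1 hq hqθ _ S
  have e2 : ∫⁻ x in cube d R, h x ^ q ≤ (∫⁻ x, h x ^ p) ^ (q / p) * v ^ (1 - q / p) := by
    have hpq' : 1 ≤ p / q := by rwa [one_le_div hq0]
    have := lintegral_mul_le_of_le (μ := volume.restrict (cube d R)) (f := fun x => h x ^ q)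
      (e := fun _ => 1) (A := 1) (B := v) (hh.pow_const _).aemeasurable aemeasurable_const
      (fun _ => le_rfl) (by simp [v]) hpq'
    simp only [mul_one, ENNReal.one_rpow, ← ENNReal.rpow_mul, one_div_div] at this
    rw [mul_div_cancel₀ _ hq0.ne'] at this
    refine this.trans (mul_le_mul_left (ENNReal.rpow_le_rpow ?_ (by positivity)) _)
    exact setLIntegral_le_lintegral _ _
  have e3 : ∑ m ∈ S, weight s m * Ψ.levelNorm q f m ≤ (S.card : ℝ≥0∞) ^ (1 - 1 / q) *
      (∑ m ∈ S, ∫⁻ x, Ψ.term s f x m ^ q) ^ (1 / q) := by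
    have := ENNReal.rpow_sum_le_const_mul_sum_rpow S
      (fun m => weight s m * Ψ.levelNorm q f m) hq
    rw [← ENNReal.rpow_le_rpow_iff hq0, ENNReal.mul_rpow_of_nonneg _ _ hq0.le, ← ENNReal.rpow_mul,
      ← ENNReal.rpow_mul, one_div_mul_cancel hq0.ne', ENNReal.rpow_one]
    refine this.trans (le_of_eq ?_)
    congr 1
    · congr 1
      field_simp
    · refine Finset.sum_congr rfl fun m _ => ?_
      rw [Ψ.weight_mul_levelNorm s hq, ← ENNReal.rpow_mul, one_div_mul_cancel hq0.ne',
        ENNReal.rpow_one]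
  have e4 : (∑ m ∈ S, ∫⁻ x, Ψ.term s f x m ^ q) ^ (1 / q) ≤
      (S.card : ℝ≥0∞) ^ (1 / q - τ) * (Ψ.fNorm s p θ f * v ^ (1 / q - 1 / p)) := by
    refine (ENNReal.rpow_le_rpow (e1.trans (mul_le_mul_right e2 _)) (by positivity)).trans
      (le_of_eq ?_)
    rw [ENNReal.mul_rpow_of_nonneg _ _ (by positivity),
      ENNReal.mul_rpow_of_nonneg _ _ (by positivity), ← ENNReal.rpow_mul, ← ENNReal.rpow_mul,
      ← ENNReal.rpow_mul, Ψ.fNorm_eq]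
    congr 2
    · field_simp
    · congr 1
      field_simp
    · congr 1
      field_simp
  refine e3.trans ((mul_le_mul_right e4 _).trans ?_)
  -- The power of the cardinality lost in `e3` and that lost in `e4` combine to `1 - 1/θ`,
  -- independently of `q`.
  have hcard : (S.card : ℝ≥0∞) ^ (1 - 1 / q) * (S.card : ℝ≥0∞) ^ (1 / q - τ) =
      (S.card : ℝ≥0∞) ^ (1 - τ) := by
    rw [← ENNReal.rpow_add_of_nonneg _ _ (by linarith) (by linarith)]
    congr 1
    ring
  rw [← mul_assoc, hcard]
  calc _ = v ^ (1 / q - 1 / p) * (S.card : ℝ≥0∞) ^ (1 - τ) * Ψ.fNorm s p θ f := by ring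
    _ ≤ _ := by
      gcongr
      exact rpow_le_one_add (by linarith) (by linarith)

/-- The indices of level `ℓ`. -/
def levelSet (d ℓ : ℕ) : Finset (Fin d → ℕ) := Finset.finAntidiagonal d ℓ

theorem mem_levelSet {ℓ : ℕ} {m : Fin d → ℕ} : m ∈ levelSet d ℓ ↔ ∑ i, m i = ℓ :=
  Finset.mem_finAntidiagonal

/-- The first coordinate is determined by the remaining `d - 1`, each of which is at most `ℓ`. -/
theorem card_levelSet_le (hd : 1 ≤ d) (ℓ : ℕ) : (levelSet d ℓ).card ≤ (ℓ + 1) ^ (d - 1) := by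
  obtain ⟨e, rfl⟩ : ∃ e, d = e + 1 := ⟨d - 1, by omega⟩
  have h : (levelSet (e + 1) ℓ).card ≤
      (Fintype.piFinset fun _ : Fin e => Finset.range (ℓ + 1)).card := by
    refine Finset.card_le_card_of_injOn (fun m => Fin.tail m) (fun m hm => ?_)
      fun m hm m' hm' h => ?_
    · have h1 := mem_levelSet.1 hm
      rw [Finset.mem_coe, Fintype.mem_piFinset]
      intro i
      have := Finset.single_le_sum (f := m) (fun _ _ => Nat.zero_le _) (Finset.mem_univ i.succ)
      rw [Finset.mem_range]
      change m i.succ < ℓ + 1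
      omega
    · have h1 := mem_levelSet.1 hm
      have h2 := mem_levelSet.1 hm'
      rw [Fin.sum_univ_succ] at h1 h2
      have h3 : ∀ i : Fin e, m i.succ = m' i.succ := fun i => congrFun h i
      funext i
      refine Fin.cases ?_ h3 i
      simp_rw [h3] at h1
      omega
  rw [Fintype.card_piFinset] at h
  simpa using h

theorem tsum_eq_tsum_levelSet (g : (Fin d → ℕ) → ℝ≥0∞) :
    ∑' m, g m = ∑' ℓ, ∑ m ∈ levelSet d ℓ, g m := by
  rw [← ENNReal.tsum_fiberwise g fun m => ∑ i, m i]
  refine tsum_congr fun ℓ => ?_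
  rw [← Finset.tsum_subtype]
  have h : (fun m : Fin d → ℕ => ∑ i, m i) ⁻¹' {ℓ} = ↑(levelSet d ℓ) := by
    ext m
    simp [mem_levelSet]
  rw [h]
  rfl

end LevelSums

/-! ### The error as a series over levels. -/

section Upper

variable {L d : ℕ} {Ψ : Kernels L} {f : 𝓢'(EuclideanSpace ℝ (Fin d), ℂ)} {θ : ℝ≥0∞} {s p : ℝ}

theorem sum_ofReal_mul (m : Fin d → ℕ) (s : ℝ) :
    (2 : ℝ) ^ (s * ∑ i, (m i : ℝ)) = (2 : ℝ) ^ (s * ((∑ i, m i : ℕ) : ℝ)) := by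
  push_cast
  rfl

/-- Polynomially weighted geometric series. -/
theorem exists_tsum_geometric_mul_rpow_le {γ β : ℝ} (hγ : 0 < γ) (hβ : 0 ≤ β) :
    ∃ C : ℝ, 0 ≤ C ∧ ∀ M : ℝ, 1 ≤ M →
      ∑' j : ℕ, ENNReal.ofReal (2 ^ (-γ * j) * (M + j) ^ β) ≤ ENNReal.ofReal (C * M ^ β) := by
  have hr0 : (0 : ℝ) < 2 ^ (-γ) := by positivity
  have hr1 : (2 : ℝ) ^ (-γ) < 1 := Real.rpow_lt_one_of_one_lt_of_neg (by norm_num) (by linarith)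
  set u : ℕ → ℝ := fun j => 2 ^ (-γ * j) * (1 + (j : ℝ)) ^ β with hu
  have hu0 : ∀ j, 0 ≤ u j := fun j => by positivity
  have hsum : Summable u := by
    have h1 := (summable_nat_add_iff 1).2 (summable_pow_mul_geometric_of_norm_lt_one ⌈β⌉₊
      (r := (2 : ℝ) ^ (-γ)) (by rwa [Real.norm_of_nonneg hr0.le]))
    refine Summable.of_nonneg_of_le hu0 (fun j => ?_) (h1.mul_left ((2 : ℝ) ^ (-γ))⁻¹)
    have h2 : (1 + (j : ℝ)) ^ β ≤ ((j + 1 : ℕ) : ℝ) ^ ⌈β⌉₊ := by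
      rw [← Real.rpow_natCast]
      push_cast
      rw [add_comm]
      exact Real.rpow_le_rpow_of_exponent_le (by linarith [(Nat.cast_nonneg j : (0 : ℝ) ≤ j)])
        (Nat.le_ceil β)
    have h3 : (2 : ℝ) ^ (-γ * j) = (2 ^ (-γ)) ^ j := by
      rw [← Real.rpow_natCast, ← Real.rpow_mul (by norm_num)]
    rw [pow_succ]
    calc u j ≤ (2 ^ (-γ)) ^ j * ((j + 1 : ℕ) : ℝ) ^ ⌈β⌉₊ := by
          simp only [hu, h3]
          gcongr
      _ = _ := by
          field_simp
  refine ⟨∑' j, u j, tsum_nonneg hu0, fun M hM => ?_⟩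
  have hM0 : 0 ≤ M := by linarith
  rw [← tsum_mul_right, ENNReal.ofReal_tsum_of_nonneg (fun j => mul_nonneg (hu0 j) (by positivity))
    (hsum.mul_right _)]
  refine ENNReal.tsum_le_tsum fun j => ENNReal.ofReal_le_ofReal ?_
  simp only [hu]
  -- As `M ≥ 1`, one has `M + j ≤ (1 + j) M`, which separates `M` from the series.
  rw [mul_assoc, ← Real.mul_rpow (by positivity) hM0]
  refine mul_le_mul_of_nonneg_left (Real.rpow_le_rpow (by positivity) ?_ hβ) (by positivity)
  nlinarith [(Nat.cast_nonneg j : (0 : ℝ) ≤ j)]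

/-- A single term bounds `2^{s|m|} ‖Ψ_m * f‖_p` by the norm of `f`, and the decay `2^{-(s-1/p)ℓ}`
outweighs the polynomial number of indices of level `ℓ`. -/
theorem summableLevels_of_fNorm (hd : 1 ≤ d) (hp : 1 ≤ p) (hθ : 1 ≤ θ) (hs : 1 / p < s)
    (hf : Ψ.fNorm s p θ f < ⊤) : Ψ.SummableLevels p f := by
  have hterm : ∀ m : Fin d → ℕ, Ψ.levelNorm p f m * ENNReal.ofReal (2 ^ ∑ i, m i) ^ (1 / p) ≤
      Ψ.fNorm s p θ f * ENNReal.ofReal (2 ^ (-(s - 1 / p) * ((∑ i, m i : ℕ) : ℝ))) := by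
    intro m
    have h1 := Ψ.weight_mul_levelNorm_le s hp hθ f m
    have h2 : ENNReal.ofReal (2 ^ ∑ i, m i) ^ (1 / p) = weight s m *
        ENNReal.ofReal (2 ^ (-(s - 1 / p) * ((∑ i, m i : ℕ) : ℝ))) := by
      rw [weight, sum_ofReal_mul, ← ENNReal.ofReal_mul (by positivity),
        ENNReal.ofReal_rpow_of_nonneg (by positivity) (by positivity),
        ← Real.rpow_add (by norm_num), ← Real.rpow_natCast, ← Real.rpow_mul (by norm_num)]
      congr 2
      ring
    rw [h2, ← mul_assoc, mul_comm (Ψ.levelNorm p f m)]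
    exact mul_le_mul_left h1 _
  refine ne_top_of_le_ne_top ?_ (ENNReal.tsum_le_tsum hterm)
  rw [ENNReal.tsum_mul_left, tsum_eq_tsum_levelSet]
  refine ENNReal.mul_ne_top hf.ne ?_
  obtain ⟨C, hC, h⟩ := exists_tsum_geometric_mul_rpow_le (sub_pos.2 hs)
    (Nat.cast_nonneg (d - 1) : (0 : ℝ) ≤ ((d - 1 : ℕ) : ℝ))
  refine ne_top_of_le_ne_top ENNReal.ofReal_ne_top (le_trans (ENNReal.tsum_le_tsum fun ℓ => ?_)
    (h 1 le_rfl))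
  rw [Finset.sum_congr rfl fun m hm => by rw [mem_levelSet.1 hm], Finset.sum_const, nsmul_eq_mul,
    mul_comm, ENNReal.ofReal_mul (by positivity), Real.rpow_natCast]
  refine mul_le_mul_right ?_ _
  rw [← ENNReal.ofReal_natCast]
  refine ENNReal.ofReal_le_ofReal ?_
  rw [add_comm]
  exact_mod_cast card_levelSet_le hd ℓ

variable {ξ : Fin d → ℝ}

/-- The error in terms of the components of high frequency. -/
theorem IsFrolovRoots.exists_ruleError_le_tsum (hξ : IsFrolovRoots ξ) (hd : 1 ≤ d)
    (Ψ : Kernels L) (hp : 1 ≤ p) (hs : 0 < s) : ∃ (K : ℝ≥0∞) (J₀ : ℕ), K ≠ ⊤ ∧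
      ∀ f : 𝓢'(EuclideanSpace ℝ (Fin d), ℂ), Distribution.dsupport f ⊆ unitCube d →
        Ψ.SummableLevels p f → ∀ n : ℕ, 1 ≤ n → ∀ q : ℕ → ℝ, (∀ j, 1 ≤ q j) →
        ruleError ξ n f ≤ K * ENNReal.ofReal ((n : ℝ) ^ (-s)) *
          ∑' j, ENNReal.ofReal (2 ^ ((1 / q j - s) * j)) *
            ∑ m ∈ levelSet d (Nat.log 2 n - J₀ + j), weight s m * Ψ.levelNorm (q j) f m := by
  obtain ⟨D⟩ := Ψ.nonempty_dualKernels
  have hdet := abs_pos.2 hξ.det_ne_zero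
  set κ : ℝ := |(Matrix.vandermonde ξ).det| / ((Matrix.vandermonde ξ).det ^ 2) ^ d with hκ
  have hκ0 : 0 < κ := by
    have := pow_pos (sq_pos_of_ne_zero hξ.det_ne_zero) d
    positivity
  have hε : 0 < D.ε ^ d := pow_pos D.ε_pos d
  set c₀ := κ / D.ε ^ d with hc₀
  have hc₀0 : 0 < c₀ := by positivity
  -- Components with a nonzero error have `2^ℓ > c₀ n`; by the choice of `J₀` they have level at
  -- least `log₂ n - J₀`.
  obtain ⟨J₀, hJ₀⟩ := pow_unbounded_of_one_lt c₀⁻¹ (one_lt_two : (1 : ℝ) < 2)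
  obtain ⟨K, hK, hKe⟩ := D.enorm_pieceError_le hξ hd hc₀0
  refine ⟨K * ENNReal.ofReal (2 ^ (((J₀ : ℝ) + 1) * s)), J₀,
    ENNReal.mul_ne_top hK ENNReal.ofReal_ne_top, fun f hf hsl n hn q hq => ?_⟩
  have hn' : (0 : ℝ) < n := by exact_mod_cast hn
  set lg := Nat.log 2 n with hlg
  -- Truncated subtraction does no harm: `μ ≤ lg ≤ μ + J₀` holds in any case.
  set μ := lg - J₀ with hμ
  have hlg1 : 2 ^ lg ≤ n := Nat.pow_log_le_self 2 (by omega)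
  have hlg2 : n < 2 ^ (lg + 1) := Nat.lt_pow_succ_log_self (by norm_num) n
  -- regrouping
  set T : ℕ → ℝ≥0∞ := fun ℓ => if μ ≤ ℓ then ∑ m ∈ levelSet d ℓ,
    K * (Ψ.levelNorm (q (ℓ - μ)) f m * ENNReal.ofReal (2 ^ ℓ / n) ^ (1 / q (ℓ - μ))) else 0 with hT
  have h1 : ruleError ξ n f ≤ ∑' ℓ, T ℓ := by
    refine (D.ruleError_le_tsum hξ hd hn hp hf hsl).trans ?_
    rw [tsum_eq_tsum_levelSet]
    refine ENNReal.tsum_le_tsum fun ℓ => ?_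
    by_cases hz : D.ε ^ d * 2 ^ ℓ ≤ κ * n
    · rw [Finset.sum_eq_zero fun m hm => by
        rw [D.pieceError_eq_zero hξ hd hn hf (by rw [mem_levelSet.1 hm]; exact hz), enorm_zero]]
      exact zero_le
    · push Not at hz
      have h2 : c₀ * n < 2 ^ ℓ := by
        rw [hc₀, div_mul_eq_mul_div, div_lt_iff₀ hε]
        linarith
      have h3 : μ ≤ ℓ := by
        have h4 : (n : ℝ) < 2 ^ (J₀ + ℓ) := by
          rw [pow_add]
          calc (n : ℝ) = c₀⁻¹ * (c₀ * n) := by rw [inv_mul_cancel_left₀ hc₀0.ne']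
            _ < 2 ^ J₀ * 2 ^ ℓ := mul_lt_mul'' hJ₀ h2 (by positivity) (by positivity)
        have h5 : 2 ^ lg < 2 ^ (J₀ + ℓ) := lt_of_le_of_lt hlg1 (by exact_mod_cast h4)
        have := (Nat.pow_lt_pow_iff_right (by norm_num : 1 < 2)).1 h5
        omega
      simp only [hT, if_pos h3]
      refine Finset.sum_le_sum fun m hm => ?_
      have h6 := hKe f hf n hn m (by rw [mem_levelSet.1 hm]; exact h2.le) (q (ℓ - μ)) (hq _)
      rwa [mem_levelSet.1 hm] at h6
  have h2 : ∑' ℓ, T ℓ = ∑' j, T (j + μ) := by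
    rw [← (ENNReal.summable (f := fun j => T (j + μ))).sum_add_tsum_nat_add',
      Finset.sum_eq_zero, zero_add]
    intro i hi
    have := Finset.mem_range.1 hi
    simp only [hT]
    rw [if_neg (by omega)]
  rw [h2] at h1
  refine h1.trans ?_
  rw [← ENNReal.tsum_mul_left]
  refine ENNReal.tsum_le_tsum fun j => ?_
  simp only [hT]
  rw [if_pos (by omega), Nat.add_sub_cancel, add_comm j μ, Finset.mul_sum, Finset.mul_sum]
  refine Finset.sum_le_sum fun m hm => ?_
  have hq0 : 0 < 1 / q j := by have := hq j; positivity
  -- From `2^μ ≤ n` the left side is at most `2^{j/q}`, and `n ≤ 2^{J₀+1} 2^μ` allows the factor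
  -- `n^{-s} 2^{sμ}` to be inserted.
  have hreal : ((2 : ℝ) ^ (μ + j) / n) ^ (1 / q j) ≤ 2 ^ (((J₀ : ℝ) + 1) * s) * (n : ℝ) ^ (-s) *
      2 ^ ((1 / q j - s) * j) * 2 ^ (s * ((μ + j : ℕ) : ℝ)) := by
    have e1 : (2 : ℝ) ^ μ / n ≤ 1 := by
      rw [div_le_one hn']
      have : 2 ^ μ ≤ n := (Nat.pow_le_pow_right (by norm_num) (Nat.sub_le _ _)).trans hlg1
      exact_mod_cast this
    have e2 : (n : ℝ) ≤ 2 ^ (J₀ + 1) * 2 ^ μ := by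
      have : n ≤ 2 ^ (J₀ + 1) * 2 ^ μ := by
        rw [← pow_add]
        exact hlg2.le.trans (Nat.pow_le_pow_right (by norm_num) (by omega))
      exact_mod_cast this
    have e3 : ((2 : ℝ) ^ (μ + j) / n) ^ (1 / q j) ≤ 2 ^ (1 / q j * j) := by
      rw [pow_add, mul_div_right_comm, Real.mul_rpow (by positivity) (by positivity),
        mul_comm (1 / q j) (j : ℝ), Real.rpow_mul (by norm_num), Real.rpow_natCast]
      exact mul_le_of_le_one_left (by positivity) (Real.rpow_le_one (by positivity) e1 hq0.le)
    have e4 : (1 : ℝ) ≤ 2 ^ (((J₀ : ℝ) + 1) * s) * (n : ℝ) ^ (-s) * 2 ^ (s * (μ : ℝ)) := by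
      have e5 := Real.rpow_le_rpow hn'.le e2 hs.le
      rw [Real.mul_rpow (by positivity) (by positivity), ← Real.rpow_natCast, ← Real.rpow_natCast,
        ← Real.rpow_mul (by norm_num), ← Real.rpow_mul (by norm_num), mul_comm (μ : ℝ)] at e5
      push_cast at e5
      rw [mul_right_comm, Real.rpow_neg hn'.le, ← div_eq_mul_inv, le_div_iff₀ (by positivity)]
      linarith
    refine e3.trans ?_
    calc (2 : ℝ) ^ (1 / q j * j) ≤ (2 ^ (((J₀ : ℝ) + 1) * s) * (n : ℝ) ^ (-s) *
          2 ^ (s * (μ : ℝ))) * 2 ^ (1 / q j * j) := le_mul_of_one_le_left (by positivity) e4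
      _ = _ := by
          have : (2 : ℝ) ^ (1 / q j * j) = 2 ^ ((1 / q j - s) * j) * 2 ^ (s * (j : ℝ)) := by
            rw [← Real.rpow_add (by norm_num)]
            congr 1
            ring
          rw [this]
          push_cast
          rw [mul_add, Real.rpow_add (by norm_num)]
          ring
  have hE := ENNReal.ofReal_le_ofReal hreal
  rw [ENNReal.ofReal_mul (by positivity), ENNReal.ofReal_mul (by positivity),
    ENNReal.ofReal_mul (by positivity), ← ENNReal.ofReal_rpow_of_nonneg (by positivity) hq0.le] at hE
  rw [weight, sum_ofReal_mul, mem_levelSet.1 hm]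
  calc _ ≤ K * (Ψ.levelNorm (q j) f m * (ENNReal.ofReal (2 ^ (((J₀ : ℝ) + 1) * s)) *
        ENNReal.ofReal ((n : ℝ) ^ (-s)) * ENNReal.ofReal (2 ^ ((1 / q j - s) * j)) *
        ENNReal.ofReal (2 ^ (s * ((μ + j : ℕ) : ℝ))))) :=
        mul_le_mul_right (mul_le_mul_right hE _) _
    _ = _ := by ring

/-- The summand `1` makes the real constant positive, whatever `K` is. -/
theorem mul_ofReal_le {K : ℝ≥0∞} (hK : K ≠ ⊤) (x : ℝ) :
    K * ENNReal.ofReal x ≤ ENNReal.ofReal ((K.toReal + 1) * x) := by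
  rw [ENNReal.ofReal_mul (by positivity)]
  refine mul_le_mul_left ?_ _
  conv_lhs => rw [← ENNReal.ofReal_toReal hK]
  exact ENNReal.ofReal_le_ofReal (by linarith)

theorem exists_sum_levelSet_le (Ψ : Kernels L) (hd : 1 ≤ d) (hp : 1 ≤ p) : ∃ K : ℝ≥0∞, K ≠ ⊤ ∧
    ∀ f : 𝓢'(EuclideanSpace ℝ (Fin d), ℂ), Distribution.dsupport f ⊆ unitCube d →
      ∀ (s q : ℝ) (θ : ℝ≥0∞), 1 ≤ q → q ≤ p → 1 ≤ θ → q * (θ⁻¹).toReal ≤ 1 →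
      Ψ.fNorm s p θ f ≤ 1 → ∀ ℓ M : ℕ, ℓ + 1 ≤ M →
      ∑ m ∈ levelSet d ℓ, weight s m * Ψ.levelNorm q f m ≤
        K * ENNReal.ofReal ((M : ℝ) ^ (((d : ℝ) - 1) * (1 - (θ⁻¹).toReal))) := by
  obtain ⟨K, hK, h⟩ := Ψ.exists_sum_weight_mul_levelNorm_le d hp
  refine ⟨K, hK, fun f hf s q θ hq hqp hθ hqθ hF ℓ M hM => ?_⟩
  refine (h f hf s q θ hq hqp hθ hqθ (levelSet d ℓ)).trans ?_
  refine (mul_le_mul_right hF _).trans ?_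
  rw [mul_one]
  refine mul_le_mul_right ?_ _
  have hτ : (θ⁻¹).toReal ≤ 1 := by
    have : (0 : ℝ) ≤ (θ⁻¹).toReal := ENNReal.toReal_nonneg
    nlinarith
  rw [← ENNReal.ofReal_natCast, ENNReal.ofReal_rpow_of_nonneg (by positivity) (by linarith)]
  refine ENNReal.ofReal_le_ofReal ?_
  rw [Real.rpow_mul (by positivity)]
  refine Real.rpow_le_rpow (by positivity) ?_ (by linarith)
  have h1 : (levelSet d ℓ).card ≤ M ^ (d - 1) :=
    (card_levelSet_le hd ℓ).trans (Nat.pow_le_pow_left hM _)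
  have h2 : ((d : ℝ) - 1) = ((d - 1 : ℕ) : ℝ) := by
    rw [Nat.cast_sub hd, Nat.cast_one]
  rw [h2, Real.rpow_natCast]
  exact_mod_cast h1

end Upper

/-! ### The upper bounds in the three ranges of smoothness. -/

section UpperBounds

variable {L d : ℕ} {θ : ℝ≥0∞} {s p : ℝ}

/-- For `s > 1/q` the level sums decay geometrically up to a polynomial factor, so the tail is
comparable to its first term. The offset `J` is zero for large smoothness and the length of the
first block otherwise. -/
theorem exists_tail_le (Ψ : Kernels L) (hd : 1 ≤ d) (hp : 1 ≤ p) (hθ : 1 ≤ θ) {q : ℝ}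
    (hq : 1 ≤ q) (hqp : q ≤ p) (hqθ : q * (θ⁻¹).toReal ≤ 1) (hs : 1 / q < s) :
    ∃ K : ℝ≥0∞, K ≠ ⊤ ∧ ∀ f : 𝓢'(EuclideanSpace ℝ (Fin d), ℂ),
      Distribution.dsupport f ⊆ unitCube d → Ψ.fNorm s p θ f ≤ 1 → ∀ μ M J : ℕ, μ + 1 ≤ M →
      ∑' i : ℕ, ENNReal.ofReal (2 ^ ((1 / q - s) * ((i + J : ℕ) : ℝ))) *
        ∑ m ∈ levelSet d (μ + (i + J)), weight s m * Ψ.levelNorm q f m ≤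
      K * ENNReal.ofReal (2 ^ (-(s - 1 / q) * J) *
        ((M + J : ℕ) : ℝ) ^ (((d : ℝ) - 1) * (1 - (θ⁻¹).toReal))) := by
  obtain ⟨K, hK, h⟩ := exists_sum_levelSet_le Ψ hd hp
  have hd' : (0 : ℝ) ≤ (d : ℝ) - 1 := by
    have : (1 : ℝ) ≤ d := by exact_mod_cast hd
    linarith
  have hτ : (θ⁻¹).toReal ≤ 1 := by
    have : (0 : ℝ) ≤ (θ⁻¹).toReal := ENNReal.toReal_nonneg
    nlinarith
  set β := ((d : ℝ) - 1) * (1 - (θ⁻¹).toReal) with hβ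
  have hβ0 : 0 ≤ β := mul_nonneg hd' (by linarith)
  obtain ⟨C, hC, hg⟩ := exists_tsum_geometric_mul_rpow_le (sub_pos.2 hs) hβ0
  refine ⟨K * ENNReal.ofReal C, ENNReal.mul_ne_top hK ENNReal.ofReal_ne_top,
    fun f hf hF μ M J hM => ?_⟩
  calc _ ≤ ∑' i : ℕ, K * ENNReal.ofReal (2 ^ (-(s - 1 / q) * J)) *
        ENNReal.ofReal (2 ^ (-(s - 1 / q) * i) * (((M + J : ℕ) : ℝ) + i) ^ β) := by
        refine ENNReal.tsum_le_tsum fun i => ?_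
        refine (mul_le_mul_right (h f hf s q θ hq hqp hθ hqθ hF (μ + (i + J)) (M + J + i)
          (by omega)) _).trans (le_of_eq ?_)
        rw [ENNReal.ofReal_mul (by positivity)]
        have : (2 : ℝ) ^ ((1 / q - s) * ((i + J : ℕ) : ℝ)) =
            2 ^ (-(s - 1 / q) * (J : ℝ)) * 2 ^ (-(s - 1 / q) * (i : ℝ)) := by
          rw [← Real.rpow_add (by norm_num)]
          congr 1
          push_cast
          ring
        rw [this, ENNReal.ofReal_mul (by positivity), ← hβ]
        push_cast
        ring
    _ ≤ K * ENNReal.ofReal (2 ^ (-(s - 1 / q) * J)) *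
        ENNReal.ofReal (C * ((M + J : ℕ) : ℝ) ^ β) := by
        rw [ENNReal.tsum_mul_left]
        refine mul_le_mul_right (hg _ ?_) _
        exact_mod_cast (by omega : 1 ≤ M + J)
    _ = _ := by
        rw [ENNReal.ofReal_mul hC, ENNReal.ofReal_mul (by positivity)]
        ring

/-- Since `log 2 > 2/3`, both `log₂ n` and, for `n ≥ 2`, the number `1` are at most `(3/2) log n`.
-/
theorem log_two_add_one_le {n : ℕ} (hn : 2 ≤ n) :
    ((Nat.log 2 n + 1 : ℕ) : ℝ) ≤ 3 * Real.log n := by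
  have h1 : (2 : ℝ) ^ Nat.log 2 n ≤ n := by exact_mod_cast Nat.pow_log_le_self 2 (by omega)
  have h2 := Real.log_le_log (by positivity) h1
  rw [Real.log_pow] at h2
  have h3 : Real.log 2 ≤ Real.log n := Real.log_le_log (by norm_num) (by exact_mod_cast hn)
  have h4 := Real.log_two_gt_d9
  push_cast
  nlinarith

theorem inv_toReal_le_one (hθ : 1 ≤ θ) : (θ⁻¹).toReal ≤ 1 := by
  rw [← ENNReal.toReal_one]
  exact ENNReal.toReal_mono ENNReal.one_ne_top (ENNReal.inv_le_one.2 hθ)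

variable {ξ : Fin d → ℝ}

theorem worstCaseError_le (Ψ : Kernels L) {n : ℕ} {X : ℝ≥0∞}
    (h : ∀ f : 𝓢'(EuclideanSpace ℝ (Fin d), ℂ), Distribution.dsupport f ⊆ unitCube d →
      Ψ.fNorm s p θ f ≤ 1 → ruleError ξ n f ≤ X) : worstCaseError ξ n Ψ s p θ ≤ X :=
  iSup₂_le fun f hf => h f hf.1.2 hf.2

theorem dim_sub_one_nonneg (hd : 1 ≤ d) : (0 : ℝ) ≤ (d : ℝ) - 1 := by
  have : (1 : ℝ) ≤ d := by exact_mod_cast hd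
  linarith

/-- The upper bound for large smoothness. -/
theorem IsFrolovRoots.worstCaseError_le_of_lt (hξ : IsFrolovRoots ξ) (hd : 1 ≤ d) (Ψ : Kernels L)
    (hp : 1 ≤ p) (hθ : 1 ≤ θ) (hs : 1 / p < s) (hsθ : (θ⁻¹).toReal < s) :
    ∃ C : ℝ, 0 < C ∧ ∀ n : ℕ, 2 ≤ n → worstCaseError ξ n Ψ s p θ ≤
      ENNReal.ofReal (C * ((n : ℝ) ^ (-s) *
        Real.log n ^ (((d : ℝ) - 1) * (1 - (θ⁻¹).toReal)))) := by
  have hp0 : 0 < 1 / p := by positivity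
  have hs0 : 0 < s := hp0.trans hs
  have hp1 : 1 / p ≤ 1 := by rw [div_le_one (by linarith)]; exact hp
  have hτ1 := inv_toReal_le_one hθ
  set τ := (θ⁻¹).toReal
  -- Then `1/a = min(p, θ)`, the largest admissible exponent; in terms of reciprocals the case `θ =
  -- ∞` needs no special treatment.
  set a := max (1 / p) τ
  have ha0 : 0 < a := lt_of_lt_of_le hp0 (le_max_left _ _)
  have ha1 : a ≤ 1 := max_le hp1 hτ1
  have has : a < s := max_lt hs hsθ
  have hq : 1 ≤ 1 / a := by rwa [one_le_div ha0]
  have hqp : 1 / a ≤ p := by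
    rw [div_le_iff₀ ha0]
    have := le_max_left (1 / p) τ
    calc (1 : ℝ) = p * (1 / p) := by field_simp
      _ ≤ p * a := by gcongr
  have hqθ : 1 / a * τ ≤ 1 := by
    rw [one_div_mul_eq_div, div_le_one ha0]
    exact le_max_right _ _
  obtain ⟨K₁, J₀, hK₁, h1⟩ := hξ.exists_ruleError_le_tsum hd Ψ hp hs0
  obtain ⟨K₂, hK₂, h2⟩ := exists_tail_le Ψ hd hp hθ hq hqp hqθ (by rwa [one_div_one_div])
  set β := ((d : ℝ) - 1) * (1 - τ)
  have hβ : 0 ≤ β := mul_nonneg (dim_sub_one_nonneg hd) (by linarith)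
  refine ⟨((K₁ * K₂).toReal + 1) * 3 ^ β, by positivity, fun n hn => worstCaseError_le Ψ
    fun f hf hF => ?_⟩
  have hsl := summableLevels_of_fNorm hd hp hθ hs (lt_of_le_of_lt hF ENNReal.one_lt_top)
  refine (h1 f hf hsl n (by omega) (fun _ => 1 / a) fun _ => hq).trans ?_
  have h3 := h2 f hf hF (Nat.log 2 n - J₀) (Nat.log 2 n + 1) 0 (by omega)
  simp only [Nat.add_zero, Nat.cast_zero, mul_zero, Real.rpow_zero, one_mul] at h3
  have hlog : 0 ≤ Real.log n := Real.log_natCast_nonneg n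
  have hM := log_two_add_one_le hn
  calc _ ≤ K₁ * ENNReal.ofReal ((n : ℝ) ^ (-s)) *
        (K₂ * ENNReal.ofReal (((Nat.log 2 n + 1 : ℕ) : ℝ) ^ β)) := mul_le_mul_right h3 _
    _ = K₁ * K₂ * ENNReal.ofReal ((n : ℝ) ^ (-s) * ((Nat.log 2 n + 1 : ℕ) : ℝ) ^ β) := by
        rw [ENNReal.ofReal_mul (by positivity)]
        ring
    _ ≤ _ := mul_ofReal_le (ENNReal.mul_ne_top hK₁ hK₂) _
    _ ≤ _ := by
        refine ENNReal.ofReal_le_ofReal ?_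
        rw [mul_assoc]
        refine mul_le_mul_of_nonneg_left ?_ (by positivity)
        rw [mul_left_comm]
        refine mul_le_mul_of_nonneg_left ?_ (by positivity)
        rw [← Real.mul_rpow (by norm_num) hlog]
        exact Real.rpow_le_rpow (by positivity) hM hβ

/-- The bound with a change of the exponent at the level `log n + J`. -/
theorem IsFrolovRoots.exists_ruleError_le_split (hξ : IsFrolovRoots ξ) (hd : 1 ≤ d)
    (Ψ : Kernels L) (hp : 1 ≤ p) (hθ : 1 ≤ θ) (hs : 1 / p < s) (hsθ : s ≤ (θ⁻¹).toReal) :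
    ∃ (K : ℝ≥0∞) (J₀ : ℕ), K ≠ ⊤ ∧ ∀ f : 𝓢'(EuclideanSpace ℝ (Fin d), ℂ),
      Distribution.dsupport f ⊆ unitCube d → Ψ.fNorm s p θ f ≤ 1 → ∀ n : ℕ, 1 ≤ n →
      ∀ M κ : ℕ, M = Nat.log 2 n + 1 → M ≤ 2 ^ κ → κ ≤ M →
      ruleError ξ n f ≤ K * ENNReal.ofReal ((n : ℝ) ^ (-s)) *
        (∑ j ∈ Finset.range ((d - 1) * κ), ENNReal.ofReal (2 ^ (((θ⁻¹).toReal - s) * j)) *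
            ∑ m ∈ levelSet d (Nat.log 2 n - J₀ + j),
              weight s m * Ψ.levelNorm (1 / (θ⁻¹).toReal) f m +
          ENNReal.ofReal ((M : ℝ) ^ (((d : ℝ) - 1) * (1 - s)))) := by
  have hp0 : 0 < 1 / p := by positivity
  have hp1 : 1 / p ≤ 1 := by rw [div_le_one (by linarith)]; exact hp
  have hs0 : 0 < s := hp0.trans hs
  have hτ1 := inv_toReal_le_one hθ
  set τ := (θ⁻¹).toReal with hτ
  have hτ0 : 0 < τ := hs0.trans_le hsθ
  have hθ0 : θ ≠ 0 := (zero_lt_one.trans_le hθ).ne'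
  have hθtop : θ ≠ ⊤ := by
    rintro rfl
    simp [hτ] at hτ0
  -- Since `1/p < s ≤ 1/θ`, the norm with `θ` dominates the one with `p` in its place, for which the
  -- exponent `q = p` is admissible.
  have hθp : θ ≤ ENNReal.ofReal p := by
    rw [ENNReal.le_ofReal_iff_toReal_le hθtop (by linarith)]
    have h1 : τ = (θ.toReal)⁻¹ := ENNReal.toReal_inv θ
    have h2 := hs.trans_le hsθ
    rw [h1, ← one_div] at h2
    exact (lt_of_one_div_lt_one_div (by linarith) h2).le
  have hθ' : (1 : ℝ≥0∞) ≤ ENNReal.ofReal p := hθ.trans hθp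
  have hp' : ((ENNReal.ofReal p)⁻¹).toReal = 1 / p := by
    rw [ENNReal.toReal_inv, ENNReal.toReal_ofReal (by linarith), one_div]
  obtain ⟨K₁, J₀, hK₁, h1⟩ := hξ.exists_ruleError_le_tsum hd Ψ hp hs0
  obtain ⟨K₂, hK₂, h2⟩ := exists_tail_le Ψ hd hp hθ' hp le_rfl
    (by rw [hp', mul_one_div_cancel (by linarith)]) hs
  rw [hp'] at h2
  have hd0 := dim_sub_one_nonneg hd
  set β := ((d : ℝ) - 1) * (1 - 1 / p)
  have hβ : 0 ≤ β := mul_nonneg hd0 (by linarith)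
  set K₃ := K₂ * ENNReal.ofReal ((d : ℝ) ^ β)
  have hK₃ : K₃ ≠ ⊤ := ENNReal.mul_ne_top hK₂ ENNReal.ofReal_ne_top
  refine ⟨K₁ * (1 + K₃), J₀, by finiteness, fun f hf hF n hn M κ hM hκ hκM => ?_⟩
  have hsl := summableLevels_of_fNorm hd hp hθ hs (lt_of_le_of_lt hF ENNReal.one_lt_top)
  -- As `2^κ` is comparable to `M`, which is of the order `log n`, the block length gives `2^J` of
  -- the order `M^{d-1}`.
  set J := (d - 1) * κ
  refine (h1 f hf hsl n hn (fun j => if j < J then 1 / τ else p) fun j => ?_).trans ?_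
  · split_ifs
    · rwa [one_le_div hτ0]
    · exact hp
  have hF' := (Ψ.fNorm_antitone s hp hθ hθp f).trans hF
  have h3 := h2 f hf hF' (Nat.log 2 n - J₀) M J (by omega)
  rw [← (ENNReal.summable (f := fun j => ENNReal.ofReal (2 ^ ((1 / (if (j + J) < J then 1 / τ else p)
    - s) * ((j + J : ℕ) : ℝ))) * ∑ m ∈ levelSet d (Nat.log 2 n - J₀ + (j + J)), weight s m *
    Ψ.levelNorm (if (j + J) < J then 1 / τ else p) f m)).sum_add_tsum_nat_add'
    (f := fun j => ENNReal.ofReal (2 ^ ((1 / (if j < J then 1 / τ else p)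
    - s) * (j : ℝ))) * ∑ m ∈ levelSet d (Nat.log 2 n - J₀ + j), weight s m *
    Ψ.levelNorm (if j < J then 1 / τ else p) f m)]
  have h4 : ∀ j, ¬ (j + J < J) := fun j => by omega
  simp only [h4, if_false]
  have h5 : ∑ j ∈ Finset.range J, ENNReal.ofReal (2 ^ ((1 / (if j < J then 1 / τ else p)
      - s) * (j : ℝ))) * ∑ m ∈ levelSet d (Nat.log 2 n - J₀ + j), weight s m *
      Ψ.levelNorm (if j < J then 1 / τ else p) f m = ∑ j ∈ Finset.range J,
      ENNReal.ofReal (2 ^ ((τ - s) * (j : ℝ))) * ∑ m ∈ levelSet d (Nat.log 2 n - J₀ + j),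
        weight s m * Ψ.levelNorm (1 / τ) f m := by
    refine Finset.sum_congr rfl fun j hj => ?_
    rw [if_pos (Finset.mem_range.1 hj), one_div_one_div]
  rw [h5]
  have hM0 : (0 : ℝ) < M := by
    rw [hM]
    positivity
  -- The exponents `-(s - 1/p)` and `1 - 1/p`, each times `d - 1`, add up to `(d - 1)(1 - s)`; the
  -- constant `d^β` comes from `M + J ≤ d M`.
  have h6 : (2 : ℝ) ^ (-(s - 1 / p) * J) * ((M + J : ℕ) : ℝ) ^ β ≤
      (d : ℝ) ^ β * (M : ℝ) ^ (((d : ℝ) - 1) * (1 - s)) := by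
    have hdc : ((d - 1 : ℕ) : ℝ) = (d : ℝ) - 1 := by rw [Nat.cast_sub hd, Nat.cast_one]
    have e1 : (2 : ℝ) ^ (-(s - 1 / p) * J) ≤ (M : ℝ) ^ (((d : ℝ) - 1) * (-(s - 1 / p))) := by
      have e2 : (2 : ℝ) ^ (-(s - 1 / p) * J) = ((2 : ℝ) ^ κ) ^ (((d : ℝ) - 1) * (-(s - 1 / p))) := by
        rw [← Real.rpow_natCast, ← Real.rpow_mul (by norm_num)]
        congr 1
        simp only [J]
        push_cast
        rw [hdc]
        ring
      rw [e2]
      refine Real.rpow_le_rpow_of_nonpos hM0 (by exact_mod_cast hκ) ?_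
      exact mul_nonpos_of_nonneg_of_nonpos hd0 (by linarith)
    have e3 : ((M + J : ℕ) : ℝ) ≤ d * M := by
      have : M + J ≤ d * M := by
        calc M + J ≤ M + (d - 1) * M := by
              simp only [J]
              gcongr
          _ = (1 + (d - 1)) * M := by ring
          _ = d * M := by rw [Nat.add_sub_cancel' hd]
      exact_mod_cast this
    calc _ ≤ (M : ℝ) ^ (((d : ℝ) - 1) * (-(s - 1 / p))) * ((d : ℝ) * M) ^ β := by gcongr
      _ = _ := by
          rw [Real.mul_rpow (by positivity) (by positivity), mul_left_comm,
            ← Real.rpow_add hM0]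
          congr 2
          simp only [β]
          ring
  have h7 : K₂ * ENNReal.ofReal ((2 : ℝ) ^ (-(s - 1 / p) * J) * ((M + J : ℕ) : ℝ) ^ β) ≤
      K₃ * ENNReal.ofReal ((M : ℝ) ^ (((d : ℝ) - 1) * (1 - s))) := by
    rw [mul_assoc, ← ENNReal.ofReal_mul (by positivity)]
    exact mul_le_mul_right (ENNReal.ofReal_le_ofReal h6) _
  rw [mul_right_comm K₁ (1 + K₃), mul_assoc (K₁ * _)]
  refine mul_le_mul_right ?_ _
  rw [mul_add]
  refine add_le_add (le_mul_of_one_le_left' le_self_add) ((h3.trans h7).trans ?_)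
  exact mul_le_mul_left le_add_self _

theorem exists_clog {M : ℕ} (hM : 2 ≤ M) : ∃ κ : ℕ, 1 ≤ κ ∧ M ≤ 2 ^ κ ∧ κ ≤ M ∧ 2 ^ κ ≤ 2 * M := by
  have h1 := Nat.pow_pred_clog_lt_self (by norm_num : 1 < 2) (by omega : 1 < M)
  have h2 : 0 < Nat.clog 2 M := Nat.clog_pos (by norm_num) (by omega)
  have h3 : (Nat.clog 2 M).pred < 2 ^ (Nat.clog 2 M).pred := Nat.lt_two_pow_self
  refine ⟨Nat.clog 2 M, h2, Nat.le_pow_clog (by norm_num) M, ?_, ?_⟩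
  · rw [Nat.pred_eq_sub_one] at h1 h3
    omega
  · obtain ⟨k, hk⟩ := Nat.exists_eq_succ_of_ne_zero h2.ne'
    rw [hk, Nat.pred_succ] at h1
    rw [hk, Nat.pow_succ]
    omega

theorem add_sub_one_mul_le (hd : 1 ≤ d) {M κ : ℕ} (h : κ ≤ M) : M + (d - 1) * κ ≤ d * M := by
  calc M + (d - 1) * κ ≤ M + (d - 1) * M := by gcongr
    _ = (1 + (d - 1)) * M := by ring
    _ = d * M := by rw [Nat.add_sub_cancel' hd]

/-- The upper bound for small smoothness. -/
theorem IsFrolovRoots.worstCaseError_le_of_gt (hξ : IsFrolovRoots ξ) (hd : 1 ≤ d) (Ψ : Kernels L)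
    (hp : 1 ≤ p) (hθ : 1 ≤ θ) (hs : 1 / p < s) (hsθ : s < (θ⁻¹).toReal) :
    ∃ C : ℝ, 0 < C ∧ ∀ n : ℕ, 2 ≤ n → worstCaseError ξ n Ψ s p θ ≤
      ENNReal.ofReal (C * ((n : ℝ) ^ (-s) * Real.log n ^ (((d : ℝ) - 1) * (1 - s)))) := by
  obtain ⟨K, J₀, hK, h⟩ := hξ.exists_ruleError_le_split hd Ψ hp hθ hs hsθ.le
  obtain ⟨K₂, hK₂, h2⟩ := exists_sum_levelSet_le Ψ hd hp
  have hp0 : 0 < 1 / p := by positivity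
  have hs0 : 0 < s := hp0.trans hs
  have hτ1 := inv_toReal_le_one hθ
  set τ := (θ⁻¹).toReal
  have hτ0 : 0 < τ := hs0.trans hsθ
  have hd0 := dim_sub_one_nonneg hd
  have hdc : ((d - 1 : ℕ) : ℝ) = (d : ℝ) - 1 := by rw [Nat.cast_sub hd, Nat.cast_one]
  have hq : 1 ≤ 1 / τ := by rwa [one_le_div hτ0]
  have hqp : 1 / τ ≤ p := by
    rw [div_le_iff₀ hτ0]
    calc (1 : ℝ) = p * (1 / p) := by field_simp
      _ ≤ p * τ := by gcongr; linarith
  set x : ℝ := 2 ^ (τ - s) with hx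
  have hx1 : 1 < x := Real.one_lt_rpow (by norm_num) (by linarith)
  set β := ((d : ℝ) - 1) * (1 - s)
  have hβ : 0 ≤ β := mul_nonneg hd0 (by linarith)
  set B : ℝ := 2 ^ (((d : ℝ) - 1) * (τ - s)) * (d : ℝ) ^ (((d : ℝ) - 1) * (1 - τ)) / (x - 1)
  set K' := K * (K₂ * ENNReal.ofReal B + 1)
  have hK' : K' ≠ ⊤ := by
    have : K₂ * ENNReal.ofReal B ≠ ⊤ := ENNReal.mul_ne_top hK₂ ENNReal.ofReal_ne_top
    finiteness
  refine ⟨(K'.toReal + 1) * 3 ^ β, by positivity, fun n hn => worstCaseError_le Ψ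
    fun f hf hF => ?_⟩
  set M := Nat.log 2 n + 1 with hM
  have hM2 : 2 ≤ M := by
    have : 0 < Nat.log 2 n := Nat.log_pos (by norm_num) hn
    omega
  obtain ⟨κ, -, hκ1, hκ2, hκ3⟩ := exists_clog hM2
  have hM0 : (0 : ℝ) < M := by positivity
  refine (h f hf hF n (by omega) M κ hM hκ1 hκ2).trans ?_
  set J := (d - 1) * κ with hJ
  -- The geometric sum with ratio `x > 1` is comparable to its last power, and `x^J` is at most
  -- `(2M)^{(d-1)(τ-s)}`. Together with the cardinality factor `M^{(d-1)(1-τ)}` this leaves the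
  -- exponent `(d - 1)(1 - s)`.
  have hblock : ∑ j ∈ Finset.range J, ENNReal.ofReal (2 ^ ((τ - s) * j)) *
      ∑ m ∈ levelSet d (Nat.log 2 n - J₀ + j), weight s m * Ψ.levelNorm (1 / τ) f m ≤
      K₂ * ENNReal.ofReal B * ENNReal.ofReal ((M : ℝ) ^ β) := by
    calc _ ≤ ∑ j ∈ Finset.range J, ENNReal.ofReal (2 ^ ((τ - s) * j)) *
          (K₂ * ENNReal.ofReal (((M + J : ℕ) : ℝ) ^ (((d : ℝ) - 1) * (1 - τ)))) := by
          refine Finset.sum_le_sum fun j hj => mul_le_mul_right ?_ _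
          have := Finset.mem_range.1 hj
          exact h2 f hf s (1 / τ) θ hq hqp hθ (by rw [one_div_mul_cancel hτ0.ne']) hF _ _
            (by omega)
      _ = K₂ * ENNReal.ofReal ((∑ j ∈ Finset.range J, x ^ j) *
          ((M + J : ℕ) : ℝ) ^ (((d : ℝ) - 1) * (1 - τ))) := by
          rw [← Finset.sum_mul, ENNReal.ofReal_mul (by positivity),
            ENNReal.ofReal_sum_of_nonneg fun j _ => by positivity]
          have : ∀ j : ℕ, (2 : ℝ) ^ ((τ - s) * (j : ℝ)) = x ^ j := fun j => by
            rw [hx, ← Real.rpow_natCast, ← Real.rpow_mul (by norm_num)]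
          simp_rw [this]
          ring
      _ ≤ K₂ * ENNReal.ofReal (B * (M : ℝ) ^ β) := by
          refine mul_le_mul_right (ENNReal.ofReal_le_ofReal ?_) _
          have e1 : ∑ j ∈ Finset.range J, x ^ j ≤
              (2 * (M : ℝ)) ^ (((d : ℝ) - 1) * (τ - s)) / (x - 1) := by
            rw [geom_sum_eq hx1.ne']
            refine div_le_div_of_nonneg_right ?_ (by linarith)
            have e2 : x ^ J = ((2 : ℝ) ^ κ) ^ (((d : ℝ) - 1) * (τ - s)) := by
              rw [hx, ← Real.rpow_natCast, ← Real.rpow_natCast, ← Real.rpow_mul (by norm_num),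
                ← Real.rpow_mul (by norm_num), hJ]
              congr 1
              push_cast
              rw [hdc]
              ring
            have e3 : ((2 : ℝ) ^ κ) ^ (((d : ℝ) - 1) * (τ - s)) ≤
                (2 * (M : ℝ)) ^ (((d : ℝ) - 1) * (τ - s)) :=
              Real.rpow_le_rpow (by positivity) (by exact_mod_cast hκ3)
                (mul_nonneg hd0 (by linarith))
            linarith
          have e4 : ((M + J : ℕ) : ℝ) ≤ d * M := by exact_mod_cast add_sub_one_mul_le hd hκ2
          have hx0 : 0 < x - 1 := by linarith
          have e5 : 0 ≤ ((d : ℝ) - 1) * (1 - τ) := mul_nonneg hd0 (by linarith)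
          calc _ ≤ (2 * (M : ℝ)) ^ (((d : ℝ) - 1) * (τ - s)) / (x - 1) *
                (d * M) ^ (((d : ℝ) - 1) * (1 - τ)) := by gcongr
            _ = B * ((M : ℝ) ^ (((d : ℝ) - 1) * (τ - s)) * (M : ℝ) ^ (((d : ℝ) - 1) * (1 - τ))) := by
                rw [Real.mul_rpow (by norm_num) hM0.le, Real.mul_rpow (by positivity) hM0.le]
                simp only [B]
                ring
            _ = _ := by
                rw [← Real.rpow_add hM0]
                congr 2
                simp only [β]
                ring
      _ = _ := by
          rw [ENNReal.ofReal_mul (by have : 0 < x - 1 := by linarith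
                                     positivity)]
          ring
  have hlog : 0 ≤ Real.log n := Real.log_natCast_nonneg n
  calc _ ≤ K * ENNReal.ofReal ((n : ℝ) ^ (-s)) *
        (K₂ * ENNReal.ofReal B * ENNReal.ofReal ((M : ℝ) ^ β) + ENNReal.ofReal ((M : ℝ) ^ β)) :=
        mul_le_mul_right (add_le_add hblock le_rfl) _
    _ = K' * ENNReal.ofReal ((n : ℝ) ^ (-s) * (M : ℝ) ^ β) := by
        rw [ENNReal.ofReal_mul (by positivity)]
        simp only [K']
        ring
    _ ≤ _ := mul_ofReal_le hK' _
    _ ≤ _ := by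
        refine ENNReal.ofReal_le_ofReal ?_
        rw [mul_assoc]
        refine mul_le_mul_of_nonneg_left ?_ (by positivity)
        rw [mul_left_comm]
        refine mul_le_mul_of_nonneg_left ?_ (by positivity)
        rw [← Real.mul_rpow (by norm_num) hlog]
        exact Real.rpow_le_rpow (by positivity) (log_two_add_one_le hn) hβ

/-- From `2^κ ≤ 6 log n` one gets `κ log 2 ≤ log 6 + log log n`. As `e < 3`, the number `log log n`
is bounded below by `log log 3 > 0` for `n ≥ 3`, which absorbs `log 6`. -/
theorem exists_clog_le_loglog : ∃ A : ℝ, 0 < A ∧ ∀ n κ : ℕ, 3 ≤ n →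
    2 ^ κ ≤ 2 * (Nat.log 2 n + 1) → (κ : ℝ) ≤ A * Real.log (Real.log n) := by
  have h3 : 1 < Real.log 3 := by
    rw [Real.lt_log_iff_exp_lt (by norm_num)]
    exact Real.exp_one_lt_three
  set y := Real.log (Real.log 3)
  have hy : 0 < y := Real.log_pos h3
  have hl2 : 0 < Real.log 2 := Real.log_pos (by norm_num)
  refine ⟨(Real.log 6 / y + 1) / Real.log 2, ?_, fun n κ hn hκ => ?_⟩
  · have : 0 < Real.log 6 := Real.log_pos (by norm_num)
    positivity
  · have h4 : Real.log 3 ≤ Real.log n := Real.log_le_log (by norm_num) (by exact_mod_cast hn)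
    have h5 : y ≤ Real.log (Real.log n) := Real.log_le_log (by linarith) h4
    have h6 : (2 : ℝ) ^ κ ≤ 6 * Real.log n := by
      have h7 : (2 : ℝ) ^ κ ≤ 2 * ((Nat.log 2 n + 1 : ℕ) : ℝ) := by exact_mod_cast hκ
      have := log_two_add_one_le (by omega : 2 ≤ n)
      linarith
    have h7 := Real.log_le_log (by positivity) h6
    rw [Real.log_pow, Real.log_mul (by norm_num) (by linarith)] at h7
    rw [div_mul_eq_mul_div, le_div_iff₀ hl2]
    refine h7.trans ?_
    rw [add_mul, one_mul]
    refine add_le_add ?_ le_rfl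
    rw [div_mul_eq_mul_div, le_div_iff₀ hy]
    exact mul_le_mul_of_nonneg_left h5 (Real.log_nonneg (by norm_num))

/-- The upper bound for the limiting smoothness. -/
theorem IsFrolovRoots.worstCaseError_le_of_eq (hξ : IsFrolovRoots ξ) (hd : 1 ≤ d) (Ψ : Kernels L)
    (hp : 1 ≤ p) (hθ : 1 ≤ θ) (hs : 1 / p < s) (hsθ : s = (θ⁻¹).toReal) :
    ∃ C : ℝ, 0 < C ∧ ∀ n : ℕ, 3 ≤ n → worstCaseError ξ n Ψ s p θ ≤
      ENNReal.ofReal (C * ((n : ℝ) ^ (-s) * Real.log n ^ (((d : ℝ) - 1) * (1 - s)) *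
        Real.log (Real.log n) ^ (1 - s))) := by
  obtain ⟨K, J₀, hK, h⟩ := hξ.exists_ruleError_le_split hd Ψ hp hθ hs hsθ.le
  obtain ⟨K₂, hK₂, h2⟩ := Ψ.exists_sum_weight_mul_levelNorm_le d hp
  obtain ⟨A, hA, hlog2⟩ := exists_clog_le_loglog
  have hp0 : 0 < 1 / p := by positivity
  have hs0 : 0 < s := hp0.trans hs
  have hs1 : s ≤ 1 := by
    rw [hsθ]
    exact inv_toReal_le_one hθ
  rw [← hsθ] at h
  have hd0 := dim_sub_one_nonneg hd
  have hdc : ((d - 1 : ℕ) : ℝ) = (d : ℝ) - 1 := by rw [Nat.cast_sub hd, Nat.cast_one]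
  have hq : 1 ≤ 1 / s := by rwa [one_le_div hs0]
  have hqp : 1 / s ≤ p := by
    rw [div_le_iff₀ hs0]
    calc (1 : ℝ) = p * (1 / p) := by field_simp
      _ ≤ p * s := by gcongr
  set β := ((d : ℝ) - 1) * (1 - s) with hβdef
  have hβ : 0 ≤ β := mul_nonneg hd0 (by linarith)
  set B : ℝ := (d : ℝ) ^ (1 - s) * (d : ℝ) ^ β
  set K' := K * (K₂ * ENNReal.ofReal B + 1)
  have hK' : K' ≠ ⊤ := by
    have : K₂ * ENNReal.ofReal B ≠ ⊤ := ENNReal.mul_ne_top hK₂ ENNReal.ofReal_ne_top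
    finiteness
  refine ⟨(K'.toReal + 1) * (3 ^ β * A ^ (1 - s)), by positivity, fun n hn => worstCaseError_le Ψ
    fun f hf hF => ?_⟩
  set M := Nat.log 2 n + 1 with hM
  have hM2 : 2 ≤ M := by
    have : 0 < Nat.log 2 n := Nat.log_pos (by norm_num) (by omega)
    omega
  obtain ⟨κ, hκ0, hκ1, hκ2, hκ3⟩ := exists_clog hM2
  have hM0 : (0 : ℝ) < M := by positivity
  refine (h f hf hF n (by omega) M κ hM hκ1 hκ2).trans ?_
  set J := (d - 1) * κ with hJ
  -- For `s = 1/θ` the geometric weights equal one, and all levels of the block are treated as a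
  -- single set of indices. The power `1 - s` then falls on the number of levels as well, which
  -- gives `κ^{1-s}` where adding the levels separately would give `κ`.
  have hblock : ∑ j ∈ Finset.range J, ENNReal.ofReal (2 ^ ((s - s) * j)) *
      ∑ m ∈ levelSet d (Nat.log 2 n - J₀ + j), weight s m * Ψ.levelNorm (1 / s) f m ≤
      K₂ * ENNReal.ofReal B * ENNReal.ofReal ((M : ℝ) ^ β * (κ : ℝ) ^ (1 - s)) := by
    have hdisj : (↑(Finset.range J) : Set ℕ).PairwiseDisjoint
        fun j => levelSet d (Nat.log 2 n - J₀ + j) := by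
      intro j _ j' _ hne
      refine Finset.disjoint_left.2 fun m hm hm' => hne ?_
      rw [mem_levelSet] at hm hm'
      omega
    set S := (Finset.range J).biUnion fun j => levelSet d (Nat.log 2 n - J₀ + j)
    have hcard : S.card ≤ J * (M + J) ^ (d - 1) := by
      refine Finset.card_biUnion_le.trans ?_
      refine (Finset.sum_le_card_nsmul _ _ ((M + J) ^ (d - 1)) fun j hj => ?_).trans
        (by rw [Finset.card_range, smul_eq_mul])
      have := Finset.mem_range.1 hj
      exact (card_levelSet_le hd _).trans (Nat.pow_le_pow_left (by omega) _)
    have e0 := h2 f hf s (1 / s) θ hq hqp hθ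
      (by rw [← hsθ, one_div_mul_cancel hs0.ne']) S
    rw [← hsθ, Finset.sum_biUnion hdisj] at e0
    simp only [sub_self, zero_mul, Real.rpow_zero, ENNReal.ofReal_one, one_mul]
    refine e0.trans ((mul_le_mul_right hF _).trans ?_)
    rw [mul_one, mul_assoc, ← ENNReal.ofReal_mul (by positivity), ← ENNReal.ofReal_natCast,
      ENNReal.ofReal_rpow_of_nonneg (by positivity) (by linarith)]
    refine mul_le_mul_right (ENNReal.ofReal_le_ofReal ?_) _
    have e1 : (S.card : ℝ) ≤ (d * κ) * ((d : ℝ) * M) ^ ((d : ℝ) - 1) := by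
      have e4 : ((M + J : ℕ) : ℝ) ≤ d * M := by exact_mod_cast add_sub_one_mul_le hd hκ2
      have e5 : (J : ℝ) ≤ d * κ := by
        have : J ≤ d * κ := Nat.mul_le_mul_right _ (Nat.sub_le _ _)
        exact_mod_cast this
      calc (S.card : ℝ) ≤ (J : ℝ) * ((M + J : ℕ) : ℝ) ^ (d - 1) := by exact_mod_cast hcard
        _ ≤ (d * κ) * ((d : ℝ) * M) ^ (d - 1) := by gcongr
        _ = _ := by rw [← hdc, Real.rpow_natCast]
    calc (S.card : ℝ) ^ (1 - s) ≤ ((d * κ) * ((d : ℝ) * M) ^ ((d : ℝ) - 1)) ^ (1 - s) :=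
          Real.rpow_le_rpow (by positivity) e1 (by linarith)
      _ = _ := by
          rw [Real.mul_rpow (by positivity) (by positivity),
            Real.mul_rpow (by positivity) (by positivity), ← Real.rpow_mul (by positivity),
            ← hβdef, Real.mul_rpow (by positivity) (by positivity)]
          simp only [B]
          ring
  have hlog : 0 ≤ Real.log n := Real.log_natCast_nonneg n
  have hκr : (κ : ℝ) ≤ A * Real.log (Real.log n) := hlog2 n κ hn hκ3
  have hκ1' : (1 : ℝ) ≤ κ := by exact_mod_cast hκ0
  have hll : 0 ≤ Real.log (Real.log n) := by
    by_contra hneg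
    push Not at hneg
    have := mul_neg_of_pos_of_neg hA hneg
    linarith
  calc _ ≤ K * ENNReal.ofReal ((n : ℝ) ^ (-s)) *
        (K₂ * ENNReal.ofReal B * ENNReal.ofReal ((M : ℝ) ^ β * (κ : ℝ) ^ (1 - s)) +
          ENNReal.ofReal ((M : ℝ) ^ β * (κ : ℝ) ^ (1 - s))) := by
        refine mul_le_mul_right (add_le_add hblock (ENNReal.ofReal_le_ofReal ?_)) _
        exact le_mul_of_one_le_right (by positivity) (Real.one_le_rpow hκ1' (by linarith))
    _ = K' * ENNReal.ofReal ((n : ℝ) ^ (-s) * ((M : ℝ) ^ β * (κ : ℝ) ^ (1 - s))) := by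
        rw [ENNReal.ofReal_mul (p := (n : ℝ) ^ (-s)) (by positivity)]
        simp only [K']
        ring
    _ ≤ _ := mul_ofReal_le hK' _
    _ ≤ _ := by
        refine ENNReal.ofReal_le_ofReal ?_
        have e1 : (M : ℝ) ^ β ≤ 3 ^ β * Real.log n ^ β := by
          rw [← Real.mul_rpow (by norm_num) hlog]
          exact Real.rpow_le_rpow (by positivity) (log_two_add_one_le (by omega)) hβ
        have e2 : (κ : ℝ) ^ (1 - s) ≤ A ^ (1 - s) * Real.log (Real.log n) ^ (1 - s) := by
          rw [← Real.mul_rpow hA.le hll]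
          exact Real.rpow_le_rpow (by positivity) hκr (by linarith)
        calc _ ≤ (K'.toReal + 1) * ((n : ℝ) ^ (-s) * (3 ^ β * Real.log n ^ β *
              (A ^ (1 - s) * Real.log (Real.log n) ^ (1 - s)))) := by gcongr
          _ = _ := by ring

end UpperBounds

/-! ### A bump function and Taylor polynomials. -/

section Bump

/-- A smooth bump supported in `(0, 1)`. -/
def bumpBase : ContDiffBump (1 / 2 : ℝ) := ⟨1 / 8, 1 / 4, by norm_num, by norm_num⟩

/-- The bump as a complex-valued function. -/
def bump (t : ℝ) : ℂ := ((bumpBase t : ℝ) : ℂ)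

theorem contDiff_bump : ContDiff ℝ ∞ bump := Complex.ofRealCLM.contDiff.comp bumpBase.contDiff

theorem hasCompactSupport_bump : HasCompactSupport bump :=
  bumpBase.hasCompactSupport.comp_left Complex.ofReal_zero

theorem norm_bump (t : ℝ) : ‖bump t‖ = bumpBase t := by
  rw [bump, Complex.norm_real, Real.norm_of_nonneg bumpBase.nonneg]

theorem norm_bump_le_one (t : ℝ) : ‖bump t‖ ≤ 1 := by
  rw [norm_bump]
  exact bumpBase.le_one

theorem mem_of_bump_ne_zero {t : ℝ} (h : bump t ≠ 0) : 0 < t ∧ t < 1 := by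
  have h1 : t ∈ Function.support bumpBase := fun h0 => h (by rw [bump, h0, Complex.ofReal_zero])
  rw [bumpBase.support_eq, Metric.mem_ball, Real.dist_eq, abs_lt] at h1
  have h2 : bumpBase.rOut = 1 / 4 := rfl
  rw [h2] at h1
  constructor <;> linarith [h1.1, h1.2]

theorem exists_norm_iteratedDeriv_bump_le (n : ℕ) : ∃ M, 0 ≤ M ∧ ∀ t, ‖iteratedDeriv n bump t‖ ≤ M := by
  obtain ⟨B, hB, h⟩ := exists_weighted_bound (hasCompactSupport_bump.toSchwartzMap contDiff_bump) 0 n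
  refine ⟨B, hB, fun t => ?_⟩
  have h1 := h t
  rw [pow_zero, one_mul, norm_iteratedFDeriv_eq_norm_iteratedDeriv] at h1
  exact h1

/-- Taylor polynomials. -/
theorem exists_taylor (n : ℕ) {M : ℝ} : ∀ {g : ℝ → ℂ}, ContDiff ℝ ∞ g →
    (∀ t, ‖iteratedDeriv n g t‖ ≤ M) → ∀ y : ℝ, ∃ c : ℕ → ℂ, ∀ h : ℝ,
      ‖g (y + h) - ∑ α ∈ Finset.range n, c α * (h : ℂ) ^ α‖ ≤ M * |h| ^ n := by
  induction n with
  | zero =>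
    intro g _ hM y
    refine ⟨0, fun h => ?_⟩
    simpa using hM (y + h)
  | succ n ih =>
    intro g hg hM y
    have hg' : ContDiff ℝ ∞ (deriv g) := (contDiff_infty_iff_deriv.1 hg).2
    have hgd : Differentiable ℝ g := (contDiff_infty_iff_deriv.1 hg).1
    have hM0 : 0 ≤ M := (norm_nonneg _).trans (hM 0)
    obtain ⟨c, hc⟩ := ih hg' (fun t => by rw [← iteratedDeriv_succ']; exact hM t) y
    -- The coefficients are those of the antiderivative of the polynomial for `deriv g` with
    -- constant term `g y`. The derivative of the remainder is thus the remainder of `deriv g`, and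
    -- the mean value inequality adds one power of `|h|`.
    refine ⟨fun α => Nat.casesOn α (g y) fun β => c β / (β + 1), fun h => ?_⟩
    set G : ℝ → ℂ := fun h => g (y + h) -
      ∑ α ∈ Finset.range (n + 1), (Nat.casesOn α (g y) fun β => c β / (β + 1) : ℂ) * (h : ℂ) ^ α
      with hG
    have hder : ∀ r : ℝ, HasDerivAt G
        (deriv g (y + r) - ∑ α ∈ Finset.range n, c α * (r : ℂ) ^ α) r := by
      intro r
      have h1 : HasDerivAt (fun r => g (y + r)) (deriv g (y + r)) r :=
        (hgd (y + r)).hasDerivAt.comp_const_add y r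
      have h2 : ∀ α : ℕ, HasDerivAt (fun r : ℝ => c α / ((α : ℂ) + 1) * (r : ℂ) ^ (α + 1))
          (c α * (r : ℂ) ^ α) r := by
        intro α
        have h3 := ((hasDerivAt_pow (α + 1) (r : ℂ)).comp_ofReal).const_mul (c α / ((α : ℂ) + 1))
        refine h3.congr_deriv ?_
        have : (α : ℂ) + 1 ≠ 0 := by exact_mod_cast Nat.succ_ne_zero α
        push_cast
        field_simp
      have h4 := HasDerivAt.fun_sum (u := Finset.range n) fun α _ => h2 α
      have h5 : G = fun r => g (y + r) - ((∑ α ∈ Finset.range n,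
          c α / ((α : ℂ) + 1) * (r : ℂ) ^ (α + 1)) + g y) := by
        funext r
        rw [hG]
        simp only
        rw [Finset.sum_range_succ']
        simp
      rw [h5]
      exact h1.sub (h4.add_const _)
    have h0 : G 0 = 0 := by
      rw [hG]
      simp only
      rw [Finset.sum_range_succ']
      simp
    have hmem : h ∈ Set.Icc (-|h|) |h| := ⟨neg_abs_le h, le_abs_self h⟩
    have h1 := (convex_Icc (-|h|) |h|).norm_image_sub_le_of_norm_hasDerivWithin_le
      (f := G) (C := M * |h| ^ n) (fun r _ => (hder r).hasDerivWithinAt) (fun r hr => ?_)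
      (⟨by simp, by simp⟩ : (0 : ℝ) ∈ Set.Icc (-|h|) |h|) hmem
    · rw [h0, sub_zero, sub_zero, Real.norm_eq_abs, mul_assoc, ← pow_succ] at h1
      exact h1
    · refine (hc r).trans ?_
      have := abs_le.2 hr
      gcongr

theorem card_le_of_abs_sub_le (F : Finset ℕ) {c r : ℝ} (hr : 0 ≤ r)
    (hF : ∀ k ∈ F, |(k : ℝ) - c| ≤ r) : (F.card : ℝ) ≤ 2 * r + 1 := by
  have h1 : F.card ≤ (Finset.Icc ⌈c - r⌉ ⌊c + r⌋).card := by
    refine Finset.card_le_card_of_injOn (fun k : ℕ => (k : ℤ)) (fun k hk => ?_)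
      (fun k _ k' _ h => Int.ofNat_inj.1 h)
    have h2 := abs_le.1 (hF k hk)
    rw [Finset.mem_coe, Finset.mem_Icc]
    constructor
    · rw [Int.ceil_le]
      push_cast
      linarith
    · rw [Int.le_floor]
      push_cast
      linarith
  rw [Int.card_Icc] at h1
  have h3 : ((F.card : ℕ) : ℝ) ≤ ((⌊c + r⌋ + 1 - ⌈c - r⌉).toNat : ℝ) := by exact_mod_cast h1
  have h4 : (((⌊c + r⌋ + 1 - ⌈c - r⌉).toNat : ℕ) : ℝ) = ((max (⌊c + r⌋ + 1 - ⌈c - r⌉) 0 : ℤ) : ℝ) := by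
    rw [← Int.toNat_eq_max]
    norm_cast
  rw [h4] at h3
  refine h3.trans ?_
  push_cast
  refine max_le ?_ (by linarith)
  linarith [Int.floor_le (c + r), Int.le_ceil (c - r)]

end Bump

/-! ### Local means of dilated and shifted bumps. -/

section LocalMeans

variable {L : ℕ}

/-- Up to the factor `(-2πi)^α`, the moment is the derivative of order `α` of the Fourier transform
at zero. -/
theorem Kernels.integral_pow_mul_psi1 (Ψ : Kernels L) {α : ℕ} (hα : α ≤ L) :
    ∫ t : ℝ, (t : ℂ) ^ α * Ψ.psi1 t = 0 := by
  have hint : ∀ n : ℕ, (n : ℕ∞) ≤ (⊤ : ℕ∞) → Integrable (fun x : ℝ => x ^ n • Ψ.psi1 x) := by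
    intro n _
    have hψ := Ψ.contDiff_psi1.continuous
    have hc : Continuous fun x : ℝ => x ^ n • Ψ.psi1 x := (continuous_pow n).smul hψ
    refine hc.integrable_of_hasCompactSupport (Ψ.hasCompactSupport_psi1.mono fun x hx h0 => hx ?_)
    change x ^ n • Ψ.psi1 x = 0
    rw [h0, smul_zero]
  have h1 := congrFun (Real.iteratedDeriv_fourier hint (n := α) le_top) 0
  rw [Ψ.moments α hα, Real.fourier_eq'] at h1
  simp only [inner_zero_right, mul_zero, Complex.ofReal_zero, zero_mul, Complex.exp_zero,
    smul_eq_mul, one_mul, mul_pow, mul_assoc] at h1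
  simp_rw [← mul_assoc] at h1
  have h2 : (((-2 : ℂ) ^ α * (Real.pi : ℂ) ^ α * Complex.I ^ α)) ≠ 0 := by
    have := Complex.I_ne_zero
    have := Real.pi_ne_zero
    simp [this]
  have h3 : ∀ v : ℝ, (-2 : ℂ) ^ α * (Real.pi : ℂ) ^ α * Complex.I ^ α * (v : ℂ) ^ α * Ψ.psi1 v =
      ((-2 : ℂ) ^ α * (Real.pi : ℂ) ^ α * Complex.I ^ α) * ((v : ℂ) ^ α * Ψ.psi1 v) := by
    intro v
    ring
  simp_rw [h3] at h1
  rw [integral_const_mul] at h1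
  exact (mul_eq_zero.1 h1.symm).resolve_left h2

/-- The local mean of a dilated and shifted bump. -/
def Kernels.bumpMean (Ψ : Kernels L) (j μ k : ℕ) (x : ℝ) : ℂ :=
  ∫ t, Ψ.psi j (x - t) * bump (2 ^ μ * t - k)

/-- The substitution `r = 2^j (x - t)` puts the scale into the bump, whose argument now varies by
the small amount `2^{μ-j} r` when `j > μ`. -/
theorem Kernels.bumpMean_succ (Ψ : Kernels L) (j μ k : ℕ) (x : ℝ) :
    Ψ.bumpMean (j + 1) μ k x =
      ∫ r, Ψ.psi1 r * bump ((2 ^ μ * x - k) + -(2 ^ μ / 2 ^ j * r)) := by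
  rw [bumpMean]
  have h1 := integral_sub_left_eq_self (fun t => Ψ.psi (j + 1) (x - t) * bump (2 ^ μ * t - k))
    volume x
  have h2 := Measure.integral_comp_mul_left
    (fun r => Ψ.psi1 r * bump ((2 ^ μ * x - k) + -(2 ^ μ / 2 ^ j * r))) ((2 : ℝ) ^ j)
  rw [← h1]
  have h3 : ∀ t, Ψ.psi (j + 1) (x - (x - t)) * bump (2 ^ μ * (x - t) - k) =
      (((2 : ℝ) ^ j : ℝ) : ℂ) * (Ψ.psi1 (2 ^ j * t) *
        bump ((2 ^ μ * x - k) + -(2 ^ μ / 2 ^ j * (2 ^ j * t)))) := by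
    intro t
    rw [sub_sub_cancel]
    have h4 : 2 ^ μ * (x - t) - k = (2 ^ μ * x - k) + -(2 ^ μ / 2 ^ j * (2 ^ j * t)) := by
      field_simp
      ring
    rw [h4, psi, Complex.ofReal_pow]
    push_cast
    ring
  simp_rw [h3]
  rw [integral_const_mul, h2, abs_of_pos (by positivity), Complex.real_smul, ← mul_assoc,
    ← Complex.ofReal_mul, mul_inv_cancel₀ (by positivity), Complex.ofReal_one, one_mul]

/-- Integer translates of the bump have disjoint supports, so only `k = ⌊y⌋` contributes. -/
theorem sum_norm_bump_le_one (F : Finset ℕ) (y : ℝ) : ∑ k ∈ F, ‖bump (y - k)‖ ≤ 1 := by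
  have h : ∀ k ∈ F, bump (y - k) ≠ 0 → k = ⌊y⌋₊ := by
    intro k _ hk
    have := mem_of_bump_ne_zero hk
    symm
    rw [Nat.floor_eq_iff (by linarith [(Nat.cast_nonneg k : (0 : ℝ) ≤ k)])]
    constructor <;> linarith
  by_cases h0 : ⌊y⌋₊ ∈ F
  · rw [Finset.sum_eq_single_of_mem _ h0 fun k hk hne => ?_]
    · exact norm_bump_le_one _
    · by_contra hc
      exact hne (h k hk (norm_ne_zero_iff.1 hc))
  · rw [Finset.sum_eq_zero fun k hk => ?_]
    · norm_num
    · by_contra hc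
      exact h0 (h k hk (norm_ne_zero_iff.1 hc) ▸ hk)

theorem Kernels.integral_norm_psi_le (Ψ : Kernels L) (j : ℕ) :
    ∫ t, ‖Ψ.psi j t‖ ≤ (∫ t, ‖Ψ.psi0 t‖) + ∫ t, ‖Ψ.psi1 t‖ := by
  have h0 : 0 ≤ ∫ t, ‖Ψ.psi0 t‖ := integral_nonneg fun t => norm_nonneg _
  have h1 : 0 ≤ ∫ t, ‖Ψ.psi1 t‖ := integral_nonneg fun t => norm_nonneg _
  cases j with
  | zero =>
    change ∫ t, ‖Ψ.psi0 t‖ ≤ _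
    linarith
  | succ j =>
    have h2 : ∀ t, ‖Ψ.psi (j + 1) t‖ = 2 ^ j * ‖Ψ.psi1 (2 ^ j * t)‖ := by
      intro t
      rw [psi, norm_mul, norm_pow]
      simp
    simp_rw [h2]
    rw [integral_const_mul, Measure.integral_comp_mul_left (fun t => ‖Ψ.psi1 t‖),
      abs_of_pos (by positivity), smul_eq_mul, mul_inv_cancel_left₀ (by positivity)]
    linarith

theorem Kernels.sum_norm_bumpMean_le (Ψ : Kernels L) (j μ : ℕ) (F : Finset ℕ) (x : ℝ) :
    ∑ k ∈ F, ‖Ψ.bumpMean j μ k x‖ ≤ (∫ t, ‖Ψ.psi0 t‖) + ∫ t, ‖Ψ.psi1 t‖ := by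
  have hψ := (Ψ.contDiff_psi j).continuous
  have hb := contDiff_bump.continuous
  have hcs : HasCompactSupport fun t => Ψ.psi j (x - t) :=
    (Ψ.hasCompactSupport_psi j).comp_homeomorph (Homeomorph.subLeft x)
  have hint : ∀ k : ℕ, Integrable fun t => Ψ.psi j (x - t) * bump (2 ^ μ * t - k) := fun k =>
    Continuous.integrable_of_hasCompactSupport (by fun_prop) hcs.mul_right
  have hint2 : Integrable fun t => Ψ.psi j (x - t) :=
    Continuous.integrable_of_hasCompactSupport (by fun_prop) hcs
  calc ∑ k ∈ F, ‖Ψ.bumpMean j μ k x‖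
      ≤ ∑ k ∈ F, ∫ t, ‖Ψ.psi j (x - t) * bump (2 ^ μ * t - k)‖ :=
        Finset.sum_le_sum fun k _ => norm_integral_le_integral_norm _
    _ = ∫ t, ∑ k ∈ F, ‖Ψ.psi j (x - t) * bump (2 ^ μ * t - k)‖ :=
        (integral_finsetSum _ fun k _ => (hint k).norm).symm
    _ ≤ ∫ t, ‖Ψ.psi j (x - t)‖ := by
        refine integral_mono (integrable_finsetSum _ fun k _ => (hint k).norm) hint2.norm
          fun t => ?_
        simp only [norm_mul]
        rw [← Finset.mul_sum]
        exact mul_le_of_le_one_right (norm_nonneg _) (sum_norm_bump_le_one F _)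
    _ = ∫ t, ‖Ψ.psi j t‖ := integral_sub_left_eq_self (fun t => ‖Ψ.psi j t‖) volume x
    _ ≤ _ := Ψ.integral_norm_psi_le j

/-- The moments of `psi1` up to order `L` annihilate the Taylor polynomial of the bump of degree
`L`; the remainder is of order `L + 1` in `2^{μ-j} r`. -/
theorem Kernels.norm_bumpMean_succ_le (Ψ : Kernels L) {M : ℝ}
    (hM : ∀ t, ‖iteratedDeriv (L + 1) bump t‖ ≤ M) (j μ k : ℕ) (x : ℝ) :
    ‖Ψ.bumpMean (j + 1) μ k x‖ ≤
      M * (2 ^ μ / 2 ^ j) ^ (L + 1) * ∫ r, |r| ^ (L + 1) * ‖Ψ.psi1 r‖ := by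
  obtain ⟨c, hc⟩ := exists_taylor (L + 1) contDiff_bump hM (2 ^ μ * x - k)
  set a : ℝ := 2 ^ μ / 2 ^ j with ha
  have ha0 : 0 ≤ a := by positivity
  have hψ := Ψ.contDiff_psi1.continuous
  have hb := contDiff_bump.continuous
  have hcs := Ψ.hasCompactSupport_psi1
  have hint1 : Integrable fun r => Ψ.psi1 r * bump ((2 ^ μ * x - k) + -(a * r)) :=
    Continuous.integrable_of_hasCompactSupport (by fun_prop) hcs.mul_right
  have hint2 : ∀ α : ℕ, Integrable fun r : ℝ => Ψ.psi1 r * (c α * ((-(a * r) : ℝ) : ℂ) ^ α) :=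
    fun α => Continuous.integrable_of_hasCompactSupport (by fun_prop) hcs.mul_right
  have hzero : ∀ α ∈ Finset.range (L + 1),
      ∫ r : ℝ, Ψ.psi1 r * (c α * ((-(a * r) : ℝ) : ℂ) ^ α) = 0 := by
    intro α hα
    have h1 : ∀ r : ℝ, Ψ.psi1 r * (c α * ((-(a * r) : ℝ) : ℂ) ^ α) =
        (c α * (-a : ℂ) ^ α) * ((r : ℂ) ^ α * Ψ.psi1 r) := by
      intro r
      have : ((-(a * r) : ℝ) : ℂ) = (-a : ℂ) * r := by push_cast; ring
      rw [this, mul_pow]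
      ring
    simp_rw [h1]
    rw [integral_const_mul, Ψ.integral_pow_mul_psi1 (by have := Finset.mem_range.1 hα; omega),
      mul_zero]
  have h2 : Ψ.bumpMean (j + 1) μ k x = ∫ r, Ψ.psi1 r * (bump ((2 ^ μ * x - k) + -(a * r)) -
      ∑ α ∈ Finset.range (L + 1), c α * ((-(a * r) : ℝ) : ℂ) ^ α) := by
    simp_rw [mul_sub, Finset.mul_sum]
    rw [integral_sub hint1 (integrable_finsetSum _ fun α _ => hint2 α),
      integral_finsetSum _ fun α _ => hint2 α, Finset.sum_eq_zero hzero, sub_zero,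
      Ψ.bumpMean_succ]
  have hint3 : Integrable fun r : ℝ => M * a ^ (L + 1) * (|r| ^ (L + 1) * ‖Ψ.psi1 r‖) := by
    refine Integrable.const_mul ?_ _
    exact Continuous.integrable_of_hasCompactSupport (by fun_prop) hcs.norm.mul_left
  rw [h2, ← integral_const_mul]
  refine norm_integral_le_of_norm_le hint3 (Filter.Eventually.of_forall fun r => ?_)
  rw [norm_mul]
  refine (mul_le_mul_of_nonneg_left (hc _) (norm_nonneg _)).trans (le_of_eq ?_)
  rw [abs_neg, abs_mul, abs_of_nonneg ha0, mul_pow]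
  ring

/-- For `j ≤ μ` the truncated exponent is zero and disjointness of the bumps suffices. For `j > μ`
the moment bound applies to each term, and the compact support of `psi1` leaves only boundedly many
`k`. -/
theorem Kernels.exists_sum_norm_bumpMean_le (Ψ : Kernels L) : ∃ C : ℝ, 0 ≤ C ∧
    ∀ (j μ : ℕ) (F : Finset ℕ) (x : ℝ),
      ∑ k ∈ F, ‖Ψ.bumpMean j μ k x‖ ≤ C * ((2 : ℝ) ^ (L + 1))⁻¹ ^ (j - μ) := by
  obtain ⟨M, hM0, hM⟩ := exists_norm_iteratedDeriv_bump_le (L + 1)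
  obtain ⟨R, hR⟩ := Ψ.hasCompactSupport_psi1.isCompact.isBounded.exists_norm_le
  set A : ℝ := (∫ t, ‖Ψ.psi0 t‖) + ∫ t, ‖Ψ.psi1 t‖
  have hA : 0 ≤ A := add_nonneg (integral_nonneg fun t => norm_nonneg _)
    (integral_nonneg fun t => norm_nonneg _)
  set I : ℝ := ∫ r, |r| ^ (L + 1) * ‖Ψ.psi1 r‖
  have hI : 0 ≤ I := integral_nonneg fun t => by positivity
  set B : ℝ := (2 * (1 + 2 * |R|) + 1) * (M * 2 ^ (L + 1) * I)
  have hB : 0 ≤ B := by positivity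
  refine ⟨A + B, by positivity, fun j μ F x => ?_⟩
  by_cases hj : j ≤ μ
  · rw [Nat.sub_eq_zero_of_le hj, pow_zero, mul_one]
    exact (Ψ.sum_norm_bumpMean_le j μ F x).trans (by linarith)
  · push Not at hj
    obtain ⟨i, rfl⟩ : ∃ i, j = i + 1 := ⟨j - 1, by omega⟩
    have ha : (2 : ℝ) ^ μ / 2 ^ i ≤ 1 := by
      rw [div_le_one (by positivity)]
      exact pow_le_pow_right₀ (by norm_num) (by omega)
    have ha0 : (0 : ℝ) ≤ 2 ^ μ / 2 ^ i := by positivity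
    have hpow : ((2 : ℝ) ^ μ / 2 ^ i) ^ (L + 1) =
        2 ^ (L + 1) * ((2 : ℝ) ^ (L + 1))⁻¹ ^ (i + 1 - μ) := by
      have h1 : (2 : ℝ) ^ μ / 2 ^ i = 2 * (2 ^ (i + 1 - μ))⁻¹ := by
        have : (2 : ℝ) ^ (i + 1) = 2 ^ (i + 1 - μ) * 2 ^ μ := by
          rw [← pow_add]
          congr 1
          omega
        rw [pow_succ] at this
        field_simp
        linarith
      rw [h1, mul_pow, inv_pow, inv_pow, ← pow_mul, ← pow_mul, mul_comm (i + 1 - μ)]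
    classical
    set F' := F.filter fun k => Ψ.bumpMean (i + 1) μ k x ≠ 0
    have h1 : ∑ k ∈ F, ‖Ψ.bumpMean (i + 1) μ k x‖ = ∑ k ∈ F', ‖Ψ.bumpMean (i + 1) μ k x‖ := by
      refine (Finset.sum_filter_of_ne fun k _ hk => ?_).symm
      exact norm_ne_zero_iff.1 hk
    have hcard : (F'.card : ℝ) ≤ 2 * (1 + 2 * |R|) + 1 := by
      refine card_le_of_abs_sub_le F' (c := 2 ^ μ * x) (by positivity) fun k hk => ?_
      have h2 := (Finset.mem_filter.1 hk).2
      rw [Ψ.bumpMean_succ] at h2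
      obtain ⟨r, hr⟩ : ∃ r, Ψ.psi1 r * bump ((2 ^ μ * x - k) + -(2 ^ μ / 2 ^ i * r)) ≠ 0 := by
        by_contra! h
        simp_rw [h] at h2
        simp at h2
      have h3 := hR r (subset_tsupport _ (left_ne_zero_of_mul hr))
      have h4 := mem_of_bump_ne_zero (right_ne_zero_of_mul hr)
      have h5 : |2 ^ μ / 2 ^ i * r| ≤ |R| := by
        rw [abs_mul, abs_of_nonneg ha0]
        exact (mul_le_of_le_one_left (abs_nonneg r) ha).trans (h3.trans (le_abs_self R))
      have h6 := abs_le.1 h5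
      rw [abs_le]
      constructor <;> linarith [h4.1, h4.2, abs_nonneg R]
    rw [h1]
    calc ∑ k ∈ F', ‖Ψ.bumpMean (i + 1) μ k x‖
        ≤ F'.card • (M * (2 ^ μ / 2 ^ i) ^ (L + 1) * I) :=
          Finset.sum_le_card_nsmul _ _ _ fun k _ => Ψ.norm_bumpMean_succ_le hM i μ k x
      _ ≤ (2 * (1 + 2 * |R|) + 1) * (M * (2 ^ μ / 2 ^ i) ^ (L + 1) * I) := by
          rw [nsmul_eq_mul]
          gcongr
      _ = B * ((2 : ℝ) ^ (L + 1))⁻¹ ^ (i + 1 - μ) := by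
          rw [hpow]
          simp only [B]
          ring
      _ ≤ _ := by
          refine mul_le_mul_of_nonneg_right (by linarith) (by positivity)

end LocalMeans

/-! ### Geometric weights and sequence norms. -/

section ProductSums

variable {d : ℕ}

/-- Interpolation between the supremum and the sum: `a^θ ≤ A^{θ-1} a`. -/
theorem seqNorm_le_of_tsum_le {ι : Type*} {θ : ℝ≥0∞} (h1 : 1 ≤ θ) {a : ι → ℝ≥0∞} {A N : ℝ≥0∞}
    (hA : ∀ j, a j ≤ A) (hN : ∑' j, a j ≤ A * N) : seqNorm θ a ≤ A * N ^ (θ⁻¹).toReal := by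
  by_cases hθ : θ = ⊤
  · rw [hθ, seqNorm_top, ENNReal.inv_top, ENNReal.toReal_zero, ENNReal.rpow_zero, mul_one]
    exact iSup_le hA
  · have ht := one_le_toReal h1 hθ
    have h0 : 0 < θ.toReal := by linarith
    rw [← ENNReal.rpow_le_rpow_iff h0, seqNorm_rpow h1 hθ,
      ENNReal.mul_rpow_of_nonneg _ _ h0.le, ← ENNReal.rpow_mul, ENNReal.toReal_inv,
      inv_mul_cancel₀ h0.ne', ENNReal.rpow_one]
    have hsplit : ∀ x : ℝ≥0∞, x ^ θ.toReal = x ^ (θ.toReal - 1) * x := by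
      intro x
      conv_lhs => rw [show θ.toReal = (θ.toReal - 1) + 1 by ring]
      rw [ENNReal.rpow_add_of_nonneg _ _ (by linarith) zero_le_one, ENNReal.rpow_one]
    calc ∑' j, a j ^ θ.toReal ≤ ∑' j, A ^ (θ.toReal - 1) * a j := by
          refine ENNReal.tsum_le_tsum fun j => ?_
          rw [hsplit]
          exact mul_le_mul_left (ENNReal.rpow_le_rpow (hA j) (by linarith)) _
      _ = A ^ (θ.toReal - 1) * ∑' j, a j := ENNReal.tsum_mul_left
      _ ≤ A ^ (θ.toReal - 1) * (A * N) := mul_le_mul_right hN _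
      _ = _ := by rw [← mul_assoc, ← hsplit]

theorem tsum_prod_le {g : Fin d → ℕ → ℝ≥0∞} {W : ℝ≥0∞} (h : ∀ i, ∑' j, g i j ≤ W) :
    ∑' m : Fin d → ℕ, ∏ i, g i (m i) ≤ W ^ d := by
  rw [ENNReal.tsum_eq_iSup_sum' (indexBox d) fun t =>
    ((tendsto_indexBox d).eventually_ge_atTop t).exists]
  refine iSup_le fun M => ?_
  rw [indexBox, Finset.sum_prod_piFinset]
  calc ∏ i, ∑ j ∈ Finset.range (M + 1), g i j ≤ ∏ _i : Fin d, W :=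
        Finset.prod_le_prod' fun i _ => (ENNReal.sum_le_tsum _).trans (h i)
    _ = W ^ d := by simp

/-- The two-sided geometric weight `ρ^{|j - μ|}`. -/
def geomWeight (ρ : ℝ) (j μ : ℕ) : ℝ := ρ ^ ((j - μ) + (μ - j))

theorem geomWeight_comm (ρ : ℝ) (j μ : ℕ) : geomWeight ρ j μ = geomWeight ρ μ j := by
  rw [geomWeight, geomWeight, add_comm]

theorem tsum_geomWeight_le {ρ : ℝ} (h0 : 0 ≤ ρ) (h1 : ρ < 1) (μ : ℕ) :
    ∑' j, ENNReal.ofReal (geomWeight ρ j μ) ≤ ENNReal.ofReal (2 * (1 - ρ)⁻¹) := by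
  have hgeo : ∑' j : ℕ, ENNReal.ofReal (ρ ^ j) = ENNReal.ofReal (1 - ρ)⁻¹ := by
    rw [← ENNReal.ofReal_tsum_of_nonneg (fun j => pow_nonneg h0 j)
      (summable_geometric_of_lt_one h0 h1), tsum_geometric_of_lt_one h0 h1]
  have h2 : 0 ≤ (1 - ρ)⁻¹ := inv_nonneg.2 (by linarith)
  have hhead : ∑ j ∈ Finset.range μ, ENNReal.ofReal (geomWeight ρ j μ) ≤
      ∑' j : ℕ, ENNReal.ofReal (ρ ^ j) := by
    rw [← Finset.sum_range_reflect (fun j => ENNReal.ofReal (geomWeight ρ j μ)) μ]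
    refine le_trans (Finset.sum_le_sum fun j hj => ?_)
      (ENNReal.sum_le_tsum (f := fun j : ℕ => ENNReal.ofReal (ρ ^ j)) (Finset.range μ))
    have := Finset.mem_range.1 hj
    exact ENNReal.ofReal_le_ofReal (pow_le_pow_of_le_one h0 h1.le (by omega))
  have htail : ∑' j : ℕ, ENNReal.ofReal (geomWeight ρ (j + μ) μ) =
      ∑' j : ℕ, ENNReal.ofReal (ρ ^ j) := by
    refine tsum_congr fun j => ?_
    rw [geomWeight, show j + μ - μ + (μ - (j + μ)) = j by omega]
  have hsplit := Summable.sum_add_tsum_nat_add' (f := fun j => ENNReal.ofReal (geomWeight ρ j μ))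
    (k := μ) ENNReal.summable
  calc ∑' j, ENNReal.ofReal (geomWeight ρ j μ)
      = ∑ j ∈ Finset.range μ, ENNReal.ofReal (geomWeight ρ j μ) +
        ∑' j, ENNReal.ofReal (geomWeight ρ (j + μ) μ) := hsplit.symm
    _ ≤ ENNReal.ofReal (1 - ρ)⁻¹ + ENNReal.ofReal (1 - ρ)⁻¹ := by
        rw [htail, hgeo]
        exact add_le_add (hhead.trans hgeo.le) le_rfl
    _ = ENNReal.ofReal (2 * (1 - ρ)⁻¹) := by rw [two_mul, ENNReal.ofReal_add h2 h2]

/-- The product of the geometric weights. -/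
def geomProd (ρ : ℝ) (j m : Fin d → ℕ) : ℝ := ∏ i, geomWeight ρ (j i) (m i)

theorem geomProd_comm (ρ : ℝ) (j m : Fin d → ℕ) : geomProd ρ j m = geomProd ρ m j :=
  Finset.prod_congr rfl fun _ _ => geomWeight_comm ρ _ _

theorem geomProd_nonneg {ρ : ℝ} (h0 : 0 ≤ ρ) (j m : Fin d → ℕ) : 0 ≤ geomProd ρ j m :=
  Finset.prod_nonneg fun _ _ => pow_nonneg h0 _

theorem tsum_geomProd_le {ρ : ℝ} (h0 : 0 ≤ ρ) (h1 : ρ < 1) (m : Fin d → ℕ) :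
    ∑' j, ENNReal.ofReal (geomProd ρ j m) ≤ ENNReal.ofReal (2 * (1 - ρ)⁻¹) ^ d := by
  have h : ∀ j : Fin d → ℕ, ENNReal.ofReal (geomProd ρ j m) =
      ∏ i, ENNReal.ofReal (geomWeight ρ (j i) (m i)) := fun j =>
    ENNReal.ofReal_prod_of_nonneg fun i _ => pow_nonneg h0 _
  simp_rw [h]
  exact tsum_prod_le (g := fun i j => ENNReal.ofReal (geomWeight ρ j (m i)))
    fun i => tsum_geomWeight_le h0 h1 (m i)

/-- The weights are symmetric and summable in either index, uniformly in the other. The supremum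
over `j` is thus bounded independently of `S`, the sum over `j` costs a factor `#S`, and
interpolation leaves `(#S)^{1/θ}`. -/
theorem seqNorm_sum_geomProd_le {θ : ℝ≥0∞} (hθ : 1 ≤ θ) {ρ : ℝ} (h0 : 0 ≤ ρ) (h1 : ρ < 1)
    (S : Finset (Fin d → ℕ)) {K : ℝ≥0∞} {a : (Fin d → ℕ) → ℝ≥0∞}
    (ha : ∀ j, a j ≤ K * ∑ m ∈ S, ENNReal.ofReal (geomProd ρ j m)) :
    seqNorm θ a ≤ K * ENNReal.ofReal (2 * (1 - ρ)⁻¹) ^ d * (S.card : ℝ≥0∞) ^ (θ⁻¹).toReal := by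
  set W := ENNReal.ofReal (2 * (1 - ρ)⁻¹) ^ d
  refine seqNorm_le_of_tsum_le hθ (fun j => (ha j).trans (mul_le_mul_right ?_ _)) ?_
  · refine (ENNReal.sum_le_tsum S).trans ?_
    simp_rw [geomProd_comm ρ j]
    exact tsum_geomProd_le h0 h1 j
  · refine (ENNReal.tsum_le_tsum ha).trans ?_
    rw [ENNReal.tsum_mul_left, mul_assoc]
    refine mul_le_mul_right ?_ _
    rw [Summable.tsum_finsetSum fun m _ => ENNReal.summable]
    refine (Finset.sum_le_card_nsmul _ _ W fun m _ => tsum_geomProd_le h0 h1 m).trans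
      (le_of_eq ?_)
    rw [nsmul_eq_mul, mul_comm]

end ProductSums

/-! ### Sums of bumps over dyadic boxes and their norms. -/

section BumpSums

variable {L d : ℕ}

/-- The bump on the dyadic box with index `k` of level `m`. -/
def bumpBox (m k : Fin d → ℕ) : 𝓢(EuclideanSpace ℝ (Fin d), ℂ) :=
  tensorSchwartz (fun i t => bump (2 ^ m i * t - k i))
    (fun i => contDiff_bump.comp ((contDiff_const.mul contDiff_id).sub contDiff_const))
    fun i => show HasCompactSupport fun t => bump (2 ^ m i * t - k i) from
      hasCompactSupport_bump.comp_homeomorph ((Homeomorph.mulLeft₀ ((2 : ℝ) ^ m i)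
        (by positivity)).trans (Homeomorph.subRight (k i : ℝ)))

theorem bumpBox_apply (m k : Fin d → ℕ) (x : EuclideanSpace ℝ (Fin d)) :
    bumpBox m k x = ∏ i, bump (2 ^ m i * x i - k i) := rfl

/-- The indices of the dyadic boxes of level `m` in the unit cube. -/
def boxes (m : Fin d → ℕ) : Finset (Fin d → ℕ) := Fintype.piFinset fun i => Finset.range (2 ^ m i)

theorem card_boxes (m : Fin d → ℕ) : (boxes m).card = 2 ^ ∑ i, m i := by
  rw [boxes, Fintype.card_piFinset]
  simp only [Finset.card_range]
  rw [Finset.prod_pow_eq_pow_sum]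

theorem bumpBox_eq_zero {m k : Fin d → ℕ} (hk : k ∈ boxes m) {x : EuclideanSpace ℝ (Fin d)}
    (hx : x ∉ unitCube d) : bumpBox m k x = 0 := by
  by_contra h
  rw [bumpBox_apply] at h
  refine hx fun i => ?_
  have h1 := mem_of_bump_ne_zero ((Finset.prod_ne_zero_iff.1 h) i (Finset.mem_univ i))
  have h2 : k i < 2 ^ m i := Finset.mem_range.1 (Fintype.mem_piFinset.1 hk i)
  have h3 : ((k i : ℝ) + 1) ≤ 2 ^ m i := by exact_mod_cast h2
  have h4 : (0 : ℝ) < 2 ^ m i := by positivity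
  have h5 : (0 : ℝ) ≤ k i := Nat.cast_nonneg _
  constructor
  · by_contra hneg
    push Not at hneg
    nlinarith [h1.1]
  · by_contra hneg
    push Not at hneg
    nlinarith [h1.2]

theorem integral_bumpBox (m k : Fin d → ℕ) :
    ∫ x, bumpBox m k x = ((((2 : ℝ) ^ ∑ i, m i)⁻¹ * (∫ t, bumpBase t) ^ d : ℝ) : ℂ) := by
  simp_rw [bumpBox_apply]
  rw [integral_prod_coord (fun i t => bump (2 ^ m i * t - k i))]
  have h : ∀ i, ∫ t, bump (2 ^ m i * t - k i) =
      ((((2 : ℝ) ^ m i)⁻¹ * ∫ t, bumpBase t : ℝ) : ℂ) := by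
    intro i
    rw [Measure.integral_comp_mul_left (fun t => bump (t - k i)), integral_sub_right_eq_self,
      abs_of_pos (by positivity), Complex.real_smul, Complex.ofReal_mul]
    congr 1
    exact integral_ofReal
  simp_rw [h]
  rw [← Complex.ofReal_prod, Finset.prod_mul_distrib, Finset.prod_inv_distrib,
    Finset.prod_pow_eq_pow_sum]
  simp

/-- The sum of the bumps on the boxes with index in `A m`, over the levels `m` in `S`. -/
def bumpSum (S : Finset (Fin d → ℕ)) (A : (Fin d → ℕ) → Finset (Fin d → ℕ)) :
    𝓢(EuclideanSpace ℝ (Fin d), ℂ) := ∑ m ∈ S, ∑ k ∈ A m, bumpBox m k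

theorem bumpSum_apply (S : Finset (Fin d → ℕ)) (A : (Fin d → ℕ) → Finset (Fin d → ℕ))
    (x : EuclideanSpace ℝ (Fin d)) : bumpSum S A x = ∑ m ∈ S, ∑ k ∈ A m, bumpBox m k x := by
  simp only [bumpSum, _root_.sum_apply]

variable {S : Finset (Fin d → ℕ)} {A : (Fin d → ℕ) → Finset (Fin d → ℕ)}

theorem bumpSum_eq_zero (hA : ∀ m ∈ S, A m ⊆ boxes m) {x : EuclideanSpace ℝ (Fin d)}
    (hx : x ∉ unitCube d) : bumpSum S A x = 0 := by
  rw [bumpSum_apply]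
  exact Finset.sum_eq_zero fun m hm => Finset.sum_eq_zero fun k hk =>
    bumpBox_eq_zero (hA m hm hk) hx

/-- The multiple of `bumpSum` as a tempered distribution. -/
def bumpDist (a : ℂ) (S : Finset (Fin d → ℕ)) (A : (Fin d → ℕ) → Finset (Fin d → ℕ)) :
    𝓢'(EuclideanSpace ℝ (Fin d), ℂ) :=
  SchwartzMap.toTemperedDistributionCLM (EuclideanSpace ℝ (Fin d)) ℂ volume (a • bumpSum S A)

theorem bumpDist_apply (a : ℂ) (φ : 𝓢(EuclideanSpace ℝ (Fin d), ℂ)) :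
    bumpDist a S A φ = ∫ x, φ x * (a * bumpSum S A x) := by
  exact SchwartzMap.toTemperedDistributionCLM_apply_apply volume (a • bumpSum S A) φ

theorem dsupport_bumpDist (a : ℂ) (hA : ∀ m ∈ S, A m ⊆ boxes m) :
    Distribution.dsupport (bumpDist a S A) ⊆ unitCube d := by
  intro x hx
  refine (Distribution.mem_dsupport_iff x).1 hx (unitCube d) (fun φ hφ => ?_) isClosed_unitCube
  rw [bumpDist_apply]
  have h : ∀ y, φ y * (a * bumpSum S A y) = 0 := by
    intro y
    by_cases hy : y ∈ unitCube d
    · rw [image_eq_zero_of_notMem_tsupport fun hy' => hφ hy' hy, zero_mul]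
    · rw [bumpSum_eq_zero hA hy, mul_zero, mul_zero]
  simp [h]

theorem Kernels.conv_bumpDist (Ψ : Kernels L) (j : Fin d → ℕ) (a : ℂ)
    (x : EuclideanSpace ℝ (Fin d)) : Ψ.conv j (bumpDist a S A) x =
      a * ∑ m ∈ S, ∑ k ∈ A m, ∏ i, Ψ.bumpMean (j i) (m i) (k i) (x i) := by
  have hint : ∀ m k, Integrable fun y => Ψ.test j x y * bumpBox m k y := by
    intro m k
    exact (bumpBox m k).integrable.bdd_mul (c := SchwartzMap.seminorm ℝ 0 0 (Ψ.test j x))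
      (Ψ.test j x).continuous.aestronglyMeasurable
      (Filter.Eventually.of_forall fun y => SchwartzMap.norm_le_seminorm ℝ _ _)
  have h1 : ∀ y, Ψ.test j x y * (a * bumpSum S A y) =
      a * ∑ m ∈ S, ∑ k ∈ A m, Ψ.test j x y * bumpBox m k y := by
    intro y
    rw [bumpSum_apply]
    simp_rw [← Finset.mul_sum]
    ring
  rw [conv, bumpDist_apply]
  simp_rw [h1]
  rw [integral_const_mul, integral_finsetSum _ fun m _ => integrable_finsetSum _ fun k _ => hint m k]
  congr 1
  refine Finset.sum_congr rfl fun m _ => ?_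
  rw [integral_finsetSum _ fun k _ => hint m k]
  refine Finset.sum_congr rfl fun k _ => ?_
  have h2 : ∀ y, Ψ.test j x y * bumpBox m k y =
      ∏ i, (Ψ.psi (j i) (x i - y i) * bump (2 ^ m i * y i - k i)) := by
    intro y
    rw [Finset.prod_mul_distrib, bumpBox_apply]
    rfl
  simp_rw [h2]
  exact integral_prod_coord fun i t => Ψ.psi (j i) (x i - t) * bump (2 ^ m i * t - k i)

/-- In each coordinate, for `j ≤ μ` the weight `2^{sj}` falls short of `2^{sμ}` by `2^{-s(μ-j)}`;
for `j > μ` the moments win against the weight by `2^{-(L+1-s)(j-μ)}`. The ratio `ρ = 2^{-δ}` with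
`δ = min(s, L + 1 - s)` covers both. -/
theorem Kernels.exists_norm_conv_bumpDist_le (Ψ : Kernels L) (d : ℕ) {s : ℝ} (hs : 0 < s)
    (hL : s < (L : ℝ) + 1) : ∃ C ρ : ℝ, 0 ≤ C ∧ 0 ≤ ρ ∧ ρ < 1 ∧
      ∀ (S : Finset (Fin d → ℕ)) (A : (Fin d → ℕ) → Finset (Fin d → ℕ)) (ℓ : ℕ),
        (∀ m ∈ S, A m ⊆ boxes m) → (∀ m ∈ S, ∑ i, m i = ℓ) → ∀ a j x,
        (2 : ℝ) ^ (s * ∑ i, (j i : ℝ)) * ‖Ψ.conv j (bumpDist a S A) x‖ ≤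
          ‖a‖ * C * 2 ^ (s * ℓ) * ∑ m ∈ S, geomProd ρ j m := by
  obtain ⟨C, hC, hb⟩ := Ψ.exists_sum_norm_bumpMean_le
  set δ := min s ((L : ℝ) + 1 - s) with hδ
  have hδ0 : 0 < δ := lt_min hs (by linarith)
  set ρ : ℝ := 2 ^ (-δ) with hρ
  have hρ0 : 0 < ρ := by positivity
  refine ⟨C ^ d, ρ, by positivity, hρ0.le,
    Real.rpow_lt_one_of_one_lt_of_neg (by norm_num) (by linarith),
    fun S A ℓ hA hS a j x => ?_⟩
  have key : ∀ j μ : ℕ, (2 : ℝ) ^ (s * (j : ℝ)) * ((2 : ℝ) ^ (L + 1))⁻¹ ^ (j - μ) ≤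
      2 ^ (s * (μ : ℝ)) * geomWeight ρ j μ := by
    intro j μ
    have h1 : ((2 : ℝ) ^ (L + 1))⁻¹ ^ (j - μ) = 2 ^ (-((L : ℝ) + 1) * ((j - μ : ℕ) : ℝ)) := by
      rw [Real.rpow_mul (by norm_num), Real.rpow_natCast, Real.rpow_neg (by norm_num)]
      congr 2
      rw [← Real.rpow_natCast]
      push_cast
      rfl
    rw [h1, geomWeight, hρ, ← Real.rpow_natCast (2 ^ (-δ)), ← Real.rpow_mul (by norm_num),
      ← Real.rpow_add (by norm_num), ← Real.rpow_add (by norm_num)]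
    refine Real.rpow_le_rpow_of_exponent_le (by norm_num) ?_
    have h2 : δ ≤ s := min_le_left _ _
    have h3 : δ ≤ (L : ℝ) + 1 - s := min_le_right _ _
    rcases le_total j μ with h | h
    · rw [Nat.sub_eq_zero_of_le h]
      have h4 : ((0 + (μ - j) : ℕ) : ℝ) = (μ : ℝ) - j := by
        rw [zero_add, Nat.cast_sub h]
      rw [h4]
      have : (j : ℝ) ≤ μ := by exact_mod_cast h
      simp only [Nat.cast_zero, mul_zero, add_zero]
      nlinarith
    · rw [Nat.sub_eq_zero_of_le h, add_zero, Nat.cast_sub h]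
      have : (μ : ℝ) ≤ j := by exact_mod_cast h
      nlinarith
  rw [Ψ.conv_bumpDist, norm_mul]
  have h1 : ‖∑ m ∈ S, ∑ k ∈ A m, ∏ i, Ψ.bumpMean (j i) (m i) (k i) (x i)‖ ≤
      ∑ m ∈ S, ∏ i, (C * ((2 : ℝ) ^ (L + 1))⁻¹ ^ (j i - m i)) := by
    refine (norm_sum_le _ _).trans (Finset.sum_le_sum fun m hm => (norm_sum_le _ _).trans ?_)
    calc ∑ k ∈ A m, ‖∏ i, Ψ.bumpMean (j i) (m i) (k i) (x i)‖
        ≤ ∑ k ∈ boxes m, ∏ i, ‖Ψ.bumpMean (j i) (m i) (k i) (x i)‖ := by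
          simp_rw [norm_prod]
          exact Finset.sum_le_sum_of_subset_of_nonneg (hA m hm)
            fun k _ _ => Finset.prod_nonneg fun i _ => norm_nonneg _
      _ = ∏ i, ∑ k ∈ Finset.range (2 ^ m i), ‖Ψ.bumpMean (j i) (m i) k (x i)‖ := by
          rw [Finset.prod_univ_sum]
          rfl
      _ ≤ _ := Finset.prod_le_prod
          (fun i _ => Finset.sum_nonneg fun k _ => norm_nonneg _) fun i _ => hb _ _ _ _
  have h2 : ∀ m ∈ S, (2 : ℝ) ^ (s * ∑ i, (j i : ℝ)) *
      ∏ i, (C * ((2 : ℝ) ^ (L + 1))⁻¹ ^ (j i - m i)) ≤ C ^ d * 2 ^ (s * ℓ) * geomProd ρ j m := by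
    intro m hm
    have h3 : (2 : ℝ) ^ (s * (ℓ : ℝ)) = ∏ i, (2 : ℝ) ^ (s * (m i : ℝ)) := by
      rw [← hS m hm, ← Real.rpow_sum_of_pos (by norm_num), ← Finset.mul_sum]
      push_cast
      rfl
    have h4 : (2 : ℝ) ^ (s * ∑ i, (j i : ℝ)) = ∏ i, (2 : ℝ) ^ (s * (j i : ℝ)) := by
      rw [← Real.rpow_sum_of_pos (by norm_num), ← Finset.mul_sum]
    have h5 : ∏ _i : Fin d, C = C ^ d := by simp
    rw [h3, h4, geomProd, ← h5, ← Finset.prod_mul_distrib, ← Finset.prod_mul_distrib,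
      ← Finset.prod_mul_distrib]
    refine Finset.prod_le_prod (fun i _ => by positivity) fun i _ => ?_
    calc (2 : ℝ) ^ (s * (j i : ℝ)) * (C * ((2 : ℝ) ^ (L + 1))⁻¹ ^ (j i - m i))
        = C * ((2 : ℝ) ^ (s * (j i : ℝ)) * ((2 : ℝ) ^ (L + 1))⁻¹ ^ (j i - m i)) := by ring
      _ ≤ C * (2 ^ (s * (m i : ℝ)) * geomWeight ρ (j i) (m i)) :=
          mul_le_mul_of_nonneg_left (key _ _) hC
      _ = _ := by ring
  calc _ ≤ (2 : ℝ) ^ (s * ∑ i, (j i : ℝ)) *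
        (‖a‖ * ∑ m ∈ S, ∏ i, (C * ((2 : ℝ) ^ (L + 1))⁻¹ ^ (j i - m i))) := by gcongr
    _ = ‖a‖ * ∑ m ∈ S, (2 : ℝ) ^ (s * ∑ i, (j i : ℝ)) *
          ∏ i, (C * ((2 : ℝ) ^ (L + 1))⁻¹ ^ (j i - m i)) := by
        rw [← Finset.mul_sum]
        ring
    _ ≤ ‖a‖ * ∑ m ∈ S, C ^ d * 2 ^ (s * ℓ) * geomProd ρ j m :=
        mul_le_mul_of_nonneg_left (Finset.sum_le_sum h2) (norm_nonneg a)
    _ = _ := by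
        rw [← Finset.mul_sum]
        ring

/-- The norm of sums of bumps. -/
theorem Kernels.exists_fNorm_bumpDist_le (Ψ : Kernels L) (d : ℕ) {s p : ℝ} {θ : ℝ≥0∞}
    (hs : 0 < s) (hL : s < (L : ℝ) + 1) (hp : 1 ≤ p) (hθ : 1 ≤ θ) : ∃ K : ℝ≥0∞, K ≠ ⊤ ∧
      ∀ (S : Finset (Fin d → ℕ)) (A : (Fin d → ℕ) → Finset (Fin d → ℕ)) (ℓ : ℕ),
        (∀ m ∈ S, A m ⊆ boxes m) → (∀ m ∈ S, ∑ i, m i = ℓ) → ∀ a,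
        Ψ.fNorm s p θ (bumpDist a S A) ≤
          K * ENNReal.ofReal (‖a‖ * (2 ^ (s * ℓ) * (S.card : ℝ) ^ (θ⁻¹).toReal)) := by
  obtain ⟨C, ρ, hC, hρ0, hρ1, h⟩ := Ψ.exists_norm_conv_bumpDist_le d hs hL
  obtain ⟨R, hR, hcube⟩ := Ψ.exists_cube d
  have hp0 : 0 < p := by linarith
  set v := volume (cube d R)
  have hv : v ^ (1 / p) ≠ ⊤ :=
    ENNReal.rpow_ne_top_of_nonneg (by positivity) (isCompact_cube R).measure_lt_top.ne
  set W := ENNReal.ofReal (2 * (1 - ρ)⁻¹) ^ d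
  have hW : W ≠ ⊤ := ENNReal.pow_ne_top ENNReal.ofReal_ne_top
  have hC' : ENNReal.ofReal C ≠ ⊤ := ENNReal.ofReal_ne_top
  refine ⟨ENNReal.ofReal C * W * v ^ (1 / p), by finiteness, fun S A ℓ hA hS a => ?_⟩
  set f := bumpDist a S A
  set B := ENNReal.ofReal (‖a‖ * C * 2 ^ (s * ℓ)) * W * (S.card : ℝ≥0∞) ^ (θ⁻¹).toReal with hB
  -- The bound is uniform in `x`, and the local means live in a fixed cube, so passing to `L_p`
  -- costs only a power of its volume.
  have h1 : ∀ x, seqNorm θ (Ψ.term s f x) ≤ B := by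
    intro x
    refine seqNorm_sum_geomProd_le hθ hρ0 hρ1 S fun j => ?_
    rw [term, ← ofReal_norm, ← ENNReal.ofReal_mul (by positivity),
      ← ENNReal.ofReal_sum_of_nonneg fun m _ => geomProd_nonneg hρ0 j m,
      ← ENNReal.ofReal_mul (by positivity)]
    exact ENNReal.ofReal_le_ofReal (h S A ℓ hA hS a j x)
  have h2 : ∀ x, x ∉ cube d R → seqNorm θ (Ψ.term s f x) = 0 := by
    intro x hx
    have h3 := seqNorm_le_of_tsum_le hθ (a := Ψ.term s f x) (A := 0) (N := 1)
    have h4 : ∀ j, Ψ.term s f x j = 0 := fun j => by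
      rw [term, hcube f (dsupport_bumpDist a hA) j x hx, enorm_zero, mul_zero]
    simpa [h4] using h3
  rw [Ψ.fNorm_eq]
  have h5 : ∫⁻ x, seqNorm θ (Ψ.term s f x) ^ p ≤ B ^ p * v := by
    have h6 : ∫⁻ x, seqNorm θ (Ψ.term s f x) ^ p =
        ∫⁻ x in cube d R, seqNorm θ (Ψ.term s f x) ^ p := by
      refine (setLIntegral_eq_of_support_subset fun x hx => ?_).symm
      by_contra hxc
      exact hx (by simp only [h2 x hxc, ENNReal.zero_rpow_of_pos hp0])
    rw [h6]
    refine (lintegral_mono fun x => ENNReal.rpow_le_rpow (h1 x) hp0.le).trans (le_of_eq ?_)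
    simp [v]
  refine (ENNReal.rpow_le_rpow h5 (by positivity)).trans (le_of_eq ?_)
  rw [ENNReal.mul_rpow_of_nonneg _ _ (by positivity), ← ENNReal.rpow_mul,
    mul_one_div_cancel hp0.ne', ENNReal.rpow_one, hB, ← ENNReal.ofReal_natCast,
    ENNReal.ofReal_rpow_of_nonneg (by positivity) ENNReal.toReal_nonneg, mul_right_comm ‖a‖,
    ENNReal.ofReal_mul (by positivity), ← mul_assoc ‖a‖,
    ENNReal.ofReal_mul (p := ‖a‖ * 2 ^ (s * ℓ)) (by positivity)]
  ring

end BumpSums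

/-! ### The lower bound. -/

section Lower

variable {L d : ℕ} {ξ : Fin d → ℝ} {s p : ℝ} {θ : ℝ≥0∞}

/-- All coordinates but the first may be chosen freely in `{0, …, ⌊ℓ/d⌋}`; the first one makes up
the rest of `ℓ`. -/
theorem le_card_levelSet (hd : 1 ≤ d) (ℓ : ℕ) : (ℓ / d + 1) ^ (d - 1) ≤ (levelSet d ℓ).card := by
  obtain ⟨e, rfl⟩ : ∃ e, d = e + 1 := ⟨d - 1, by omega⟩
  have h : (Fintype.piFinset fun _ : Fin e => Finset.range (ℓ / (e + 1) + 1)).card ≤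
      (levelSet (e + 1) ℓ).card := by
    refine Finset.card_le_card_of_injOn
      (fun v => (Fin.cons (ℓ - ∑ i, v i) v : Fin (e + 1) → ℕ)) (fun v hv => ?_)
      fun v _ v' _ h => ?_
    · have h1 : ∑ i, v i ≤ e * (ℓ / (e + 1)) := by
        refine (Finset.sum_le_card_nsmul Finset.univ v (ℓ / (e + 1)) fun i _ => ?_).trans
          (by simp)
        have := Finset.mem_range.1 (Fintype.mem_piFinset.1 hv i)
        omega
      have h2 : (e + 1) * (ℓ / (e + 1)) ≤ ℓ := Nat.mul_div_le _ _
      rw [add_mul] at h2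
      refine Finset.mem_coe.2 (mem_levelSet.2 ?_)
      rw [Fin.sum_univ_succ]
      simp only [Fin.cons_zero, Fin.cons_succ]
      omega
    · exact (Fin.cons_injective2 h).2
  rw [Fintype.card_piFinset] at h
  simpa using h

theorem IsFrolovRoots.exists_card_nodes_le (hξ : IsFrolovRoots ξ) (hd : 1 ≤ d) :
    ∃ C : ℕ, ∀ (n : ℕ) (hn : 1 ≤ n), (finite_nodes hξ hn).toFinset.card ≤ C * n := by
  obtain ⟨N, hN1, hN, -⟩ := hξ.exists_nat_mul_separation zero_le_one
  refine ⟨3 ^ d * N, fun n hn => ?_⟩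
  have hfin := finite_nodes hξ hn
  set S : Set (Fin d → ℤ) := {k | ∀ i, 0 ≤ latticePoint ξ n k i ∧ latticePoint ξ n k i < 1} with hS
  have hSf : S.Finite := by
    rw [nodes_eq_image] at hfin
    exact hfin.of_finite_image (hξ.latticePoint_injective hd hn).injOn
  have h1 : (finite_nodes hξ hn).toFinset.card ≤ hSf.toFinset.card := by
    rw [← Set.ncard_eq_toFinset_card _ _, ← Set.ncard_eq_toFinset_card _ _, nodes_eq_image]
    exact Set.ncard_image_le hSf
  refine h1.trans ?_
  rw [mul_assoc]
  refine hξ.card_mem_cube_le hd le_rfl hn (N := N * n) ?_ 0 _ fun k hk i => ?_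
  · have hn' : (0 : ℝ) ≤ n := Nat.cast_nonneg n
    push_cast
    rw [zero_add, one_pow, mul_right_comm]
    exact mul_le_mul_of_nonneg_right hN hn'
  · have := (hSf.mem_toFinset.1 hk) i
    rw [sub_zero, neg_zero, add_zero]
    exact ⟨this.1, this.2.le⟩

open Classical in
/-- The boxes of level `m` on which no point of `F` meets the support of the bump. -/
def avoiding (F : Finset (EuclideanSpace ℝ (Fin d))) (m : Fin d → ℕ) : Finset (Fin d → ℕ) :=
  (boxes m).filter fun k => ∀ x ∈ F, bumpBox m k x = 0

theorem avoiding_subset (F : Finset (EuclideanSpace ℝ (Fin d))) (m : Fin d → ℕ) :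
    avoiding F m ⊆ boxes m := Finset.filter_subset _ _

/-- Bumps of the same level have disjoint supports: a point can meet only the box with index
`⌊2^{m_i} x_i⌋`, so at most `#F` boxes are lost. -/
theorem le_card_avoiding (F : Finset (EuclideanSpace ℝ (Fin d))) (m : Fin d → ℕ) :
    2 ^ ∑ i, m i ≤ (avoiding F m).card + F.card := by
  classical
  rw [← card_boxes, avoiding, ← Finset.card_filter_add_card_filter_not (s := boxes m)
    (fun k => ∀ x ∈ F, bumpBox m k x = 0)]
  refine add_le_add (le_of_eq (by congr)) ?_
  refine (Finset.card_le_card fun k hk => ?_).trans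
    (Finset.card_image_le (s := F) (f := fun x i => ⌊(2 : ℝ) ^ m i * x i⌋₊))
  have hk := (Finset.mem_filter.1 hk).2
  push Not at hk
  obtain ⟨x, hx, h⟩ := hk
  refine Finset.mem_image.2 ⟨x, hx, funext fun i => ?_⟩
  rw [bumpBox_apply] at h
  have h1 := mem_of_bump_ne_zero ((Finset.prod_ne_zero_iff.1 h) i (Finset.mem_univ i))
  have h2 : (0 : ℝ) ≤ k i := Nat.cast_nonneg _
  rw [Nat.floor_eq_iff (by linarith [h1.1])]
  exact ⟨by linarith [h1.1], by linarith [h1.2]⟩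

theorem bumpSum_avoiding_eq_zero {F : Finset (EuclideanSpace ℝ (Fin d))}
    (S : Finset (Fin d → ℕ)) {x : EuclideanSpace ℝ (Fin d)} (hx : x ∈ F) :
    bumpSum S (avoiding F) x = 0 := by
  rw [bumpSum_apply]
  exact Finset.sum_eq_zero fun m _ => Finset.sum_eq_zero fun k hk =>
    (Finset.mem_filter.1 hk).2 x hx

theorem integral_bumpSum {S : Finset (Fin d → ℕ)} {A : (Fin d → ℕ) → Finset (Fin d → ℕ)} {ℓ : ℕ}
    (hS : ∀ m ∈ S, ∑ i, m i = ℓ) : ∫ x, bumpSum S A x =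
      (((∑ m ∈ S, ((A m).card : ℝ)) * (((2 : ℝ) ^ ℓ)⁻¹ * (∫ t, bumpBase t) ^ d) : ℝ) : ℂ) := by
  simp_rw [bumpSum_apply]
  rw [integral_finsetSum _ fun m _ => integrable_finsetSum _ fun k _ => (bumpBox m k).integrable,
    Finset.sum_mul, Complex.ofReal_sum]
  refine Finset.sum_congr rfl fun m hm => ?_
  rw [integral_finsetSum _ fun k _ => (bumpBox m k).integrable]
  simp_rw [integral_bumpBox]
  rw [hS m hm, Finset.sum_const, nsmul_eq_mul]
  push_cast
  rfl

/-- The continuous representative is unique, so the infimum defining the error concerns this one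
function, on which the rule vanishes. -/
theorem enorm_integral_le_ruleError {n : ℕ} {S : Finset (Fin d → ℕ)}
    {A : (Fin d → ℕ) → Finset (Fin d → ℕ)}
    (h0 : ∀ x ∈ nodes ξ n, bumpSum S A x = 0) (a : ℂ) :
    ‖a * ∫ x, bumpSum S A x‖ₑ ≤ ruleError ξ n (bumpDist a S A) := by
  refine le_iInf₂ fun g hg => le_of_eq ?_
  have hgeq : ∀ x, g x = a * bumpSum S A x := by
    intro x
    refine eqOn_of_forall_integral_eq hg.1 (continuous_const.mul (bumpSum S A).continuous)
      isOpen_univ (fun φ _ _ => ?_) (Set.mem_univ x)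
    rw [← hg.2.2 φ, bumpDist_apply]
    rfl
  have h1 : ∫ x in unitCube d, g x = a * ∫ x, bumpSum S A x := by
    rw [setIntegral_eq_integral_of_forall_compl_eq_zero hg.2.1]
    simp_rw [hgeq]
    exact integral_const_mul _ _
  have h2 : rule ξ n g = 0 := by
    rw [rule]
    have : ∀ x ∈ nodes ξ n, g x = 0 := fun x hx => by rw [hgeq, h0 x hx, mul_zero]
    rw [finsum_mem_congr rfl this]
    simp
  rw [h1, h2, sub_zero]

/-- The lower bound. -/
theorem IsFrolovRoots.exists_le_worstCaseError (hξ : IsFrolovRoots ξ) (hd : 1 ≤ d) (Ψ : Kernels L)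
    (hs : 0 < s) (hL : s < (L : ℝ) + 1) (hp : 1 ≤ p) (hθ : 1 ≤ θ) :
    ∃ c : ℝ, 0 < c ∧ ∀ n : ℕ, 1 ≤ n →
      ENNReal.ofReal (c * ((n : ℝ) ^ (-s) *
        Real.log n ^ (((d : ℝ) - 1) * (1 - (θ⁻¹).toReal)))) ≤ worstCaseError ξ n Ψ s p θ := by
  obtain ⟨K, hK, hnorm⟩ := Ψ.exists_fNorm_bumpDist_le d hs hL hp hθ
  obtain ⟨C, hC⟩ := hξ.exists_card_nodes_le hd
  have hτ1 := inv_toReal_le_one hθ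
  set τ := (θ⁻¹).toReal
  set K' := K.toReal + 1
  have hK' : 0 < K' := by positivity
  set I := ∫ t, bumpBase t
  have hI : 0 < I := bumpBase.integral_pos
  set M : ℝ := 2 ^ (2 * C + 1)
  have hd' : (0 : ℝ) < d := by exact_mod_cast hd
  set β := ((d : ℝ) - 1) * (1 - τ)
  refine ⟨I ^ d / (2 * K') * (M ^ (-s) * ((d : ℝ)⁻¹) ^ β), by positivity, fun n hn => ?_⟩
  have hn' : (0 : ℝ) < n := by exact_mod_cast hn
  have hlog : 0 ≤ Real.log n := Real.log_natCast_nonneg n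
  set F := (finite_nodes hξ hn).toFinset
  -- Since `2C ≤ 2^{2C}`, the number `2^ℓ` is at least twice the number of nodes, while it remains
  -- below `M n`.
  set ℓ := Nat.log 2 n + 1 + 2 * C with hℓ
  set S := levelSet d ℓ
  have hS : ∀ m ∈ S, ∑ i, m i = ℓ := fun m hm => mem_levelSet.1 hm
  have hA : ∀ m ∈ S, avoiding F m ⊆ boxes m := fun m _ => avoiding_subset F m
  have hlt : n < 2 ^ (Nat.log 2 n + 1) := Nat.lt_pow_succ_log_self (by norm_num) n
  have hle : 2 ^ Nat.log 2 n ≤ n := Nat.pow_log_le_self 2 (by omega)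
  have hF : 2 * F.card ≤ 2 ^ ℓ := by
    have h1 : F.card ≤ C * n := hC n hn
    have h2 : 2 * C ≤ 2 ^ (2 * C) := Nat.lt_two_pow_self.le
    calc 2 * F.card ≤ n * (2 * C) := by linarith
      _ ≤ 2 ^ (Nat.log 2 n + 1) * 2 ^ (2 * C) := Nat.mul_le_mul hlt.le h2
      _ = 2 ^ ℓ := (pow_add _ _ _).symm
  have hℓn : (2 : ℝ) ^ ℓ ≤ M * n := by
    have : (2 : ℝ) ^ ℓ = M * 2 ^ Nat.log 2 n := by rw [← pow_add]; congr 1; omega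
    rw [this]
    exact mul_le_mul_of_nonneg_left (by exact_mod_cast hle) (by positivity)
  have hnℓ : Real.log n ≤ ℓ := by
    have h1 : Real.log n ≤ Real.log (2 ^ ℓ) := by
      refine Real.log_le_log hn' ?_
      have : n ≤ 2 ^ ℓ := hlt.le.trans (Nat.pow_le_pow_right (by norm_num) (by omega))
      exact_mod_cast this
    rw [Real.log_pow] at h1
    refine h1.trans (mul_le_of_le_one_right (Nat.cast_nonneg _) ?_)
    linarith [Real.log_two_lt_d9]
  set G : ℝ := (S.card : ℝ)
  have hG : ((d : ℝ)⁻¹ * Real.log n) ^ ((d : ℝ) - 1) ≤ G := by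
    have h1 : ((ℓ / d + 1 : ℕ) : ℝ) ^ (d - 1) ≤ G := by
      rw [← Nat.cast_pow]
      exact Nat.cast_le.2 (le_card_levelSet hd ℓ)
    refine le_trans ?_ h1
    have h2 : ((d : ℝ) - 1) = ((d - 1 : ℕ) : ℝ) := by rw [Nat.cast_sub hd, Nat.cast_one]
    rw [h2, Real.rpow_natCast]
    refine pow_le_pow_left₀ (by positivity) ?_ _
    rw [inv_mul_le_iff₀ hd']
    refine hnℓ.trans ?_
    have : ℓ < d * (ℓ / d + 1) := Nat.lt_mul_div_succ ℓ hd
    exact_mod_cast this.le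
  have hG0 : 0 < G := by
    have : 0 < S.card := lt_of_lt_of_le (by positivity) (le_card_levelSet hd ℓ)
    exact Nat.cast_pos.2 this
  -- Up to `K'`, this is the norm bound for the unscaled sum of bumps; the coefficient `a`
  -- normalises it to one.
  set X : ℝ := 2 ^ (s * ℓ) * G ^ τ
  have hX : 0 < X := by positivity
  set a : ℝ := (K' * X)⁻¹
  have ha : 0 < a := by positivity
  set f := bumpDist (a : ℂ) S (avoiding F)
  have hf1 : Ψ.fNorm s p θ f ≤ 1 := by
    refine (hnorm S (avoiding F) ℓ hA hS a).trans ((mul_ofReal_le hK _).trans ?_)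
    rw [Complex.norm_real, Real.norm_of_nonneg ha.le, ← ENNReal.ofReal_one]
    refine ENNReal.ofReal_le_ofReal (le_of_eq ?_)
    change K' * ((K' * X)⁻¹ * X) = 1
    field_simp
  have hmem : f ∈ {f ∈ Ψ.fSpace d s p θ | Ψ.fNorm s p θ f ≤ 1} :=
    ⟨⟨lt_of_le_of_lt hf1 ENNReal.one_lt_top, dsupport_bumpDist _ hA⟩, hf1⟩
  refine le_trans ?_ (le_iSup₂ (f := fun f (_ : f ∈ {f ∈ Ψ.fSpace d s p θ |
    Ψ.fNorm s p θ f ≤ 1}) => ruleError ξ n f) f hmem)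
  refine le_trans ?_ (enorm_integral_le_ruleError
    (fun x hx => bumpSum_avoiding_eq_zero S ((finite_nodes hξ hn).mem_toFinset.2 hx)) (a : ℂ))
  rw [integral_bumpSum hS, ← Complex.ofReal_mul, ← ofReal_norm, Complex.norm_real]
  refine ENNReal.ofReal_le_ofReal (le_trans ?_ (le_abs_self _))
  -- At every `m` of level `ℓ`, at least half of the `2^ℓ` boxes avoid the nodes. The factor `2^ℓ`
  -- cancels against the integral of one bump, so the total integral is of the order `G`.
  have hcard : G * (2 ^ ℓ / 2) ≤ ∑ m ∈ S, ((avoiding F m).card : ℝ) := by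
    rw [← nsmul_eq_mul]
    refine Finset.card_nsmul_le_sum _ _ _ fun m hm => ?_
    have h1 := le_card_avoiding F m
    rw [hS m hm] at h1
    have h2 : 2 ^ ℓ ≤ 2 * (avoiding F m).card := by omega
    have h3 : (2 : ℝ) ^ ℓ ≤ 2 * (avoiding F m).card := by exact_mod_cast h2
    linarith
  have hGτ : ((d : ℝ)⁻¹) ^ β * Real.log n ^ β ≤ G ^ (1 - τ) := by
    rw [← Real.mul_rpow (by positivity) hlog, Real.rpow_mul (by positivity)]
    exact Real.rpow_le_rpow (by positivity) hG (by linarith)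
  have h2s : M ^ (-s) * (n : ℝ) ^ (-s) ≤ (2 ^ (s * (ℓ : ℝ)))⁻¹ := by
    rw [← Real.mul_rpow (by positivity) hn'.le, mul_comm s, Real.rpow_mul (by norm_num),
      Real.rpow_natCast, ← Real.rpow_neg (by positivity)]
    exact Real.rpow_le_rpow_of_nonpos (by positivity) hℓn (by linarith)
  calc _ = I ^ d / (2 * K') * ((M ^ (-s) * (n : ℝ) ^ (-s)) * (((d : ℝ)⁻¹) ^ β * Real.log n ^ β)) := by
        ring
    _ ≤ I ^ d / (2 * K') * ((2 ^ (s * (ℓ : ℝ)))⁻¹ * G ^ (1 - τ)) := by gcongr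
    _ = a * (G * (2 ^ ℓ / 2) * (((2 : ℝ) ^ ℓ)⁻¹ * I ^ d)) := by
        rw [Real.rpow_sub hG0, Real.rpow_one]
        change _ = (K' * (2 ^ (s * ℓ) * G ^ τ))⁻¹ * _
        field_simp
    _ ≤ _ := by gcongr

end Lower

end

end Frolov

/-! ### The three regimes combined. -/

theorem theorem5p2 (d : ℕ) (hd : 1 ≤ d) (ξ : Fin d → ℝ) (hξ : Frolov.IsFrolovRoots ξ)
    (p : ℝ) (hp : 1 ≤ p) (θ : ENNReal) (hθ : 1 ≤ θ) (s : ℝ) (hs : 1 / p < s)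
    (L : ℕ) (hL : s < (L : ℝ) + 1) (Ψ : Frolov.Kernels L) :
    ((θ⁻¹).toReal < s → ∃ c C : ℝ, 0 < c ∧ 0 < C ∧ ∀ n : ℕ, 2 ≤ n →
      ENNReal.ofReal (c * ((n : ℝ) ^ (-s) *
          Real.log n ^ (((d : ℝ) - 1) * (1 - (θ⁻¹).toReal)))) ≤
        Frolov.worstCaseError ξ n Ψ s p θ ∧
      Frolov.worstCaseError ξ n Ψ s p θ ≤
        ENNReal.ofReal (C * ((n : ℝ) ^ (-s) *
          Real.log n ^ (((d : ℝ) - 1) * (1 - (θ⁻¹).toReal))))) ∧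
    (s < (θ⁻¹).toReal → ∃ C : ℝ, 0 < C ∧ ∀ n : ℕ, 2 ≤ n →
      Frolov.worstCaseError ξ n Ψ s p θ ≤
        ENNReal.ofReal (C * ((n : ℝ) ^ (-s) *
          Real.log n ^ (((d : ℝ) - 1) * (1 - s))))) ∧
    (s = (θ⁻¹).toReal → ∃ C : ℝ, 0 < C ∧ ∀ n : ℕ, 3 ≤ n →
      Frolov.worstCaseError ξ n Ψ s p θ ≤
        ENNReal.ofReal (C * ((n : ℝ) ^ (-s) *
          Real.log n ^ (((d : ℝ) - 1) * (1 - s)) *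
          Real.log (Real.log n) ^ (1 - s)))) := by
  refine ⟨fun hsθ => ?_, hξ.worstCaseError_le_of_gt hd Ψ hp hθ hs,
    hξ.worstCaseError_le_of_eq hd Ψ hp hθ hs⟩
  have hs0 : 0 < s := lt_trans (by positivity) hs
  obtain ⟨c, hc, hlower⟩ := hξ.exists_le_worstCaseError hd Ψ hs0 hL hp hθ
  obtain ⟨C, hC, hupper⟩ := hξ.worstCaseError_le_of_lt hd Ψ hp hθ hs hsθ
  exact ⟨c, C, hc, hC, fun n hn => ⟨hlower n (by omega), hupper n hn⟩⟩
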